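/- **Setting.** Let $N\ge 1$, $s\in(0,\tfrac2N)$, $\tilde s\in[0,\tfrac{2}{N-2})$ ($\tilde s\in[0,\infty)$ if $N=1,2$), and let $\lambda\in L^\infty(\mathbb R^N)$ be real valued. Let $\eta\in L^2(\mathbb R^N)\cap C^2(\mathbb R^N)$ be a positive, spherically symmetric solution of $-\Delta\eta+\eta-\eta^{2s+1}=0$. Let $\omega(u,v)=\Im\int u\bar v\,dx$. For $\sigma=(a,v,\gamma,\mu)\in\mathbb R^N\times\mathbb R^N\times\mathbb R\times(0,\infty)$ let $$(T_\sigma u)(x)=e^{i(\frac12 v\cdot(x-a)+\gamma)}\mu^{\frac1{2s}}u(\sqrt\mu(x-a)),\qquad \eta_\sigma=T_\sigma\eta .$$ Let $m(\mu)=\tfrac12\int\eta_{(0,0,0,\mu)}^2\,dx$, and let $\mathsf g$ be the real span of $$e_i=-\partial_{x_i},\quad e_{i+N}=ix_i\ (1\le i\le N),\quad e_{2N+1}=i,\quad e_{2N+2}=\tfrac1{2s}+\tfrac12x\cdot\partial_x,$$ with $\|X\|=\max_\alpha|X_\alpha|$ for $X=\sum_\alpha X_\alpha e_\alpha$. Define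 $P(u)=\sum_{\alpha=1}^{2N+2} P_\alpha(u)e_\alpha$ by $$P_i(u)=-\tfrac1{m(1)}\,\omega(u,e_{i+N}\eta),\quad P_{i+N}(u)=\tfrac1{m(1)}\,\omega(u,e_i\eta)\quad(1\le i\le N),$$ $$P_{2N+1}(u)=\tfrac1{m'(1)}\,\omega(u,e_{2N+2}\eta),\quad P_{2N+2}(u)=-\tfrac1{m'(1)}\,\omega(u,e_{2N+1}\eta).$$ Let $I\subset(0,\infty)$ be bounded. For $I_0\subset I\setminus\partial I$ and $\delta>0$ let $U_\delta$ be the set of $\psi\in H^1(\mathbb R^N,\mathbb C)$ such that $\inf\|\psi-\eta_\sigma\|_{H^1}\le\delta$, the infimum being over $\sigma\in\mathbb R^N\times\mathbb R^N\times[0,2\pi)\times I_0$. Given $T>0$, $\epsilon\in[0,1)$, a function $\psi$ on $[0,T]$ with values in $H^1$, and a differentiable path $\sigma(t)=(a(t),v(t),\gamma(t),\mu(t))$ on $[0,T]$, put $w(t)=T_{\sigma(t)}^{-1}(\psi(t)-\eta_{\sigma(t)})$, so that $\psi(t)=T_{\sigma(t)}(\eta+w(t))$, and $$\tilde X(t)=\sum_{i=1}^N(v_i-\dot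 a_i)\sqrt\mu\,e_i-\sum_{i=1}^N\frac{\dot v_i}{2\sqrt\mu}\,e_{i+N}+\Big(\mu-\dot\gamma+\frac{\dot a\cdot v}2-\frac{|v|^2}4\Big)e_{2N+1}-\frac{\dot\mu}\mu\,e_{2N+2},$$ $$Y(t)=\tilde X(t)-\epsilon\,\mu^{\tilde s/s}\,P\big(i\,\lambda(\tfrac{x}{\sqrt\mu}+a)\,\eta^{2\tilde s+1}\big),$$ where $a,v,\gamma,\mu$ and their derivatives are evaluated at $t$. **Proposition 3.1.** There are constants $c\in(0,1)$ and $C>0$, depending only on $N,s,\tilde s,\lambda,\eta,I$ (in particular not on $\epsilon$, $t$, $T$, $\delta$, $\psi$ or $\sigma$), such that the following holds for all $I_0\subset I\setminus\partial I$, $\epsilon\in[0,1)$, $\delta>0$ and $T>0$. Suppose that * $\psi\in C([0,T],H^1)$ satisfies $i\partial_t\psi=-\Delta\psi-|\psi|^{2s}\psi+\epsilon\lambda(x)|\psi|^{2\tilde s}\psi$ in $H^{-1}$ on $[0,T]$; * $\psi(t)\in U_\delta$ for all $t\in[0,T]$; * $\sigma$ is a differentiable path on $[0,T]$ with $\mu(t)\in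 I$ and $\omega(\psi(t)-\eta_{\sigma(t)},\,Z\,\eta_{\sigma(t)})=0$ for all $Z\in\mathsf g$ and all $t\in[0,T]$ (skew-orthogonal decomposition). Then, for every $t\in[0,T]$ with $\|w(t)\|_{H^1}<c$, $$\|Y(t)\|\le C\big(\epsilon\|w(t)\|_{H^1}+\|w(t)\|_{H^1}^2\big).$$ -/

import Mathlib

open MeasureTheory Set
open scoped ContDiff ComplexConjugate ENNReal

namespace SolitonNLS

noncomputable section

/-- Configuration space `ℝ^N` with its Euclidean norm. -/
abbrev Space (N : ℕ) := EuclideanSpace ℝ (Fin N)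

/-- The `i`-th standard basis vector. -/
def basisVec {N : ℕ} (i : Fin N) : Space N := EuclideanSpace.single i (1 : ℝ)

/-- The classical partial derivative `∂_{x_i} u`. -/
def partialDeriv {N : ℕ} (i : Fin N) (u : Space N → ℂ) (x : Space N) : ℂ :=
  fderiv ℝ u x (basisVec i)

/-! ### The Sobolev space `H¹(ℝ^N, ℂ)`

Elements are represented by functions; all notions below only depend on the a.e. class. -/

/-- `g` is the weak partial derivative of `u` in direction `i`. -/
def IsWeakPartial {N : ℕ} (i : Fin N) (u g : Space N → ℂ) : Prop :=
  ∀ φ : Space N → ℝ, ContDiff ℝ ∞ φ → HasCompactSupport φ →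
    ∫ x, u x * ((fderiv ℝ φ x (basisVec i) : ℝ) : ℂ) = - ∫ x, g x * (φ x : ℂ)

/-- `u ∈ H¹`: `u` and all its first weak partial derivatives are square integrable. -/
def MemH1 {N : ℕ} (u : Space N → ℂ) : Prop :=
  MemLp u 2 volume ∧ ∀ i : Fin N, ∃ g : Space N → ℂ, MemLp g 2 volume ∧ IsWeakPartial i u g

open Classical in
/-- The square integrable weak partial derivative of `u` (unique up to null sets); it is `0` by
convention if there is none. -/
def weakPartial {N : ℕ} (i : Fin N) (u : Space N → ℂ) : Space N → ℂ :=
  if h : ∃ g : Space N → ℂ, MemLp g 2 volume ∧ IsWeakPartial i u g then h.choose else 0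

/-- `‖u‖_{H¹} = (‖u‖²_{L²} + ‖∇u‖²_{L²})^{1/2}`, for `u ∈ H¹`. -/
def normH1 {N : ℕ} (u : Space N → ℂ) : ℝ :=
  Real.sqrt ((∫ x, ‖u x‖ ^ 2) + ∑ i : Fin N, ∫ x, ‖weakPartial i u x‖ ^ 2)

/-- The symplectic form `ω(u, v) = Im ∫ u v̄`. -/
def sympl {N : ℕ} (u v : Space N → ℂ) : ℝ :=
  (∫ x, u x * conj (v x)).im

/-! ### The perturbed nonlinear Schrödinger equation -/

/-- The gauge invariant power `z ↦ |z|^{2p} z`. -/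
def powNL (p : ℝ) (z : ℂ) : ℂ := ((‖z‖ ^ (2 * p) : ℝ) : ℂ) * z

/-- The pairing of `-Δu - |u|^{2s} u + ε λ |u|^{2s̃} u ∈ H^{-1}` with `φ ∈ H¹`, that is
`∫ ∇u·∇φ̄ - ∫ |u|^{2s} u φ̄ + ε ∫ λ |u|^{2s̃} u φ̄`. -/
def energyGradPairing {N : ℕ} (s st : ℝ) (lam : Space N → ℝ) (ε : ℝ) (u φ : Space N → ℂ) : ℂ :=
  (∑ i : Fin N, ∫ x, weakPartial i u x * conj (weakPartial i φ x))
    - (∫ x, powNL s (u x) * conj (φ x))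
    + (ε : ℂ) * ∫ x, (lam x : ℂ) * powNL st (u x) * conj (φ x)

/-- `ψ ∈ C([0,T], H¹)` solves `i ∂_t ψ = -Δψ - |ψ|^{2s} ψ + ε λ |ψ|^{2s̃} ψ` in
`H^{-1} = (H¹)*` on `[0,T]`: the equation is tested against every element of `H¹`, with one-sided
time derivatives at the end points. -/
structure IsNLSSolution {N : ℕ} (s st : ℝ) (lam : Space N → ℝ) (ε T : ℝ)
    (ψ : ℝ → Space N → ℂ) : Prop where
  memH1 : ∀ t ∈ Icc 0 T, MemH1 (ψ t)
  continuous : ∀ t ∈ Icc 0 T,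
    Filter.Tendsto (fun r => normH1 (fun x => ψ r x - ψ t x)) (nhdsWithin t (Icc 0 T)) (nhds 0)
  equation : ∀ t ∈ Icc 0 T, ∀ φ : Space N → ℂ, MemH1 φ →
    HasDerivWithinAt (fun r => ∫ x, ψ r x * conj (φ x))
      (-Complex.I * energyGradPairing s st lam ε (ψ t) φ) (Icc 0 T) t

/-! ### Solitons, the symmetry group and its Lie algebra -/

/-- A soliton profile with `μ = 1`: a positive, spherically symmetric function in `L² ∩ C²` with
`-Δη + η - η^{2s+1} = 0`. -/
structure IsSolitonProfile {N : ℕ} (s : ℝ) (η : Space N → ℝ) : Prop where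
  memL2 : MemLp η 2 volume
  contDiff : ContDiff ℝ 2 η
  pos : ∀ x, 0 < η x
  radial : ∀ x y, ‖x‖ = ‖y‖ → η x = η y
  equation : ∀ x, -(Laplacian.laplacian η x) + η x - η x ^ (2 * s + 1) = 0

/-- A real function regarded as a complex valued one. -/
def toC {N : ℕ} (η : Space N → ℝ) : Space N → ℂ := fun x => (η x : ℂ)

/-- Parameters `σ = (a, v, γ, μ)`. -/
structure Param (N : ℕ) where
  a : Space N
  v : Space N
  γ : ℝ
  μ : ℝ

/-- `(T_σ u)(x) = e^{i(v·(x-a)/2 + γ)} μ^{1/(2s)} u(√μ (x - a))`. -/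
def trans {N : ℕ} (s : ℝ) (σ : Param N) (u : Space N → ℂ) : Space N → ℂ := fun x =>
  Complex.exp (Complex.I * (((1 / 2) * inner ℝ σ.v (x - σ.a) + σ.γ : ℝ) : ℂ)) *
    ((σ.μ ^ (1 / (2 * s)) : ℝ) : ℂ) * u (Real.sqrt σ.μ • (x - σ.a))

/-- The inverse transformation `T_σ⁻¹`. -/
def transInv {N : ℕ} (s : ℝ) (σ : Param N) (u : Space N → ℂ) : Space N → ℂ := fun y =>
  Complex.exp (-(Complex.I *
      (((1 / 2) * inner ℝ σ.v ((Real.sqrt σ.μ)⁻¹ • y) + σ.γ : ℝ) : ℂ))) *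
    (((σ.μ ^ (1 / (2 * s)))⁻¹ : ℝ) : ℂ) * u ((Real.sqrt σ.μ)⁻¹ • y + σ.a)

theorem trans_transInv {N : ℕ} (s : ℝ) (σ : Param N) (hμ : 0 < σ.μ) (u : Space N → ℂ) :
    trans s σ (transInv s σ u) = u := by
  funext x
  have h1 : Real.sqrt σ.μ ≠ 0 := (Real.sqrt_pos.2 hμ).ne'
  have h2 : (((σ.μ ^ (1 / (2 * s)) : ℝ)) : ℂ) ≠ 0 := by
    exact_mod_cast (Real.rpow_pos_of_pos hμ _).ne'
  simp only [trans, transInv, smul_smul, inv_mul_cancel₀ h1, one_smul, sub_add_cancel, Complex.exp_neg,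
    Complex.ofReal_inv]
  field_simp [Complex.exp_ne_zero]

theorem transInv_trans {N : ℕ} (s : ℝ) (σ : Param N) (hμ : 0 < σ.μ) (u : Space N → ℂ) :
    transInv s σ (trans s σ u) = u := by
  funext x
  have h1 : Real.sqrt σ.μ ≠ 0 := (Real.sqrt_pos.2 hμ).ne'
  have h2 : (((σ.μ ^ (1 / (2 * s)) : ℝ)) : ℂ) ≠ 0 := by
    exact_mod_cast (Real.rpow_pos_of_pos hμ _).ne'
  simp only [trans, transInv, smul_smul, mul_inv_cancel₀ h1, one_smul, add_sub_cancel_right,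
    Complex.exp_neg, Complex.ofReal_inv]
  field_simp [Complex.exp_ne_zero]

/-- Index set of the `2N+2` generators: `N` translations, `N` boosts, gauge (`0`) and
scaling (`1`). -/
abbrev Idx (N : ℕ) := Fin N ⊕ Fin N ⊕ Fin 2

/-- Elements `X = ∑ X_α e_α` of the Lie algebra, given by their coefficients. The norm of this
type is `‖X‖ = sup_α |X_α|`. -/
abbrev LieAlg (N : ℕ) := Idx N → ℝ

/-- Coefficients of `∑ bᵢ eᵢ + ∑ cᵢ e_{i+N} + g e_{2N+1} + k e_{2N+2}`. -/
def coeffs {N : ℕ} (b c : Fin N → ℝ) (g k : ℝ) : LieAlg N :=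
  Sum.elim b (Sum.elim c ![g, k])

/-- The generators `e_i = -∂_{x_i}`, `e_{i+N} = i x_i`, `e_{2N+1} = i`,
`e_{2N+2} = 1/(2s) + x·∂_x/2`. -/
def gen {N : ℕ} (s : ℝ) : Idx N → (Space N → ℂ) → Space N → ℂ
  | .inl i, u => fun x => - partialDeriv i u x
  | .inr (.inl i), u => fun x => Complex.I * (x i : ℂ) * u x
  | .inr (.inr 0), u => fun x => Complex.I * u x
  | .inr (.inr 1), u => fun x =>
      ((1 / (2 * s) : ℝ) : ℂ) * u x + (1 / 2 : ℂ) * ∑ j : Fin N, (x j : ℂ) * partialDeriv j u x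

/-- The action `X u = ∑ X_α e_α u`. -/
def act {N : ℕ} (s : ℝ) (X : LieAlg N) (u : Space N → ℂ) : Space N → ℂ := fun x =>
  ∑ α, (X α : ℂ) * gen s α u x

/-- The soliton `η_σ = T_σ η`. -/
def soliton {N : ℕ} (s : ℝ) (η : Space N → ℝ) (σ : Param N) : Space N → ℂ := trans s σ (toC η)

/-- The mass `m(μ) = ½ ∫ η_μ²` of the soliton `η_μ = T_{(0,0,0,μ)} η`. -/
def mass {N : ℕ} (s : ℝ) (η : Space N → ℝ) (μ : ℝ) : ℝ :=
  (1 / 2) * ∫ x, ‖soliton s η ⟨0, 0, 0, μ⟩ x‖ ^ 2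

/-- The `H¹`-neighbourhood
`U_δ = {ψ ∈ H¹ : inf_{σ ∈ ℝ^N × ℝ^N × [0,2π) × I₀} ‖ψ - η_σ‖_{H¹} ≤ δ}`
(the infimum over the empty set being `∞`). -/
def nbhd {N : ℕ} (s : ℝ) (η : Space N → ℝ) (I₀ : Set ℝ) (δ : ℝ) : Set (Space N → ℂ) :=
  {ψ | MemH1 ψ ∧
    (⨅ σ ∈ {σ : Param N | σ.γ ∈ Ico 0 (2 * Real.pi) ∧ σ.μ ∈ I₀},
      ENNReal.ofReal (normH1 (fun x => ψ x - soliton s η σ x))) ≤ ENNReal.ofReal δ}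

/-- Skew-orthogonality of `ψ - η_σ` to the tangent space `{Y η_σ : Y ∈ g}` of the soliton manifold
at `η_σ`. -/
def IsSkewOrthogonal {N : ℕ} (s : ℝ) (η : Space N → ℝ) (ψ : Space N → ℂ) (σ : Param N) : Prop :=
  ∀ Y : LieAlg N, sympl (fun x => ψ x - soliton s η σ x) (act s Y (soliton s η σ)) = 0

/-- The fluctuation `w = T_σ⁻¹ (ψ - η_σ)`, so that `ψ = T_σ (η + w)`. -/
def fluctuation {N : ℕ} (s : ℝ) (η : Space N → ℝ) (ψ : Space N → ℂ) (σ : Param N) :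
    Space N → ℂ :=
  transInv s σ (fun x => ψ x - soliton s η σ x)

/-- A path of parameters that is differentiable on `[0,T]`. -/
structure IsDifferentiablePath {N : ℕ} (T : ℝ) (σ : ℝ → Param N) : Prop where
  a : DifferentiableOn ℝ (fun t => (σ t).a) (Icc 0 T)
  v : DifferentiableOn ℝ (fun t => (σ t).v) (Icc 0 T)
  γ : DifferentiableOn ℝ (fun t => (σ t).γ) (Icc 0 T)
  μ : DifferentiableOn ℝ (fun t => (σ t).μ) (Icc 0 T)

/-- The velocity `X(σ(t)) ∈ g` of the path of group elements, `∂_t T_{σ(t)} = T_{σ(t)} X(σ(t))`: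
`X = ∑ ȧᵢ√μ eᵢ + ∑ v̇ᵢ/(2√μ) e_{i+N} + (γ̇ - ȧ·v/2) e_{2N+1} + (μ̇/μ) e_{2N+2}`. -/
def velocity {N : ℕ} (T : ℝ) (σ : ℝ → Param N) (t : ℝ) : LieAlg N :=
  coeffs
    (fun i => (derivWithin (fun r => (σ r).a) (Icc 0 T) t) i * Real.sqrt (σ t).μ)
    (fun i => (derivWithin (fun r => (σ r).v) (Icc 0 T) t) i / (2 * Real.sqrt (σ t).μ))
    (derivWithin (fun r => (σ r).γ) (Icc 0 T) t
      - inner ℝ (derivWithin (fun r => (σ r).a) (Icc 0 T) t) (σ t).v / 2)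
    (derivWithin (fun r => (σ r).μ) (Icc 0 T) t / (σ t).μ)

/-- `X̃(t) = -X(σ(t)) + ∑ vᵢ√μ eᵢ + (μ - v²/4) e_{2N+1}`. -/
def Xtilde {N : ℕ} (T : ℝ) (σ : ℝ → Param N) (t : ℝ) : LieAlg N :=
  -velocity T σ t +
    coeffs (fun i => (σ t).v i * Real.sqrt (σ t).μ) 0 ((σ t).μ - ‖(σ t).v‖ ^ 2 / 4) 0

/-- The Lyapunov–Schmidt mapping `P u = ∑ P_α(u) e_α` onto the Lie algebra. -/
def lyapunovSchmidt {N : ℕ} (s : ℝ) (η : Space N → ℝ) (u : Space N → ℂ) : LieAlg N :=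
  coeffs
    (fun i => -1 / mass s η 1 * sympl u (gen s (.inr (.inl i)) (toC η)))
    (fun i => 1 / mass s η 1 * sympl u (gen s (.inl i) (toC η)))
    (1 / deriv (mass s η) 1 * sympl u (gen s (.inr (.inr 1)) (toC η)))
    (-1 / deriv (mass s η) 1 * sympl u (gen s (.inr (.inr 0)) (toC η)))

/-- `Y(t) = X̃(t) - ε μ^{s̃/s} P(i λ(x/√μ + a) η^{2s̃+1})`. -/
def Yelem {N : ℕ} (s st : ℝ) (lam : Space N → ℝ) (η : Space N → ℝ) (ε T : ℝ)
    (σ : ℝ → Param N) (t : ℝ) : LieAlg N :=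
  Xtilde T σ t - (ε * (σ t).μ ^ (st / s)) •
    lyapunovSchmidt s η (fun x =>
      Complex.I * (lam ((Real.sqrt (σ t).μ)⁻¹ • x + (σ t).a) : ℂ) *
        ((η x ^ (2 * st + 1) : ℝ) : ℂ))

end

end SolitonNLS

open SolitonNLS

/-! Write `ψ = T_σ u` with `u = η + w`. For a real profile `g`, the number `∫ ψ · conj (T_σ g)` is,
up to the explicit factor `massFactor`, the sum of `∫ η g` and `⟨w, g⟩ = ∫ w g`. Its time derivative
can be computed in the moving frame: the velocity of the group element is a free motion minus `X̃`,
and the free motion cancels the kinetic terms that the Galilei boost produces. What is left is `-i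
(μ ⟨-Δu + u - |u|^{2s} u, g⟩ + ε μ^{s̃/s} ⟨λ |u|^{2s̃} u, g⟩)` plus a term linear in `X̃`
(`hasDerivWithinAt_pair_trans`).

Skew-orthogonality, pulled back to the profile (`IsSkewOrthogonal.pair_eq_zero`), says that `⟨w, g⟩`
has vanishing real part for `g = η` and `g = x_k η`, and vanishing imaginary part for `g = ∂_k η`
and `g = Λη`, where `Λ = 1/(2s) + x·∂/2`. Differentiating these `2N+2` constraints yields one scalar
equation for each coefficient of `X̃` (`modulation_im`, `modulation_re`).

Each equation is estimated as follows. (a) The static term vanishes at `u = η`. Its part linear in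
`w` is governed by `L₊ = -Δ + 1 - (2s+1) η^{2s}` on real parts and `L₋ = -Δ + 1 - η^{2s}` on
imaginary parts. Since `L₊ ∂_k η = 0`, `L₊ Λη = -η`, `L₋ η = 0` and `L₋ (x_k η) = -2 ∂_k η`, the
linear part is zero or is killed by another of the constraints. Only a remainder of order `‖w‖²`
survives (`exists_taylor_bound`). (b) The `X̃` term evaluated at `η` isolates, by parity and
integration by parts, the symplectically conjugate coefficient of `X̃`, multiplied up to sign by
`m(1)` or `m'(1)`. Both are nonzero, the second because `s < 2/N`. (c) The perturbation at `η` is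
exactly the corresponding component of `P`. Replacing `η` by `η + w` costs `O(ε ‖w‖)`
(`exists_lipschitz_bound`). (d) The `X̃` term evaluated at `w` is `O(‖X̃‖ ‖w‖)`. Hence `‖Y‖ ≤ C
(‖X̃‖ ‖w‖ + μ ‖w‖² + ε μ^{s̃/s} ‖w‖)`. Because `X̃ = Y + O(ε)`, the contribution `‖Y‖ ‖w‖` is
absorbed on the left when `‖w‖` is small (`absorb_bound`).

Three analytic inputs support this. Density of test functions in `H¹` allows integration by parts
against profiles without compact support. A Sobolev inequality controls the superquadratic powers of
`w`. The radial differential equation gives exponential decay of `η` and bounds its first two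
derivatives by `η` itself; this is essential because the Taylor remainder of `|u|^{2s} u` around `η`
carries possibly negative powers of `η`, which the test profile must compensate. -/

namespace SolitonNLS

noncomputable section

/-! ### Square integrable functions -/

/-- The `L²` norm as a real number. -/
def l2 {N : ℕ} (u : Space N → ℂ) : ℝ := (eLpNorm u 2 volume).toReal

theorem l2_nonneg {N : ℕ} (u : Space N → ℂ) : 0 ≤ l2 u := ENNReal.toReal_nonneg

theorem l2_sq {N : ℕ} {u : Space N → ℂ} (hu : MemLp u 2 volume) :
    l2 u ^ 2 = ∫ x, ‖u x‖ ^ 2 := by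
  have h := hu.eLpNorm_eq_integral_rpow_norm (by norm_num) (by norm_num)
  have h0 : 0 ≤ ∫ x, ‖u x‖ ^ 2 := integral_nonneg fun x => by positivity
  simp only [ENNReal.toReal_ofNat, Real.rpow_two] at h
  rw [l2, h, ENNReal.toReal_ofReal (by positivity), ← Real.rpow_natCast, ← Real.rpow_mul h0]
  norm_num

theorem l2_add_le {N : ℕ} {u v : Space N → ℂ} (hu : MemLp u 2 volume) (hv : MemLp v 2 volume) :
    l2 (fun x => u x + v x) ≤ l2 u + l2 v := by
  have := eLpNorm_add_le hu.1 hv.1 (p := 2) (by norm_num)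
  have h2 := ENNReal.toReal_mono (ENNReal.add_ne_top.2 ⟨hu.2.ne, hv.2.ne⟩) this
  rwa [ENNReal.toReal_add hu.2.ne hv.2.ne] at h2

theorem integrable_mul_of_memLp {N : ℕ} {u v : Space N → ℂ} (hu : MemLp u 2 volume)
    (hv : MemLp v 2 volume) : Integrable (fun x => u x * v x) :=
  hu.integrable_mul hv

theorem norm_integral_mul_le {N : ℕ} {u v : Space N → ℂ} (hu : MemLp u 2 volume)
    (hv : MemLp v 2 volume) : ‖∫ x, u x * v x‖ ≤ l2 u * l2 v := by
  have h1 : eLpNorm (fun x => u x * v x) 1 volume ≤ eLpNorm u 2 volume * eLpNorm v 2 volume :=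
    eLpNorm_smul_le_mul_eLpNorm (p := 2) (q := 2) (r := 1) (f := v) (φ := u) hv.1 hu.1
  have h2 : ‖∫ x, u x * v x‖ₑ ≤ eLpNorm (fun x => u x * v x) 1 volume := by
    rw [eLpNorm_one_eq_lintegral_enorm]; exact enorm_integral_le_lintegral_enorm _
  have h3 := ENNReal.toReal_mono (ENNReal.mul_ne_top hu.2.ne hv.2.ne) (h2.trans h1)
  rwa [ENNReal.toReal_mul, toReal_enorm] at h3

theorem memLp_conj {N : ℕ} {u : Space N → ℂ} (hu : MemLp u 2 volume) :
    MemLp (fun x => conj (u x)) 2 volume :=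
  hu.of_le (Complex.continuous_conj.comp_aestronglyMeasurable hu.1)
    (Filter.Eventually.of_forall fun x => by simp)

theorem l2_conj {N : ℕ} (u : Space N → ℂ) : l2 (fun x => conj (u x)) = l2 u := by
  rw [l2, l2, eLpNorm_congr_norm_ae (g := u) (Filter.Eventually.of_forall fun x => by simp)]

theorem norm_integral_mul_conj_le {N : ℕ} {u v : Space N → ℂ} (hu : MemLp u 2 volume)
    (hv : MemLp v 2 volume) : ‖∫ x, u x * conj (v x)‖ ≤ l2 u * l2 v := by
  have := norm_integral_mul_le hu (memLp_conj hv)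
  rwa [l2_conj] at this

theorem integrable_mul_conj {N : ℕ} {u v : Space N → ℂ} (hu : MemLp u 2 volume)
    (hv : MemLp v 2 volume) : Integrable (fun x => u x * conj (v x)) :=
  integrable_mul_of_memLp hu (memLp_conj hv)

theorem tendsto_integral_mul_of_l2 {N : ℕ} {ι : Type*} {l : Filter ι} {u : ι → Space N → ℂ}
    {u₀ v : Space N → ℂ} (hu : ∀ n, MemLp (u n) 2 volume) (hu₀ : MemLp u₀ 2 volume)
    (hv : MemLp v 2 volume) (h : Filter.Tendsto (fun n => l2 (fun x => u n x - u₀ x)) l (nhds 0)) :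
    Filter.Tendsto (fun n => ∫ x, u n x * v x) l (nhds (∫ x, u₀ x * v x)) := by
  rw [tendsto_iff_norm_sub_tendsto_zero]
  refine squeeze_zero (fun _ => norm_nonneg _) (fun n => ?_)
    (by simpa using h.mul_const (l2 v))
  rw [← integral_sub (integrable_mul_of_memLp (hu n) hv) (integrable_mul_of_memLp hu₀ hv)]
  simp_rw [← sub_mul]
  exact norm_integral_mul_le ((hu n).sub hu₀) hv

theorem _root_.MeasureTheory.MemLp.locallyIntegrable_two {N : ℕ} {u : Space N → ℂ}
    (hu : MemLp u 2 volume) :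
    LocallyIntegrable u volume := hu.locallyIntegrable (by norm_num)

/-! ### Weak derivatives -/

theorem integrable_mul_of_locallyIntegrable {N : ℕ} {u φ : Space N → ℂ}
    (hu : LocallyIntegrable u volume) (hφ : Continuous φ) (hc : HasCompactSupport φ) :
    Integrable (fun x => u x * φ x) := by
  have := hu.integrable_smul_left_of_hasCompactSupport hφ hc
  simpa [mul_comm] using this

theorem IsWeakPartial.ae_unique {N : ℕ} {i : Fin N} {u g h : Space N → ℂ}
    (hg : LocallyIntegrable g volume) (hh : LocallyIntegrable h volume)
    (H1 : IsWeakPartial i u g) (H2 : IsWeakPartial i u h) : g =ᵐ[volume] h := by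
  refine ae_eq_of_integral_contDiff_smul_eq hg hh fun φ hφ hc => ?_
  have h1 := H1 φ hφ hc
  have h2 := H2 φ hφ hc
  rw [h1] at h2
  have := neg_injective h2
  simpa [mul_comm] using this

theorem MemH1.memLp_weakPartial {N : ℕ} {u : Space N → ℂ} (hu : MemH1 u) (i : Fin N) :
    MemLp (weakPartial i u) 2 volume := by
  rw [weakPartial, dif_pos (hu.2 i)]; exact (hu.2 i).choose_spec.1

theorem MemH1.isWeakPartial {N : ℕ} {u : Space N → ℂ} (hu : MemH1 u) (i : Fin N) :
    IsWeakPartial i u (weakPartial i u) := by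
  rw [weakPartial, dif_pos (hu.2 i)]; exact (hu.2 i).choose_spec.2

theorem weakPartial_ae_eq {N : ℕ} {i : Fin N} {u g : Space N → ℂ} (hg : MemLp g 2 volume)
    (H : IsWeakPartial i u g) : weakPartial i u =ᵐ[volume] g := by
  have hex : ∃ g : Space N → ℂ, MemLp g 2 volume ∧ IsWeakPartial i u g := ⟨g, hg, H⟩
  rw [weakPartial, dif_pos hex]
  exact hex.choose_spec.2.ae_unique hex.choose_spec.1.locallyIntegrable_two
    hg.locallyIntegrable_two H

theorem normH1_sq {N : ℕ} {u : Space N → ℂ} :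
    normH1 u ^ 2 = (∫ x, ‖u x‖ ^ 2) + ∑ i : Fin N, ∫ x, ‖weakPartial i u x‖ ^ 2 := by
  rw [normH1, Real.sq_sqrt]
  exact add_nonneg (integral_nonneg fun x => by positivity)
    (Finset.sum_nonneg fun i _ => integral_nonneg fun x => by positivity)

theorem normH1_nonneg {N : ℕ} (u : Space N → ℂ) : 0 ≤ normH1 u := Real.sqrt_nonneg _

theorem MemH1.normH1_sq_eq {N : ℕ} {u : Space N → ℂ} (hu : MemH1 u) :
    normH1 u ^ 2 = l2 u ^ 2 + ∑ i : Fin N, l2 (weakPartial i u) ^ 2 := by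
  rw [normH1_sq, l2_sq hu.1]
  congr 1
  exact Finset.sum_congr rfl fun i _ => (l2_sq (hu.memLp_weakPartial i)).symm

theorem MemH1.l2_le {N : ℕ} {u : Space N → ℂ} (hu : MemH1 u) : l2 u ≤ normH1 u := by
  refine le_of_sq_le_sq ?_ (normH1_nonneg u)
  rw [hu.normH1_sq_eq]
  have : 0 ≤ ∑ i : Fin N, l2 (weakPartial i u) ^ 2 := Finset.sum_nonneg fun i _ => sq_nonneg _
  linarith

/-- Weak derivatives are defined by real test functions, but pulling a test function back through
`T_σ` multiplies it by a complex phase. Splitting into real and imaginary parts covers this case. -/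
theorem isWeakPartial_complex {N : ℕ} {i : Fin N} {u g : Space N → ℂ}
    (hu : LocallyIntegrable u volume) (hg : LocallyIntegrable g volume) (H : IsWeakPartial i u g)
    {φ : Space N → ℂ} (hφ : ContDiff ℝ ∞ φ) (hc : HasCompactSupport φ) :
    ∫ x, u x * partialDeriv i φ x = - ∫ x, g x * φ x := by
  have hd : Differentiable ℝ φ := hφ.differentiable (by simp)
  have h1 : ContDiff ℝ ∞ (fun x => (φ x).re) := Complex.reCLM.contDiff.comp hφ
  have h2 : ContDiff ℝ ∞ (fun x => (φ x).im) := Complex.imCLM.contDiff.comp hφ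
  have c1 : HasCompactSupport (fun x => (φ x).re) := hc.comp_left (g := Complex.re) rfl
  have c2 : HasCompactSupport (fun x => (φ x).im) := hc.comp_left (g := Complex.im) rfl
  have e1 : ∀ x, fderiv ℝ (fun x => (φ x).re) x (basisVec i) = (partialDeriv i φ x).re := fun x => by
    have := (Complex.reCLM.hasFDerivAt.comp x (hd x).hasFDerivAt).fderiv
    rw [show (fun x => (φ x).re) = Complex.reCLM ∘ φ from rfl, this]; rfl
  have e2 : ∀ x, fderiv ℝ (fun x => (φ x).im) x (basisVec i) = (partialDeriv i φ x).im := fun x => by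
    have := (Complex.imCLM.hasFDerivAt.comp x (hd x).hasFDerivAt).fderiv
    rw [show (fun x => (φ x).im) = Complex.imCLM ∘ φ from rfl, this]; rfl
  have H1 := H _ h1 c1
  have H2 := H _ h2 c2
  simp only [e1, e2] at H1 H2
  have cd : Continuous (partialDeriv i φ) := by
    unfold partialDeriv
    exact (hφ.continuous_fderiv (by simp)).clm_apply continuous_const
  have ccd : HasCompactSupport (partialDeriv i φ) := hc.fderiv_apply ℝ _
  have i1 := integrable_mul_of_locallyIntegrable (φ := fun x => ((partialDeriv i φ x).re : ℂ)) hu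
    (by fun_prop) (ccd.comp_left (g := fun z : ℂ => (z.re : ℂ)) (by simp))
  have i2 := integrable_mul_of_locallyIntegrable (φ := fun x => ((partialDeriv i φ x).im : ℂ)) hu
    (by fun_prop) (ccd.comp_left (g := fun z : ℂ => (z.im : ℂ)) (by simp))
  have cφ := hφ.continuous
  have i3 := integrable_mul_of_locallyIntegrable (φ := fun x => ((φ x).re : ℂ)) hg
    (by fun_prop) (hc.comp_left (g := fun z : ℂ => (z.re : ℂ)) (by simp))
  have i4 := integrable_mul_of_locallyIntegrable (φ := fun x => ((φ x).im : ℂ)) hg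
    (by fun_prop) (hc.comp_left (g := fun z : ℂ => (z.im : ℂ)) (by simp))
  have L : ∫ x, u x * partialDeriv i φ x =
      (∫ x, u x * ((partialDeriv i φ x).re : ℂ)) +
        (∫ x, u x * ((partialDeriv i φ x).im : ℂ)) * Complex.I := by
    rw [← integral_mul_const, ← integral_add i1 (i2.mul_const _)]
    refine integral_congr_ae (Filter.Eventually.of_forall fun x => ?_)
    simp only
    conv_lhs => rw [← Complex.re_add_im (partialDeriv i φ x)]
    ring
  have R : ∫ x, g x * φ x =
      (∫ x, g x * ((φ x).re : ℂ)) + (∫ x, g x * ((φ x).im : ℂ)) * Complex.I := by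
    rw [← integral_mul_const, ← integral_add i3 (i4.mul_const _)]
    refine integral_congr_ae (Filter.Eventually.of_forall fun x => ?_)
    simp only
    conv_lhs => rw [← Complex.re_add_im (φ x)]
    ring
  rw [L, R, H1, H2]
  ring

theorem isWeakPartial_of_complex {N : ℕ} {i : Fin N} {u g : Space N → ℂ}
    (H : ∀ φ : Space N → ℂ, ContDiff ℝ ∞ φ → HasCompactSupport φ →
      ∫ x, u x * partialDeriv i φ x = - ∫ x, g x * φ x) : IsWeakPartial i u g := by
  intro φ hφ hc
  have := H (fun x => (φ x : ℂ)) (Complex.ofRealCLM.contDiff.comp hφ)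
    (hc.comp_left (g := Complex.ofReal) rfl)
  rw [← this]
  refine integral_congr_ae (Filter.Eventually.of_forall fun x => ?_)
  simp only [partialDeriv]
  congr 1
  have := (Complex.ofRealCLM.hasFDerivAt.comp x
    ((hφ.differentiable (by simp)) x).hasFDerivAt).fderiv
  rw [show (fun x => (φ x : ℂ)) = Complex.ofRealCLM ∘ φ from rfl, this]; rfl

theorem IsWeakPartial.add {N : ℕ} {i : Fin N} {u v g h : Space N → ℂ}
    (hu : MemLp u 2 volume) (hv : MemLp v 2 volume) (hg : MemLp g 2 volume)
    (hh : MemLp h 2 volume)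
    (H1 : IsWeakPartial i u g) (H2 : IsWeakPartial i v h) :
    IsWeakPartial i (fun x => u x + v x) (fun x => g x + h x) := by
  intro φ hφ hc
  have cφ := hφ.continuous
  have cd : Continuous (fun x => fderiv ℝ φ x (basisVec i)) :=
    (hφ.continuous_fderiv (by simp)).clm_apply continuous_const
  have ccd : HasCompactSupport (fun x => fderiv ℝ φ x (basisVec i)) := hc.fderiv_apply ℝ _
  have k1 : Continuous (fun x => ((fderiv ℝ φ x (basisVec i) : ℝ) : ℂ)) := by fun_prop
  have k2 : HasCompactSupport (fun x => ((fderiv ℝ φ x (basisVec i) : ℝ) : ℂ)) :=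
    ccd.comp_left (g := Complex.ofReal) rfl
  have k3 : Continuous (fun x => (φ x : ℂ)) := by fun_prop
  have k4 : HasCompactSupport (fun x => (φ x : ℂ)) := hc.comp_left (g := Complex.ofReal) rfl
  simp only [add_mul]
  rw [integral_add (integrable_mul_of_locallyIntegrable hu.locallyIntegrable_two k1 k2)
    (integrable_mul_of_locallyIntegrable hv.locallyIntegrable_two k1 k2),
    integral_add (integrable_mul_of_locallyIntegrable hg.locallyIntegrable_two k3 k4)
    (integrable_mul_of_locallyIntegrable hh.locallyIntegrable_two k3 k4), H1 φ hφ hc, H2 φ hφ hc]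
  ring

theorem IsWeakPartial.const_mul {N : ℕ} {i : Fin N} {u g : Space N → ℂ} (c : ℂ)
    (H1 : IsWeakPartial i u g) :
    IsWeakPartial i (fun x => c * u x) (fun x => c * g x) := by
  intro φ hφ hc
  simp only [mul_assoc, integral_const_mul, H1 φ hφ hc, mul_neg]

theorem MemH1.add {N : ℕ} {u v : Space N → ℂ} (hu : MemH1 u) (hv : MemH1 v) :
    MemH1 (fun x => u x + v x) :=
  ⟨hu.1.add hv.1, fun i => ⟨_, (hu.memLp_weakPartial i).add (hv.memLp_weakPartial i),
    (hu.isWeakPartial i).add hu.1 hv.1 (hu.memLp_weakPartial i) (hv.memLp_weakPartial i)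
      (hv.isWeakPartial i)⟩⟩

theorem MemH1.const_mul {N : ℕ} {u : Space N → ℂ} (c : ℂ) (hu : MemH1 u) :
    MemH1 (fun x => c * u x) :=
  ⟨hu.1.const_mul c, fun i => ⟨_, (hu.memLp_weakPartial i).const_mul c,
    (hu.isWeakPartial i).const_mul c⟩⟩

theorem MemH1.sub {N : ℕ} {u v : Space N → ℂ} (hu : MemH1 u) (hv : MemH1 v) :
    MemH1 (fun x => u x - v x) := by
  have := hu.add (hv.const_mul (-1))
  simpa [sub_eq_add_neg] using this

theorem MemH1.weakPartial_add {N : ℕ} {u v : Space N → ℂ} (hu : MemH1 u) (hv : MemH1 v)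
    (i : Fin N) : weakPartial i (fun x => u x + v x) =ᵐ[volume]
      fun x => weakPartial i u x + weakPartial i v x :=
  weakPartial_ae_eq ((hu.memLp_weakPartial i).add (hv.memLp_weakPartial i))
    ((hu.isWeakPartial i).add hu.1 hv.1 (hu.memLp_weakPartial i) (hv.memLp_weakPartial i)
      (hv.isWeakPartial i))

/-- Integration by parts of a compactly supported function against a `C¹` function. -/
theorem integral_mul_partialDeriv_of_hasCompactSupport {N : ℕ} {i : Fin N} {φ g : Space N → ℂ}
    (hφ : ContDiff ℝ 1 φ) (hc : HasCompactSupport φ) (hg : ContDiff ℝ 1 g) :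
    ∫ x, g x * partialDeriv i φ x = - ∫ x, partialDeriv i g x * φ x := by
  have cd : Continuous (partialDeriv i φ) := by
    unfold partialDeriv
    exact (hφ.continuous_fderiv (by simp)).clm_apply continuous_const
  have cg : Continuous (partialDeriv i g) := by
    unfold partialDeriv
    exact (hg.continuous_fderiv (by simp)).clm_apply continuous_const
  have ccd : HasCompactSupport (partialDeriv i φ) := hc.fderiv_apply ℝ _
  exact integral_mul_fderiv_eq_neg_fderiv_mul_of_integrable
    ((cg.mul hφ.continuous).integrable_of_hasCompactSupport hc.mul_left)
    ((hg.continuous.mul cd).integrable_of_hasCompactSupport ccd.mul_left)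
    ((hg.continuous.mul hφ.continuous).integrable_of_hasCompactSupport hc.mul_left)
    (fun x _ => (hg.differentiable (by simp)) x) (fun x _ => (hφ.differentiable (by simp)) x)

theorem isWeakPartial_of_contDiff {N : ℕ} {i : Fin N} {g : Space N → ℂ} (hg : ContDiff ℝ 1 g) :
    IsWeakPartial i g (partialDeriv i g) :=
  isWeakPartial_of_complex fun _ hφ hc =>
    integral_mul_partialDeriv_of_hasCompactSupport (hφ.of_le (by simp)) hc hg

theorem memH1_of_contDiff {N : ℕ} {g : Space N → ℂ} (hg : ContDiff ℝ 1 g) (h : MemLp g 2 volume)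
    (h' : ∀ i, MemLp (partialDeriv i g) 2 volume) : MemH1 g :=
  ⟨h, fun i => ⟨_, h' i, isWeakPartial_of_contDiff hg⟩⟩

theorem weakPartial_of_contDiff {N : ℕ} {i : Fin N} {g : Space N → ℂ} (hg : ContDiff ℝ 1 g)
    (h' : MemLp (partialDeriv i g) 2 volume) : weakPartial i g =ᵐ[volume] partialDeriv i g :=
  weakPartial_ae_eq h' (isWeakPartial_of_contDiff hg)

end

noncomputable section

/-! ### Density of smooth compactly supported functions in `H¹` -/

/-- A shrinking family of smooth bump functions at the origin. -/
def shrinkingBump (N : ℕ) (n : ℕ) : ContDiffBump (0 : Space N) :=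
  ⟨1 / ((n : ℝ) + 1), 2 / ((n : ℝ) + 1), by positivity, by gcongr; norm_num⟩

/-- Mollification at scale `1 / (n + 1)`. -/
def mollify {N : ℕ} (n : ℕ) (u : Space N → ℂ) : Space N → ℂ :=
  convolution ((shrinkingBump N n).normed volume) u (ContinuousLinearMap.lsmul ℝ ℝ) volume

theorem tendsto_shrinkingBump_rOut (N : ℕ) :
    Filter.Tendsto (fun n => (shrinkingBump N n).rOut) Filter.atTop (nhds 0) := by
  have := (tendsto_one_div_add_atTop_nhds_zero_nat (𝕜 := ℝ)).const_mul 2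
  simpa [shrinkingBump, div_eq_mul_inv] using this

theorem ae_tendsto_mollify {N : ℕ} {u : Space N → ℂ} (hu : LocallyIntegrable u volume) :
    ∀ᵐ x, Filter.Tendsto (fun n => mollify n u x) Filter.atTop (nhds (u x)) :=
  -- The outer radius is always twice the inner one; this bounded ratio is what Lebesgue
  -- differentiation needs.
  ContDiffBump.ae_convolution_tendsto_right_of_locallyIntegrable (K := 2)
    (tendsto_shrinkingBump_rOut N)
    (Filter.Eventually.of_forall fun n => by simp only [shrinkingBump]; ring_nf; rfl) hu

theorem contDiff_mollify {N : ℕ} (n : ℕ) {u : Space N → ℂ} (hu : LocallyIntegrable u volume) :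
    ContDiff ℝ ∞ (mollify n u) :=
  (shrinkingBump N n).hasCompactSupport_normed.contDiff_convolution_left _
    (shrinkingBump N n).contDiff_normed hu

/-- Jensen's inequality for the probability density `k`, obtained from Cauchy–Schwarz after writing
`k = k^{1/2} k^{1/2}`. -/
theorem lintegral_mul_sq_le {N : ℕ} {k h : Space N → ℝ≥0∞} (hk : AEMeasurable k)
    (hh : AEMeasurable h) (hk1 : ∫⁻ y, k y = 1) :
    (∫⁻ y, k y * h y) ^ 2 ≤ ∫⁻ y, k y * h y ^ 2 := by
  have H := ENNReal.lintegral_mul_le_Lp_mul_Lq (μ := (volume : Measure (Space N)))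
    (p := 2) (q := 2) (by norm_num [Real.holderConjugate_iff])
    (f := fun y => k y ^ (1 / 2 : ℝ)) (g := fun y => k y ^ (1 / 2 : ℝ) * h y)
    (hk.pow_const _) ((hk.pow_const _).mul hh)
  have e : ∀ y, k y ^ (1 / 2 : ℝ) * k y ^ (1 / 2 : ℝ) = k y := fun y => by
    rw [← ENNReal.rpow_add_of_nonneg _ _ (by norm_num) (by norm_num)]; norm_num
  have e2 : ∀ y, (k y ^ (1 / 2 : ℝ)) ^ (2 : ℝ) = k y := fun y => by
    rw [← ENNReal.rpow_mul]; norm_num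
  simp only [Pi.mul_apply, ← mul_assoc, e, ENNReal.mul_rpow_of_nonneg _ _ (zero_le_two : (0:ℝ) ≤ 2),
    e2, hk1, ENNReal.one_rpow, one_mul] at H
  calc (∫⁻ y, k y * h y) ^ 2 ≤ ((∫⁻ y, k y * h y ^ (2 : ℝ)) ^ (1 / 2 : ℝ)) ^ 2 := by gcongr
    _ = _ := by
      rw [← ENNReal.rpow_natCast, ← ENNReal.rpow_mul]
      norm_num

/-- Mollification contracts `L²`: Jensen at each point, then Tonelli and translation invariance. -/
theorem lintegral_mollify_sq_le {N : ℕ} (n : ℕ) {u : Space N → ℂ}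
    (hu : AEStronglyMeasurable u volume) :
    ∫⁻ x, ‖mollify n u x‖ₑ ^ 2 ≤ ∫⁻ x, ‖u x‖ₑ ^ 2 := by
  -- Tonelli requires joint measurability of `u (x - y)`, so `u` is replaced by a strongly
  -- measurable representative; neither side notices the change.
  wlog hm : StronglyMeasurable u generalizing u
  · have h1 : mollify n u = mollify n (hu.mk u) :=
      convolution_congr _ (Filter.EventuallyEq.refl _ _) hu.ae_eq_mk
    have h2 : ∫⁻ x, ‖u x‖ₑ ^ 2 = ∫⁻ x, ‖hu.mk u x‖ₑ ^ 2 :=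
      lintegral_congr_ae (hu.ae_eq_mk.mono fun x hx => by simp only [hx])
    rw [h1, h2]
    exact this hu.stronglyMeasurable_mk.aestronglyMeasurable hu.stronglyMeasurable_mk
  set ρ := (shrinkingBump N n).normed volume with hρ
  have cρ : Continuous ρ := (shrinkingBump N n).continuous_normed
  set k : Space N → ℝ≥0∞ := fun y => ‖ρ y‖ₑ with hk
  have mk : Measurable k := by fun_prop
  have hk1 : ∫⁻ y, k y = 1 := by
    have h1 := (shrinkingBump N n).integral_normed (μ := volume)
    have h2 := ofReal_integral_eq_lintegral_ofReal ((shrinkingBump N n).integrable_normed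
      (μ := volume)) (Filter.Eventually.of_forall fun x => (shrinkingBump N n).nonneg_normed x)
    rw [h1, ENNReal.ofReal_one] at h2
    rw [h2]
    exact lintegral_congr fun y => Real.enorm_of_nonneg ((shrinkingBump N n).nonneg_normed y)
  have mu : Measurable u := hm.measurable
  calc ∫⁻ x, ‖mollify n u x‖ₑ ^ 2 ≤ ∫⁻ x, (∫⁻ y, k y * ‖u (x - y)‖ₑ) ^ 2 := by
        gcongr with x
        refine (enorm_integral_le_lintegral_enorm _).trans (le_of_eq ?_)
        refine lintegral_congr fun y => ?_
        rw [ContinuousLinearMap.lsmul_apply, enorm_smul]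
    _ ≤ ∫⁻ x, ∫⁻ y, k y * ‖u (x - y)‖ₑ ^ 2 := by
        gcongr with x
        exact lintegral_mul_sq_le mk.aemeasurable (by fun_prop) hk1
    _ = ∫⁻ y, ∫⁻ x, k y * ‖u (x - y)‖ₑ ^ 2 := by
        rw [lintegral_lintegral_swap]
        exact Measurable.aemeasurable (by fun_prop)
    _ = ∫⁻ y, k y * ∫⁻ x, ‖u x‖ₑ ^ 2 := by
        refine lintegral_congr fun y => ?_
        rw [lintegral_const_mul _ (by fun_prop),
          lintegral_sub_right_eq_self (fun x => ‖u x‖ₑ ^ 2) y]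
    _ = ∫⁻ x, ‖u x‖ₑ ^ 2 := by
        rw [lintegral_mul_const _ mk, hk1, one_mul]

theorem eLpNorm_two_sq {N : ℕ} (u : Space N → ℂ) :
    eLpNorm u 2 volume ^ 2 = ∫⁻ x, ‖u x‖ₑ ^ 2 := by
  have := eLpNorm_nnreal_pow_eq_lintegral (f := u) (μ := (volume : Measure (Space N)))
    (p := 2) (by norm_num)
  have e : ∀ a : ℝ≥0∞, a ^ ((2 : NNReal) : ℝ) = a ^ 2 := fun a => by
    rw [NNReal.coe_ofNat, ← Nat.cast_ofNat, ENNReal.rpow_natCast]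
  simp only [e] at this
  exact this

theorem memLp_mollify {N : ℕ} (n : ℕ) {u : Space N → ℂ} (hu : MemLp u 2 volume) :
    MemLp (mollify n u) 2 volume ∧ l2 (mollify n u) ≤ l2 u := by
  have h := lintegral_mollify_sq_le n hu.1
  rw [← eLpNorm_two_sq, ← eLpNorm_two_sq] at h
  have h' : eLpNorm (mollify n u) 2 volume ≤ eLpNorm u 2 volume :=
    (ENNReal.pow_le_pow_left_iff (by norm_num)).1 h
  exact ⟨⟨(contDiff_mollify n hu.locallyIntegrable_two).continuous.aestronglyMeasurable,
    h'.trans_lt hu.2⟩, ENNReal.toReal_mono hu.2.ne h'⟩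

/-- The derivative falls on the kernel, and the reflected kernel `t ↦ ρ (x - t)` is itself an
admissible test function for the weak derivative. -/
theorem partialDeriv_mollify {N : ℕ} (n : ℕ) {i : Fin N} {u g : Space N → ℂ}
    (hu : LocallyIntegrable u volume) (H : IsWeakPartial i u g) :
    partialDeriv i (mollify n u) = mollify n g := by
  funext x
  set ρ := (shrinkingBump N n).normed volume with hρ
  have sρ : ContDiff ℝ ∞ ρ := (shrinkingBump N n).contDiff_normed
  have kρ : HasCompactSupport ρ := (shrinkingBump N n).hasCompactSupport_normed
  have h1 := (kρ.hasFDerivAt_convolution_left (ContinuousLinearMap.lsmul ℝ ℝ)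
    (sρ.of_le (by simp)) hu x).fderiv
  have cf : Continuous (fderiv ℝ ρ) := sρ.continuous_fderiv (by simp)
  have ex := (kρ.fderiv (𝕜 := ℝ)).convolutionExists_left
    ((ContinuousLinearMap.lsmul ℝ ℝ : ℝ →L[ℝ] ℂ →L[ℝ] ℂ).precompL (Space N)) cf hu x
  have e1 : partialDeriv i (mollify n u) x =
      ∫ t, ((fderiv ℝ ρ t (basisVec i) : ℝ) : ℂ) * u (x - t) := by
    rw [partialDeriv, mollify, h1, convolution_def, ContinuousLinearMap.integral_apply ex]
    refine integral_congr_ae (Filter.Eventually.of_forall fun t => ?_)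
    simp [ContinuousLinearMap.precompL_apply]
  have e2 : mollify n g x = ∫ t, (ρ t : ℂ) * g (x - t) := by
    rw [mollify, convolution_def]
    exact integral_congr_ae (Filter.Eventually.of_forall fun t => by simp [hρ])
  have sφ : ContDiff ℝ ∞ (fun t => ρ (x - t)) := sρ.comp (contDiff_const.sub contDiff_id)
  have kφ : HasCompactSupport (fun t => ρ (x - t)) :=
    kρ.comp_homeomorph (Homeomorph.subLeft x)
  have dφ : ∀ t, fderiv ℝ (fun t => ρ (x - t)) t (basisVec i) =
      - fderiv ℝ ρ (x - t) (basisVec i) := fun t => by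
    have := ((sρ.differentiable (by simp) (x - t)).hasFDerivAt.comp t
      ((hasFDerivAt_const x t).sub (hasFDerivAt_id t))).fderiv
    rw [show (fun t => ρ (x - t)) = ρ ∘ (fun t => x - t) from rfl]
    erw [this]
    simp
  have := H _ sφ kφ
  simp only [dφ] at this
  rw [e1, e2, ← integral_sub_left_eq_self _ volume x,
    ← integral_sub_left_eq_self (fun t => (ρ t : ℂ) * g (x - t)) volume x]
  simp only [sub_sub_cancel]
  have h3 : ∫ t, g t * ((ρ (x - t) : ℝ) : ℂ) = ∫ t, u t * ((fderiv ℝ ρ (x - t) (basisVec i) : ℝ) : ℂ) := by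
    rw [eq_comm, ← neg_inj, ← this, ← integral_neg]
    exact integral_congr_ae (Filter.Eventually.of_forall fun t => by simp)
  simp_rw [mul_comm _ (u _), mul_comm _ (g _)]
  exact h3.symm

/-- Convergence almost everywhere without gain of `L²` norm implies convergence in `L²`. -/
theorem tendsto_l2_of_ae_of_le {N : ℕ} {f : ℕ → Space N → ℂ} {g : Space N → ℂ}
    (hf : ∀ n, MemLp (f n) 2 volume) (hg : MemLp g 2 volume) (hle : ∀ n, l2 (f n) ≤ l2 g)
    (h : ∀ᵐ x, Filter.Tendsto (fun n => f n x) Filter.atTop (nhds (g x))) :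
    Filter.Tendsto (fun n => l2 (fun x => f n x - g x)) Filter.atTop (nhds 0) := by
  have sqi : ∀ {v : Space N → ℂ}, MemLp v 2 volume → Integrable (fun x => ‖v x‖ ^ 2) :=
    fun hv => hv.integrable_norm_pow (p := 2) (by norm_num)
  have hd : ∀ n, MemLp (fun x => f n x - g x) 2 volume := fun n => (hf n).sub hg
  -- By the parallelogram law `F n = |f n + g|²`, which is nonnegative. Fatou gives `liminf ∫ F n ≥
  -- 4 ‖g‖²`, while the norm bound gives `∫ F n ≤ 4 ‖g‖² - ‖f n - g‖²`; together these force the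
  -- difference to zero.
  set F : ℕ → Space N → ℝ := fun n x => 2 * ‖f n x‖ ^ 2 + 2 * ‖g x‖ ^ 2 - ‖f n x - g x‖ ^ 2 with hF
  have Fnn : ∀ n x, 0 ≤ F n x := fun n x => by
    have := parallelogram_law_with_norm ℝ (f n x) (g x)
    simp only [hF]
    nlinarith [norm_nonneg (f n x + g x)]
  have Fi : ∀ n, Integrable (F n) := fun n =>
    (((sqi (hf n)).const_mul 2).add ((sqi hg).const_mul 2)).sub (sqi (hd n))
  have Fe : ∀ n, ∫ x, F n x = 2 * l2 (f n) ^ 2 + 2 * l2 g ^ 2 - l2 (fun x => f n x - g x) ^ 2 := by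
    intro n
    have h1 : Integrable (fun x => 2 * ‖f n x‖ ^ 2 + 2 * ‖g x‖ ^ 2) :=
      ((sqi (hf n)).const_mul 2).add ((sqi hg).const_mul 2)
    simp only [hF]
    rw [integral_sub h1 (sqi (hd n)), integral_add ((sqi (hf n)).const_mul 2) ((sqi hg).const_mul 2), integral_const_mul,
      integral_const_mul, l2_sq (hf n), l2_sq hg, l2_sq (hd n)]
  have fat : ∫⁻ x, ENNReal.ofReal (4 * ‖g x‖ ^ 2) ≤
      Filter.liminf (fun n => ∫⁻ x, ENNReal.ofReal (F n x)) Filter.atTop := by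
    refine le_trans (le_of_eq ?_) (lintegral_liminf_le' fun n =>
      (Fi n).aestronglyMeasurable.aemeasurable.ennreal_ofReal)
    refine lintegral_congr_ae (h.mono fun x hx => ?_)
    have : Filter.Tendsto (fun n => F n x) Filter.atTop (nhds (4 * ‖g x‖ ^ 2)) := by
      have := (((hx.norm.pow 2).const_mul 2).add_const (2 * ‖g x‖ ^ 2)).sub
        ((hx.sub_const (g x)).norm.pow 2)
      convert this using 2
      simp; ring
    exact ((ENNReal.tendsto_ofReal this).liminf_eq).symm
  have e4 : ∫⁻ x, ENNReal.ofReal (4 * ‖g x‖ ^ 2) = ENNReal.ofReal (4 * l2 g ^ 2) := by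
    rw [← ofReal_integral_eq_lintegral_ofReal ((sqi hg).const_mul 4)
      (Filter.Eventually.of_forall fun x => by positivity), integral_const_mul, l2_sq hg]
  have eF : ∀ n, ∫⁻ x, ENNReal.ofReal (F n x) = ENNReal.ofReal (∫ x, F n x) := fun n =>
    (ofReal_integral_eq_lintegral_ofReal (Fi n) (Filter.Eventually.of_forall (Fnn n))).symm
  simp only [e4, eF] at fat
  have sq0 : Filter.Tendsto (fun n => l2 (fun x => f n x - g x) ^ 2) Filter.atTop (nhds 0) := by
    rw [Metric.tendsto_atTop]
    intro ε hε
    have key : ∀ᶠ n in Filter.atTop, l2 (fun x => f n x - g x) ^ 2 < ε := by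
      -- `ENNReal.ofReal` truncates at zero, so the comparison with `4 ‖g‖² - ε` needs this number
      -- to be nonnegative. In the other case `∫ F n ≥ 0` already suffices.
      by_cases h0 : 4 * l2 g ^ 2 < ε
      · refine Filter.Eventually.of_forall fun n => ?_
        have : 0 ≤ ∫ x, F n x := integral_nonneg (Fnn n)
        rw [Fe] at this
        have h3 := pow_le_pow_left₀ (l2_nonneg _) (hle n) 2
        linarith
      · have hlt : ENNReal.ofReal (4 * l2 g ^ 2 - ε) <
            Filter.liminf (fun n => ENNReal.ofReal (∫ x, F n x)) Filter.atTop :=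
          lt_of_lt_of_le ((ENNReal.ofReal_lt_ofReal_iff_of_nonneg (by linarith)).2
            (by linarith)) fat
        filter_upwards [Filter.eventually_lt_of_lt_liminf hlt] with n hn
        have := (ENNReal.ofReal_lt_ofReal_iff_of_nonneg (by linarith)).1 hn
        rw [Fe] at this
        have h3 := pow_le_pow_left₀ (l2_nonneg _) (hle n) 2
        linarith
    obtain ⟨n₀, hn₀⟩ := Filter.eventually_atTop.1 key
    refine ⟨n₀, fun n hn => ?_⟩
    rw [Real.dist_0_eq_abs, abs_of_nonneg (sq_nonneg _)]
    exact hn₀ n hn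
  have := (Real.continuous_sqrt.tendsto 0).comp sq0
  simpa [Function.comp_def, Real.sqrt_sq (l2_nonneg _)] using this

/-- A growing family of smooth cutoff functions. -/
def cutoff (N : ℕ) (n : ℕ) (x : Space N) : ℝ :=
  (⟨1, 2, one_pos, one_lt_two⟩ : ContDiffBump (0 : Space N)) (((n : ℝ) + 1)⁻¹ • x)

theorem contDiff_cutoff (N n : ℕ) : ContDiff ℝ ∞ (cutoff N n) :=
  (ContDiffBump.contDiff _).comp (contDiff_const_smul _)

theorem hasCompactSupport_cutoff (N n : ℕ) : HasCompactSupport (cutoff N n) :=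
  (ContDiffBump.hasCompactSupport _).comp_homeomorph
    (Homeomorph.smulOfNeZero (((n : ℝ) + 1)⁻¹) (by positivity))

theorem cutoff_nonneg (N n : ℕ) (x : Space N) : 0 ≤ cutoff N n x := ContDiffBump.nonneg _

theorem cutoff_le_one (N n : ℕ) (x : Space N) : cutoff N n x ≤ 1 := ContDiffBump.le_one _

theorem tendsto_cutoff (N : ℕ) (x : Space N) :
    Filter.Tendsto (fun n => cutoff N n x) Filter.atTop (nhds 1) := by
  refine tendsto_const_nhds.congr' ?_
  filter_upwards [Filter.eventually_ge_atTop ⌈‖x‖⌉₊] with n hn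
  refine (ContDiffBump.one_of_mem_closedBall _ ?_).symm
  have h1 : ‖x‖ ≤ n := (Nat.le_ceil _).trans (by exact_mod_cast hn)
  rw [mem_closedBall_zero_iff, norm_smul, norm_inv, Real.norm_of_nonneg (by positivity)]
  exact (inv_mul_le_iff₀ (by positivity)).2 (by linarith)

theorem exists_fderiv_cutoff_le (N : ℕ) : ∃ C, 0 ≤ C ∧ ∀ (n : ℕ) (i : Fin N) (x : Space N),
    |fderiv ℝ (cutoff N n) x (basisVec i)| ≤ C * ((n : ℝ) + 1)⁻¹ := by
  set χ : ContDiffBump (0 : Space N) := ⟨1, 2, one_pos, one_lt_two⟩ with hχ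
  have sχ : ContDiff ℝ ∞ χ := χ.contDiff
  obtain ⟨C, hC⟩ := (sχ.continuous_fderiv (by simp)).bounded_above_of_compact_support
    (χ.hasCompactSupport.fderiv (𝕜 := ℝ))
  refine ⟨C, (norm_nonneg _).trans (hC 0), fun n i x => ?_⟩
  have h1 : fderiv ℝ (cutoff N n) x (basisVec i) =
      ((n : ℝ) + 1)⁻¹ * fderiv ℝ χ (((n : ℝ) + 1)⁻¹ • x) (basisVec i) := by
    have hh := (((sχ.differentiable (by simp) (((n : ℝ) + 1)⁻¹ • x)).hasFDerivAt).comp x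
      ((hasFDerivAt_id x).const_smul ((n : ℝ) + 1)⁻¹)).fderiv
    rw [show cutoff N n = χ ∘ (fun x => ((n : ℝ) + 1)⁻¹ • x) from rfl]
    erw [hh]
    simp
  rw [h1, abs_mul, abs_of_nonneg (by positivity : (0 : ℝ) ≤ ((n : ℝ) + 1)⁻¹), mul_comm]
  gcongr
  refine ((fderiv ℝ χ (((n : ℝ) + 1)⁻¹ • x)).le_opNorm (basisVec i)).trans ?_
  simpa [basisVec] using hC _

/-- Cut-off mollification. -/
def approx {N : ℕ} (n : ℕ) (u : Space N → ℂ) : Space N → ℂ :=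
  fun x => (cutoff N n x : ℂ) * mollify n u x

theorem contDiff_approx {N : ℕ} (n : ℕ) {u : Space N → ℂ} (hu : LocallyIntegrable u volume) :
    ContDiff ℝ ∞ (approx n u) :=
  (Complex.ofRealCLM.contDiff.comp (contDiff_cutoff N n)).mul (contDiff_mollify n hu)

theorem hasCompactSupport_approx {N : ℕ} (n : ℕ) (u : Space N → ℂ) :
    HasCompactSupport (approx n u) :=
  ((hasCompactSupport_cutoff N n).comp_left (g := Complex.ofReal) rfl).mul_right

theorem ae_tendsto_approx {N : ℕ} {u : Space N → ℂ} (hu : LocallyIntegrable u volume) :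
    ∀ᵐ x, Filter.Tendsto (fun n => approx n u x) Filter.atTop (nhds (u x)) := by
  filter_upwards [ae_tendsto_mollify hu] with x hx
  have := ((Complex.continuous_ofReal.tendsto 1).comp (tendsto_cutoff N x)).mul hx
  simpa [approx] using this

theorem memLp_approx {N : ℕ} (n : ℕ) {u : Space N → ℂ} (hu : MemLp u 2 volume) :
    MemLp (approx n u) 2 volume ∧ l2 (approx n u) ≤ l2 u := by
  have hm := memLp_mollify n hu
  have hle : ∀ x, ‖approx n u x‖ ≤ ‖mollify n u x‖ := fun x => by
    rw [approx, norm_mul, Complex.norm_real, Real.norm_of_nonneg (cutoff_nonneg _ _ _)]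
    exact mul_le_of_le_one_left (norm_nonneg _) (cutoff_le_one _ _ _)
  have h1 := eLpNorm_mono (p := 2) (μ := volume) hle
  exact ⟨⟨(contDiff_approx n hu.locallyIntegrable_two).continuous.aestronglyMeasurable,
    h1.trans_lt hm.1.2⟩, (ENNReal.toReal_mono hm.1.2.ne h1).trans hm.2⟩

theorem tendsto_l2_approx {N : ℕ} {u : Space N → ℂ} (hu : MemLp u 2 volume) :
    Filter.Tendsto (fun n => l2 (fun x => approx n u x - u x)) Filter.atTop (nhds 0) :=
  tendsto_l2_of_ae_of_le (fun n => (memLp_approx n hu).1) hu (fun n => (memLp_approx n hu).2)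
    (ae_tendsto_approx hu.locallyIntegrable_two)

/-- The second summand is an error of order `1 / (n + 1)` in `L²`, by `exists_fderiv_cutoff_le`; the
first converges to the weak derivative. -/
theorem partialDeriv_approx {N : ℕ} (n : ℕ) {i : Fin N} {u g : Space N → ℂ}
    (hu : LocallyIntegrable u volume) (H : IsWeakPartial i u g) (x : Space N) :
    partialDeriv i (approx n u) x = approx n g x +
      ((fderiv ℝ (cutoff N n) x (basisVec i) : ℝ) : ℂ) * mollify n u x := by
  have h1 : HasFDerivAt (fun x => (cutoff N n x : ℂ))
      (Complex.ofRealCLM.comp (fderiv ℝ (cutoff N n) x)) x :=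
    Complex.ofRealCLM.hasFDerivAt.comp x
      ((contDiff_cutoff N n).differentiable (by simp) x).hasFDerivAt
  have h2 := ((contDiff_mollify n hu).differentiable (by simp) x).hasFDerivAt
  have h3 := (h1.mul h2).fderiv
  have h4 := congrFun (partialDeriv_mollify n hu H) x
  rw [partialDeriv] at h4 ⊢
  rw [show approx n u = (fun x => (cutoff N n x : ℂ)) * mollify n u from rfl, h3]
  simp [h4, approx, mul_comm]

/-- Smooth compactly supported functions are dense in `H¹`. -/
theorem MemH1.exists_approx {N : ℕ} {u : Space N → ℂ} (hu : MemH1 u) :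
    ∃ w : ℕ → Space N → ℂ, (∀ n, ContDiff ℝ ∞ (w n)) ∧ (∀ n, HasCompactSupport (w n)) ∧
      (∀ᵐ x, Filter.Tendsto (fun n => w n x) Filter.atTop (nhds (u x))) ∧
      Filter.Tendsto (fun n => l2 (fun x => w n x - u x)) Filter.atTop (nhds 0) ∧
      ∀ i, Filter.Tendsto (fun n => l2 (fun x => partialDeriv i (w n) x - weakPartial i u x))
        Filter.atTop (nhds 0) := by
  have hl := hu.1.locallyIntegrable_two
  refine ⟨fun n => approx n u, fun n => contDiff_approx n hl,
    fun n => hasCompactSupport_approx n u, ae_tendsto_approx hl, tendsto_l2_approx hu.1,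
    fun i => ?_⟩
  obtain ⟨C, hC0, hC⟩ := exists_fderiv_cutoff_le N
  have hg := hu.memLp_weakPartial i
  have lim : Filter.Tendsto (fun n : ℕ => l2 (fun x => approx n (weakPartial i u) x
      - weakPartial i u x) + C * ((n : ℝ) + 1)⁻¹ * l2 u) Filter.atTop (nhds 0) := by
    have h1 := ((tendsto_one_div_add_atTop_nhds_zero_nat (𝕜 := ℝ)).const_mul C).mul_const (l2 u)
    simpa using (tendsto_l2_approx hg).add h1
  refine squeeze_zero (fun n => l2_nonneg _) (fun n => ?_) lim
  have hm := memLp_mollify n hu.1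
  set r : Space N → ℂ :=
    fun x => ((fderiv ℝ (cutoff N n) x (basisVec i) : ℝ) : ℂ) * mollify n u x with hr
  have rle : ∀ x, ‖r x‖ ≤ C * ((n : ℝ) + 1)⁻¹ * ‖mollify n u x‖ := fun x => by
    rw [hr, norm_mul, Complex.norm_real, Real.norm_eq_abs]
    gcongr
    exact hC n i x
  have rmeas : AEStronglyMeasurable r volume := by
    refine Continuous.aestronglyMeasurable ?_
    have c1 := (contDiff_mollify n hl).continuous
    have c2 : Continuous (fun x => fderiv ℝ (cutoff N n) x (basisVec i)) :=
      ((contDiff_cutoff N n).continuous_fderiv (by simp)).clm_apply continuous_const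
    fun_prop
  have rmem : MemLp r 2 volume := hm.1.of_le_mul rmeas (Filter.Eventually.of_forall rle)
  have rl2 : l2 r ≤ C * ((n : ℝ) + 1)⁻¹ * l2 u := by
    have h1 := eLpNorm_le_mul_eLpNorm_of_ae_le_mul (p := 2) (μ := volume)
      (Filter.Eventually.of_forall rle)
    have h2 := ENNReal.toReal_mono (ENNReal.mul_ne_top ENNReal.ofReal_ne_top hm.1.2.ne) h1
    rw [ENNReal.toReal_mul, ENNReal.toReal_ofReal (by positivity)] at h2
    exact h2.trans (by gcongr; exact hm.2)
  have e : (fun x => partialDeriv i (approx n u) x - weakPartial i u x) =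
      fun x => (approx n (weakPartial i u) x - weakPartial i u x) + r x := by
    funext x
    rw [partialDeriv_approx n hl (hu.isWeakPartial i)]
    ring
  rw [e]
  exact (l2_add_le (((memLp_approx n hg).1).sub hg) rmem).trans (add_le_add le_rfl rl2)

end

noncomputable section

/-! ### The Sobolev inequality -/

/-- The squared `H¹` norm of a differentiable function, in `[0, ∞]`. -/
def classicalEnergy {N : ℕ} (u : Space N → ℂ) : ℝ≥0∞ :=
  (∫⁻ x, ‖u x‖ₑ ^ 2) + ∑ i : Fin N, ∫⁻ x, ‖partialDeriv i u x‖ₑ ^ 2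

theorem enorm_fderiv_sq_le {N : ℕ} (u : Space N → ℂ) (x : Space N) :
    ‖fderiv ℝ u x‖ₑ ^ 2 ≤ ∑ i : Fin N, ‖partialDeriv i u x‖ₑ ^ 2 := by
  have h : ‖fderiv ℝ u x‖ ≤ Real.sqrt (∑ i : Fin N, ‖partialDeriv i u x‖ ^ 2) := by
    refine ContinuousLinearMap.opNorm_le_bound _ (Real.sqrt_nonneg _) fun y => ?_
    have hy : y = ∑ i : Fin N, y i • (basisVec i : Space N) := by
      ext j; simp [basisVec, Finset.sum_apply, Pi.single_apply]
    have e : fderiv ℝ u x y = ∑ i : Fin N, y i • partialDeriv i u x := by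
      conv_lhs => rw [hy]
      simp [partialDeriv]
    rw [e, EuclideanSpace.norm_eq]
    calc ‖∑ i : Fin N, y i • partialDeriv i u x‖ ≤ ∑ i : Fin N, ‖partialDeriv i u x‖ * ‖y i‖ := by
          refine (norm_sum_le _ _).trans (le_of_eq ?_)
          exact Finset.sum_congr rfl fun i _ => by rw [norm_smul, mul_comm]
      _ ≤ _ := Real.sum_mul_le_sqrt_mul_sqrt _ _ _
  have h2 : ‖fderiv ℝ u x‖ ^ 2 ≤ ∑ i : Fin N, ‖partialDeriv i u x‖ ^ 2 := by
    have := pow_le_pow_left₀ (norm_nonneg _) h 2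
    rwa [Real.sq_sqrt (Finset.sum_nonneg fun i _ => by positivity)] at this
  have h3 := ENNReal.ofReal_le_ofReal h2
  rw [ENNReal.ofReal_sum_of_nonneg fun i _ => by positivity] at h3
  simpa [ENNReal.ofReal_pow, ofReal_norm] using h3

theorem lintegral_sq_le_classicalEnergy {N : ℕ} (u : Space N → ℂ) :
    ∫⁻ x, ‖u x‖ₑ ^ 2 ≤ classicalEnergy u := le_self_add

theorem lintegral_fderiv_sq_le_classicalEnergy {N : ℕ} {u : Space N → ℂ} (hu : ContDiff ℝ 1 u) :
    ∫⁻ x, ‖fderiv ℝ u x‖ₑ ^ 2 ≤ classicalEnergy u := by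
  have c : ∀ i, Continuous (partialDeriv i u) := fun i => by
    unfold partialDeriv
    exact (hu.continuous_fderiv (by simp)).clm_apply continuous_const
  calc ∫⁻ x, ‖fderiv ℝ u x‖ₑ ^ 2 ≤ ∫⁻ x, ∑ i : Fin N, ‖partialDeriv i u x‖ₑ ^ 2 :=
        lintegral_mono fun x => enorm_fderiv_sq_le u x
    _ = ∑ i : Fin N, ∫⁻ x, ‖partialDeriv i u x‖ₑ ^ 2 := by
        refine lintegral_finsetSum _ fun i _ => ?_
        have := (c i).measurable
        fun_prop
    _ ≤ _ := le_add_self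

theorem lintegral_mul_le_sqrt {N : ℕ} {f g : Space N → ℝ≥0∞} (hf : AEMeasurable f)
    (hg : AEMeasurable g) :
    (∫⁻ x, f x * g x) ^ 2 ≤ (∫⁻ x, f x ^ 2) * ∫⁻ x, g x ^ 2 := by
  have H := ENNReal.lintegral_mul_le_Lp_mul_Lq (μ := (volume : Measure (Space N)))
    (p := 2) (q := 2) (by norm_num [Real.holderConjugate_iff]) hf hg
  simp only [Pi.mul_apply, ENNReal.rpow_two] at H
  have := pow_le_pow_left' H 2
  rw [mul_pow, ← ENNReal.rpow_natCast (_ ^ (1 / 2 : ℝ)), ← ENNReal.rpow_natCast (_ ^ (1 / 2 : ℝ)),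
    ← ENNReal.rpow_mul, ← ENNReal.rpow_mul] at this
  norm_num at this
  exact this

theorem enorm_fderiv_pow_le {N : ℕ} {u : Space N → ℂ} (hu : ContDiff ℝ 1 u) (k : ℕ)
    (x : Space N) :
    ‖fderiv ℝ (fun x => u x ^ (k + 1)) x‖ₑ ≤ (k + 1) * (‖u x‖ₑ ^ k * ‖fderiv ℝ u x‖ₑ) := by
  have h := ((hu.differentiable (by simp) x).hasFDerivAt.pow (k + 1)).fderiv
  rw [h]
  rw [enorm_smul]
  have e : ‖((k : ℂ) + 1)‖ₑ = k + 1 := by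
    rw [← ofReal_norm, show ((k : ℂ) + 1) = ((k + 1 : ℕ) : ℂ) by push_cast; ring, Complex.norm_natCast,
      ENNReal.ofReal_natCast]
    push_cast; ring
  simp [mul_assoc, e]

/-- In low dimension the `W^{1,1}` inequality is applied to powers of `u`. By Cauchy–Schwarz this
trades one factor of energy for a gain of integrability. -/
theorem sq_lintegral_fderiv_pow_le {N : ℕ} {u : Space N → ℂ} (hu : ContDiff ℝ 1 u) (k : ℕ) :
    (∫⁻ x, ‖fderiv ℝ (fun x => u x ^ (k + 1)) x‖ₑ) ^ 2 ≤
      (k + 1) ^ 2 * ((∫⁻ x, ‖u x‖ₑ ^ (2 * k)) * classicalEnergy u) := by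
  have m1 : Measurable fun x => ‖u x‖ₑ ^ k := by
    have := hu.continuous.measurable; fun_prop
  have m2 : Measurable fun x => ‖fderiv ℝ u x‖ₑ :=
    (hu.continuous_fderiv (by simp)).measurable.enorm
  calc (∫⁻ x, ‖fderiv ℝ (fun x => u x ^ (k + 1)) x‖ₑ) ^ 2
      ≤ (∫⁻ x, (k + 1) * (‖u x‖ₑ ^ k * ‖fderiv ℝ u x‖ₑ)) ^ 2 := by
        gcongr with x
        exact enorm_fderiv_pow_le hu k x
    _ = (k + 1) ^ 2 * (∫⁻ x, ‖u x‖ₑ ^ k * ‖fderiv ℝ u x‖ₑ) ^ 2 := by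
        have m3 : Measurable fun x => ‖u x‖ₑ ^ k * ‖fderiv ℝ u x‖ₑ := m1.mul m2
        rw [lintegral_const_mul _ m3, mul_pow]
    _ ≤ (k + 1) ^ 2 * ((∫⁻ x, (‖u x‖ₑ ^ k) ^ 2) * ∫⁻ x, ‖fderiv ℝ u x‖ₑ ^ 2) := by
        gcongr
        exact lintegral_mul_le_sqrt m1.aemeasurable m2.aemeasurable
    _ ≤ _ := by
        simp only [← pow_mul, mul_comm k 2]
        gcongr
        exact lintegral_fderiv_sq_le_classicalEnergy hu

theorem contDiff_pow_comp {N : ℕ} {u : Space N → ℂ} (hu : ContDiff ℝ 1 u) (k : ℕ) :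
    ContDiff ℝ 1 (fun x => u x ^ k) := hu.pow k

theorem hasCompactSupport_pow_succ {N : ℕ} {u : Space N → ℂ} (hc : HasCompactSupport u) (k : ℕ) :
    HasCompactSupport (fun x => u x ^ (k + 1)) :=
  hc.comp_left (g := fun z : ℂ => z ^ (k + 1)) (by simp)

/-- In dimension one, the sup norm is controlled by the `L¹` norm of the derivative. -/
theorem enorm_le_lintegral_fderiv_one {u : Space 1 → ℂ} (hu : ContDiff ℝ 1 u)
    (hc : HasCompactSupport u) (x : Space 1) : ‖u x‖ₑ ≤ ∫⁻ y, ‖fderiv ℝ u y‖ₑ := by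
  -- The map `t ↦ t e₀` is a measure preserving isometry of the real line onto the space, which
  -- reduces the claim to one variable.
  set L : ℝ →L[ℝ] Space 1 := ContinuousLinearMap.toSpanSingleton ℝ (basisVec 0) with hL
  have hLx : ∀ t, L t = t • (basisVec 0 : Space 1) := fun t => rfl
  have Ln : ∀ t, ‖L t‖ = ‖t‖ := fun t => by simp [hLx, basisVec, norm_smul]
  have iso : Isometry L := AddMonoidHomClass.isometry_of_norm L Ln
  have hv : ContDiff ℝ 1 (u ∘ L) := hu.comp L.contDiff
  have hcv : HasCompactSupport (u ∘ L) := hc.comp_isClosedEmbedding iso.isClosedEmbedding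
  have mp : MeasurePreserving L volume volume := by
    have h1 := (volume_preserving_funUnique (Fin 1) ℝ).symm
    have h2 := (EuclideanSpace.volume_preserving_symm_measurableEquiv_toLp (Fin 1)).symm
    have h3 : (L : ℝ → Space 1) = (MeasurableEquiv.toLp 2 (Fin 1 → ℝ)).symm.symm ∘
        (MeasurableEquiv.funUnique (Fin 1) ℝ).symm := by
      funext t
      ext j
      fin_cases j
      simp [hLx, basisVec]
    rw [h3]
    exact h2.comp h1
  have hx : x = L (x 0) := by
    ext j; fin_cases j; simp [hLx, basisVec]
  have key := hcv.enorm_le_lintegral_Ici_deriv hv (x 0)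
  rw [Function.comp_apply, ← hx] at key
  refine key.trans ?_
  calc ∫⁻ t in Iic (x 0), ‖deriv (u ∘ L) t‖ₑ ≤ ∫⁻ t, ‖deriv (u ∘ L) t‖ₑ :=
        lintegral_mono' Measure.restrict_le_self le_rfl
    _ ≤ ∫⁻ t, ‖fderiv ℝ u (L t)‖ₑ := by
        gcongr with t
        have : deriv (u ∘ L) t = fderiv ℝ u (L t) (basisVec 0) := by
          have := ((hu.differentiable (by simp) (L t)).hasFDerivAt.comp_hasDerivAt t
            L.hasDerivAt).deriv
          rw [this]; simp [hLx]
        rw [this]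
        refine (ContinuousLinearMap.le_opENorm _ _).trans ?_
        have e1 : ‖(basisVec 0 : Space 1)‖ₑ = 1 := by
          rw [← ofReal_norm]; simp [basisVec]
        rw [e1, mul_one]
    _ = ∫⁻ y, ‖fderiv ℝ u y‖ₑ :=
        mp.lintegral_comp ((hu.continuous_fderiv (by simp)).measurable.enorm)

/-- The inductive step for even powers in dimensions one and two. -/
theorem exists_lintegral_pow_succ_le {N : ℕ} (hN : N = 1 ∨ N = 2) (k : ℕ) (hk : 1 ≤ k) :
    ∃ C : NNReal, ∀ u : Space N → ℂ, ContDiff ℝ 1 u → HasCompactSupport u →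
      ∫⁻ x, ‖u x‖ₑ ^ (2 * k) ≤ C * classicalEnergy u ^ k := by
  induction k, hk using Nat.le_induction with
  | base => exact ⟨1, fun u _ _ => by simpa using lintegral_sq_le_classicalEnergy u⟩
  | succ k hk ih =>
    obtain ⟨C, hC⟩ := ih
    rcases hN with rfl | rfl
    -- Dimension one: `|u|²` is bounded by `∫ |∇(u²)|`, hence by twice the energy, and this sup
    -- bound is pulled out of the integral.
    · refine ⟨2 * C, fun u hu hc => ?_⟩
      have sup : ∀ x, ‖u x‖ₑ ^ 2 ≤ 2 * classicalEnergy u := fun x => by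
        have h1 := enorm_le_lintegral_fderiv_one (contDiff_pow_comp hu 2)
          (hasCompactSupport_pow_succ hc 1) x
        have h2 := sq_lintegral_fderiv_pow_le hu 1
        have h3 : (‖u x‖ₑ ^ 2) ^ 2 ≤ (2 * classicalEnergy u) ^ 2 := by
          rw [← enorm_pow]
          calc ‖u x ^ 2‖ₑ ^ 2 ≤ (∫⁻ x, ‖fderiv ℝ (fun x => u x ^ (1 + 1)) x‖ₑ) ^ 2 := by
                gcongr
            _ ≤ _ := h2
            _ ≤ (2 * classicalEnergy u) ^ 2 := by
                rw [mul_pow, sq (classicalEnergy u)]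
                norm_num
                exact mul_le_mul' le_rfl (mul_le_mul' (lintegral_sq_le_classicalEnergy u) le_rfl)
        exact (ENNReal.pow_le_pow_left_iff (by norm_num)).1 h3
      calc ∫⁻ x, ‖u x‖ₑ ^ (2 * (k + 1)) ≤ ∫⁻ x, 2 * classicalEnergy u * ‖u x‖ₑ ^ (2 * k) := by
            refine lintegral_mono fun x => ?_
            rw [mul_add, pow_add, mul_comm]
            gcongr
            simpa using sup x
        _ = 2 * classicalEnergy u * ∫⁻ x, ‖u x‖ₑ ^ (2 * k) := by
            refine lintegral_const_mul _ ?_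
            have := hu.continuous.measurable
            fun_prop
        _ ≤ 2 * classicalEnergy u * (C * classicalEnergy u ^ k) := by gcongr; exact hC u hu hc
        _ = _ := by push_cast; ring
    -- Dimension two: the embedding of `W^{1,1}` into `L²` is applied to `u^{k+1}`, and the
    -- induction hypothesis controls the resulting `L^{2k}` factor.
    · set K := lintegralPowLePowLIntegralFDerivConst (volume : Measure (Space 2)) 2 with hK
      refine ⟨K * (k + 1) ^ 2 * C, fun u hu hc => ?_⟩
      have h1 := lintegral_pow_le_pow_lintegral_fderiv (volume : Measure (Space 2))
        (contDiff_pow_comp hu (k + 1)) (hasCompactSupport_pow_succ hc k) (p := 2)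
        (by rw [finrank_euclideanSpace]; norm_num [Real.holderConjugate_iff])
      have h2 := sq_lintegral_fderiv_pow_le hu k
      simp only [ENNReal.rpow_two] at h1
      calc ∫⁻ x, ‖u x‖ₑ ^ (2 * (k + 1)) = ∫⁻ x, ‖u x ^ (k + 1)‖ₑ ^ 2 := by
            refine lintegral_congr fun x => ?_
            rw [enorm_pow, ← pow_mul, mul_comm]
        _ ≤ _ := h1
        _ ≤ K * ((k + 1) ^ 2 * ((C * classicalEnergy u ^ k) * classicalEnergy u)) := by
            gcongr
            refine h2.trans ?_
            gcongr
            exact hC u hu hc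
        _ = _ := by push_cast; ring

/-- A Sobolev inequality with an exponent that may be taken as large as permitted. -/
theorem exists_lintegral_rpow_le {N : ℕ} (hN : 1 ≤ N) (p : ℝ) (hp : 2 ≤ p)
    (hpN : 3 ≤ N → p ≤ 2 * N / (N - 2)) :
    ∃ q : ℝ, p ≤ q ∧ ∃ C : NNReal, ∀ u : Space N → ℂ, ContDiff ℝ 1 u → HasCompactSupport u →
      ∫⁻ x, ‖u x‖ₑ ^ q ≤ C * classicalEnergy u ^ (q / 2) := by
  by_cases h3 : 3 ≤ N
  · have hN' : (3 : ℝ) ≤ N := by exact_mod_cast h3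
    have hq0 : (0 : ℝ) < 2 * N / (N - 2) := div_pos (by linarith) (by linarith)
    refine ⟨2 * N / (N - 2), hpN h3, ?_⟩
    set q : NNReal := ⟨2 * N / (N - 2), hq0.le⟩ with hq
    have hqc : (q : ℝ) = 2 * N / (N - 2) := rfl
    set K := eLpNormLESNormFDerivOfEqInnerConst (volume : Measure (Space N)) 2 with hK
    refine ⟨K ^ (q : ℝ), fun u hu hc => ?_⟩
    have h1 := eLpNorm_le_eLpNorm_fderiv_of_eq_inner (volume : Measure (Space N)) hu hc
      (p := 2) (p' := q) (by norm_num) (by rw [finrank_euclideanSpace, Fintype.card_fin]; omega)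
      (by
        rw [finrank_euclideanSpace, hqc]
        simp only [Fintype.card_fin]
        have : (N : ℝ) - 2 ≠ 0 := by linarith
        field_simp
        norm_num
        ring)
    have q0 : q ≠ 0 := by
      intro h; rw [h] at hqc; simp at hqc; linarith [hq0]
    have h2 := ENNReal.rpow_le_rpow h1 q.coe_nonneg
    rw [eLpNorm_nnreal_pow_eq_lintegral q0, ENNReal.mul_rpow_of_nonneg _ _ q.coe_nonneg] at h2
    rw [← hqc]
    refine h2.trans ?_
    rw [← ENNReal.coe_rpow_of_nonneg _ q.coe_nonneg]
    have h4 : eLpNorm (fderiv ℝ u) ((2 : NNReal) : ℝ≥0∞) volume =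
        (∫⁻ x, ‖fderiv ℝ u x‖ₑ ^ 2) ^ (1 / 2 : ℝ) := by
      rw [eLpNorm_nnreal_eq_lintegral (by norm_num)]
      norm_num
    erw [h4]
    rw [← ENNReal.rpow_mul, one_div_mul_eq_div]
    refine mul_le_mul' le_rfl (ENNReal.rpow_le_rpow ?_ (by positivity))
    exact lintegral_fderiv_sq_le_classicalEnergy hu
  -- There is no critical exponent here, so any even integer above `p` serves as `q`.
  · have hN12 : N = 1 ∨ N = 2 := by omega
    obtain ⟨k, hk⟩ := exists_nat_ge p
    have hk1 : 1 ≤ k := by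
      have : (2 : ℝ) ≤ k := hp.trans hk
      have : 2 ≤ k := by exact_mod_cast this
      omega
    obtain ⟨C, hC⟩ := exists_lintegral_pow_succ_le hN12 k hk1
    refine ⟨(2 * k : ℕ), ?_, C, fun u hu hc => ?_⟩
    · push_cast; linarith
    · have := hC u hu hc
      have e : ((2 * k : ℕ) : ℝ) / 2 = k := by push_cast; ring
      simpa only [e, ENNReal.rpow_natCast] using this

theorem classicalEnergy_eq {N : ℕ} {u : Space N → ℂ} (hu : ContDiff ℝ 1 u)
    (hc : HasCompactSupport u) :
    classicalEnergy u = ENNReal.ofReal (l2 u ^ 2 + ∑ i : Fin N, l2 (partialDeriv i u) ^ 2) := by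
  have c : ∀ i, Continuous (partialDeriv i u) := fun i => by
    unfold partialDeriv
    exact (hu.continuous_fderiv (by simp)).clm_apply continuous_const
  have m0 : MemLp u 2 volume := hu.continuous.memLp_of_hasCompactSupport hc
  have m1 : ∀ i, MemLp (partialDeriv i u) 2 volume := fun i =>
    (c i).memLp_of_hasCompactSupport (hc.fderiv_apply ℝ _)
  have e : ∀ {v : Space N → ℂ}, MemLp v 2 volume →
      ENNReal.ofReal (l2 v ^ 2) = ∫⁻ x, ‖v x‖ₑ ^ 2 := fun {v} hv => by
    rw [← eLpNorm_two_sq, ENNReal.ofReal_pow (l2_nonneg _), l2, ENNReal.ofReal_toReal hv.2.ne]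
  rw [ENNReal.ofReal_add (sq_nonneg _) (Finset.sum_nonneg fun i _ => sq_nonneg _),
    ENNReal.ofReal_sum_of_nonneg fun i _ => sq_nonneg _, e m0]
  simp only [classicalEnergy]
  congr 1
  exact Finset.sum_congr rfl fun i _ => (e (m1 i)).symm

theorem tendsto_l2 {N : ℕ} {f : ℕ → Space N → ℂ} {g : Space N → ℂ}
    (hf : ∀ n, MemLp (f n) 2 volume) (hg : MemLp g 2 volume)
    (h : Filter.Tendsto (fun n => l2 (fun x => f n x - g x)) Filter.atTop (nhds 0)) :
    Filter.Tendsto (fun n => l2 (f n)) Filter.atTop (nhds (l2 g)) := by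
  rw [tendsto_iff_norm_sub_tendsto_zero]
  refine squeeze_zero (fun _ => norm_nonneg _) (fun n => ?_) h
  have d : MemLp (fun x => f n x - g x) 2 volume := (hf n).sub hg
  have h1 := l2_add_le d hg
  have h2 := l2_add_le (hf n) (u := f n) (v := fun x => (-1 : ℂ) * (f n x - g x))
    (d.const_mul (-1))
  have h3 : l2 (fun x => (-1 : ℂ) * (f n x - g x)) = l2 (fun x => f n x - g x) := by
    rw [l2, l2, eLpNorm_congr_norm_ae (g := fun x => f n x - g x)
      (Filter.Eventually.of_forall fun x => by simp [norm_sub_rev])]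
  rw [h3] at h2
  simp only [sub_add_cancel] at h1
  have e : (fun x => f n x + (-1 : ℂ) * (f n x - g x)) = g := by funext x; ring
  rw [e] at h2
  rw [Real.norm_eq_abs, abs_le]
  constructor <;> linarith

/-- **Sobolev's inequality** for functions in the unit ball of `H¹`. -/
theorem exists_integral_rpow_le {N : ℕ} (hN : 1 ≤ N) (p : ℝ) (hp : 2 ≤ p)
    (hpN : 3 ≤ N → p ≤ 2 * N / (N - 2)) :
    ∃ C : ℝ, 0 ≤ C ∧ ∀ u : Space N → ℂ, MemH1 u → normH1 u ≤ 1 →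
      Integrable (fun x => ‖u x‖ ^ p) ∧ ∫ x, ‖u x‖ ^ p ≤ C * normH1 u ^ 2 := by
  obtain ⟨q, hpq, C, hC⟩ := exists_lintegral_rpow_le hN p hp hpN
  have q2 : 2 ≤ q := hp.trans hpq
  refine ⟨1 + C, by positivity, fun u hu hu1 => ?_⟩
  obtain ⟨w, ws, wc, wae, w0, w1⟩ := hu.exists_approx
  have wm : ∀ n, MemLp (w n) 2 volume := fun n =>
    (ws n).continuous.memLp_of_hasCompactSupport (wc n)
  have wm1 : ∀ i n, MemLp (partialDeriv i (w n)) 2 volume := fun i n => by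
    refine Continuous.memLp_of_hasCompactSupport ?_ ((wc n).fderiv_apply ℝ _)
    unfold partialDeriv
    exact ((ws n).continuous_fderiv (by simp)).clm_apply continuous_const
  have E : Filter.Tendsto (fun n => classicalEnergy (w n)) Filter.atTop
      (nhds (ENNReal.ofReal (normH1 u ^ 2))) := by
    simp only [fun n => classicalEnergy_eq ((ws n).of_le (by simp)) (wc n)]
    refine ENNReal.tendsto_ofReal ?_
    rw [hu.normH1_sq_eq]
    exact ((tendsto_l2 wm hu.1 w0).pow 2).add (tendsto_finsetSum _ fun i _ =>
      (tendsto_l2 (wm1 i) (hu.memLp_weakPartial i) (w1 i)).pow 2)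
  -- The inequality passes from test functions to `u` by Fatou along an almost everywhere convergent
  -- approximation whose energies converge.
  have fat : ∫⁻ x, ‖u x‖ₑ ^ q ≤ C * ENNReal.ofReal (normH1 u ^ 2) ^ (q / 2) := by
    have lim : Filter.Tendsto (fun n => (C : ℝ≥0∞) * classicalEnergy (w n) ^ (q / 2)) Filter.atTop
        (nhds (C * ENNReal.ofReal (normH1 u ^ 2) ^ (q / 2))) :=
      ENNReal.Tendsto.const_mul ((ENNReal.continuous_rpow_const.tendsto _).comp E)
        (Or.inr ENNReal.coe_ne_top)
    rw [← lim.liminf_eq]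
    refine le_trans ?_ (Filter.liminf_le_liminf (Filter.Eventually.of_forall fun n =>
      hC (w n) ((ws n).of_le (by simp)) (wc n)))
    refine le_trans (le_of_eq ?_) (lintegral_liminf_le' fun n =>
      ((ws n).continuous.measurable.enorm.pow_const q).aemeasurable)
    refine lintegral_congr_ae (wae.mono fun x hx => ?_)
    exact (((ENNReal.continuous_rpow_const.tendsto _).comp
      ((continuous_enorm.tendsto _).comp hx)).liminf_eq).symm
  -- In the unit ball the power `q / 2 ≥ 1` of the squared norm may be lowered to the first power,
  -- so the final bound is quadratic whatever `p` is.
  have hle : ENNReal.ofReal (normH1 u ^ 2) ^ (q / 2) ≤ ENNReal.ofReal (normH1 u ^ 2) := by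
    rw [ENNReal.ofReal_rpow_of_nonneg (sq_nonneg _) (by linarith)]
    refine ENNReal.ofReal_le_ofReal (Real.rpow_le_self_of_le_one (sq_nonneg _) ?_ (by linarith))
    exact pow_le_one₀ (normH1_nonneg u) hu1
  have sq : ∫⁻ x, ‖u x‖ₑ ^ 2 ≤ ENNReal.ofReal (normH1 u ^ 2) := by
    rw [← eLpNorm_two_sq, ← ENNReal.ofReal_toReal hu.1.2.ne,
      ← ENNReal.ofReal_pow ENNReal.toReal_nonneg]
    exact ENNReal.ofReal_le_ofReal (pow_le_pow_left₀ (l2_nonneg u) hu.l2_le 2)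
  have tot : ∫⁻ x, ENNReal.ofReal (‖u x‖ ^ p) ≤ ENNReal.ofReal ((1 + C) * normH1 u ^ 2) := by
    calc ∫⁻ x, ENNReal.ofReal (‖u x‖ ^ p) ≤ ∫⁻ x, (‖u x‖ₑ ^ 2 + ‖u x‖ₑ ^ q) := by
          refine lintegral_mono fun x => ?_
          -- Since `2 ≤ p ≤ q`, the power `p` is dominated by the square below `1` and by the power
          -- `q` above `1`.
          have : ‖u x‖ ^ p ≤ ‖u x‖ ^ 2 + ‖u x‖ ^ q := by
            rcases le_total ‖u x‖ 1 with h | h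
            · have : ‖u x‖ ^ p ≤ ‖u x‖ ^ (2 : ℝ) := by
                rcases (norm_nonneg (u x)).eq_or_lt with h0 | h0
                · rw [← h0, Real.zero_rpow (by linarith), Real.zero_rpow (by norm_num)]
                · exact Real.rpow_le_rpow_of_exponent_ge h0 h hp
              rw [Real.rpow_two] at this
              have := Real.rpow_nonneg (norm_nonneg (u x)) q
              linarith
            · have := Real.rpow_le_rpow_of_exponent_le h hpq
              nlinarith [norm_nonneg (u x)]
          calc ENNReal.ofReal (‖u x‖ ^ p) ≤ ENNReal.ofReal (‖u x‖ ^ 2 + ‖u x‖ ^ q) :=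
                ENNReal.ofReal_le_ofReal this
            _ = _ := by
              rw [ENNReal.ofReal_add (by positivity) (by positivity),
                ENNReal.ofReal_pow (norm_nonneg _), ofReal_norm,
                ← ENNReal.ofReal_rpow_of_nonneg (norm_nonneg _) (by linarith),
                ofReal_norm]
      _ = (∫⁻ x, ‖u x‖ₑ ^ 2) + ∫⁻ x, ‖u x‖ₑ ^ q :=
          lintegral_add_left' (hu.1.1.enorm.pow_const 2) _
      _ ≤ ENNReal.ofReal (normH1 u ^ 2) + C * ENNReal.ofReal (normH1 u ^ 2) := by
          gcongr
          exact fat.trans (by gcongr)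
      _ = _ := by
          rw [ENNReal.ofReal_mul (by positivity), ENNReal.ofReal_add zero_le_one (by positivity),
            add_mul, ENNReal.ofReal_one, one_mul, ENNReal.ofReal_coe_nnreal]
  have meas : AEStronglyMeasurable (fun x => ‖u x‖ ^ p) volume :=
    (hu.1.1.norm.aemeasurable.pow_const p).aestronglyMeasurable
  have nn : 0 ≤ᵐ[volume] fun x => ‖u x‖ ^ p :=
    Filter.Eventually.of_forall fun x => Real.rpow_nonneg (norm_nonneg _) _
  refine ⟨⟨meas, ?_⟩, ?_⟩
  · rw [hasFiniteIntegral_iff_ofReal nn]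
    exact tot.trans_lt ENNReal.ofReal_lt_top
  · rw [integral_eq_lintegral_of_nonneg_ae nn meas]
    exact ENNReal.toReal_le_of_le_ofReal (by positivity) tot

end

noncomputable section

/-! ### The radial profile equation -/

/-- A positive solution `f`, with derivatives `f₁` and `f₂`, of
`f'' + (d / r) f' = f - f ^ (2 s + 1)` on `(0, ∞)`. -/
structure IsRadialSolution (d : ℕ) (s : ℝ) (f f₁ f₂ : ℝ → ℝ) : Prop where
  pos : ∀ r, 0 < r → 0 < f r
  deriv₁ : ∀ r, 0 < r → HasDerivAt f (f₁ r) r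
  deriv₂ : ∀ r, 0 < r → HasDerivAt f₁ (f₂ r) r
  eq : ∀ r, 0 < r → f₂ r + d / r * f₁ r = f r - f r ^ (2 * s + 1)

namespace IsRadialSolution

variable {d : ℕ} {s : ℝ} {f f₁ f₂ : ℝ → ℝ}

/-- The energy of a radial solution. -/
def energy (s : ℝ) (f f₁ : ℝ → ℝ) (r : ℝ) : ℝ :=
  f₁ r ^ 2 / 2 - f r ^ 2 / 2 + f r ^ (2 * s + 2) / (2 * s + 2)

/-- Multiplying the equation by `f₁` makes every term a total derivative except the friction `d / r
· f₁²`. -/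
theorem hasDerivAt_energy (hs : 0 < s) (h : IsRadialSolution d s f f₁ f₂) {r : ℝ} (hr : 0 < r) :
    HasDerivAt (energy s f f₁) (-(d / r) * f₁ r ^ 2) r := by
  have h1 := h.deriv₁ r hr
  have h2 := h.deriv₂ r hr
  have h3 := (h1.rpow_const (p := 2 * s + 2) (Or.inl (h.pos r hr).ne')).div_const (2 * s + 2)
  have h4 := (((h2.pow 2).div_const 2).sub ((h1.pow 2).div_const 2)).add h3
  refine h4.congr_deriv ?_
  have e := h.eq r hr
  have e2 : 2 * s + 2 - 1 = 2 * s + 1 := by ring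
  have e3 : 2 * s + 2 ≠ 0 := by positivity
  rw [e2]
  have e4 : f₁ r * (2 * s + 2) * f r ^ (2 * s + 1) / (2 * s + 2) = f₁ r * f r ^ (2 * s + 1) := by
    field_simp
  rw [e4]
  have e5 : f₂ r = f r - f r ^ (2 * s + 1) - d / r * f₁ r := by linarith
  rw [e5]
  simp
  ring

theorem monotoneOn_of_hasDerivAt {g g' : ℝ → ℝ} {R : ℝ}
    (hg : ∀ r, R ≤ r → HasDerivAt g (g' r) r) (h : ∀ r, R ≤ r → 0 ≤ g' r) :
    MonotoneOn g (Ici R) := by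
  refine monotoneOn_of_deriv_nonneg (convex_Ici R)
    (fun x hx => (hg x hx).continuousAt.continuousWithinAt)
    (fun x hx => (hg x (interior_subset hx)).differentiableAt.differentiableWithinAt) fun x hx => ?_
  rw [(hg x (interior_subset hx)).deriv]
  exact h x (interior_subset hx)

theorem antitoneOn_of_hasDerivAt {g g' : ℝ → ℝ} {R : ℝ}
    (hg : ∀ r, R ≤ r → HasDerivAt g (g' r) r) (h : ∀ r, R ≤ r → g' r ≤ 0) :
    AntitoneOn g (Ici R) := by
  have := (monotoneOn_of_hasDerivAt (g := -g) (g' := -g') (fun r hr => (hg r hr).neg)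
    (fun r hr => by simpa using h r hr)).neg
  simpa using this

theorem nonneg_of_antitoneOn {g : ℝ → ℝ} {R : ℝ} (h : AntitoneOn g (Ici R))
    (h0 : Filter.Tendsto g Filter.atTop (nhds 0)) {r : ℝ} (hr : R ≤ r) : 0 ≤ g r := by
  refine le_of_tendsto h0 ?_
  filter_upwards [Filter.eventually_ge_atTop r] with t ht
  exact h hr (hr.trans ht) ht

theorem nonpos_of_monotoneOn {g : ℝ → ℝ} {R : ℝ} (h : MonotoneOn g (Ici R))
    (h0 : Filter.Tendsto g Filter.atTop (nhds 0)) {r : ℝ} (hr : R ≤ r) : g r ≤ 0 := by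
  refine ge_of_tendsto h0 ?_
  filter_upwards [Filter.eventually_ge_atTop r] with t ht
  exact h hr (hr.trans ht) ht

/-- The threshold `K` solves `K^{2s} = 2s + 2`; beyond it the superquadratic term dominates `y²`. -/
theorem exists_potential_ge (hs : 0 < s) :
    ∃ B : ℝ, ∀ y : ℝ, 0 < y → -B ≤ -(y ^ 2 / 2) + y ^ (2 * s + 2) / (2 * s + 2) := by
  refine ⟨((2 * s + 2) ^ (1 / (2 * s))) ^ 2 / 2, fun y hy => ?_⟩
  set K := (2 * s + 2) ^ (1 / (2 * s)) with hK
  have K0 : 0 < K := Real.rpow_pos_of_pos (by positivity) _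
  have p2 : 0 ≤ y ^ (2 * s + 2) / (2 * s + 2) := by positivity
  rcases le_total y K with h | h
  · nlinarith
  · have h1 : K ^ (2 * s) ≤ y ^ (2 * s) := Real.rpow_le_rpow K0.le h (by positivity)
    have h2 : K ^ (2 * s) = 2 * s + 2 := by
      rw [hK, ← Real.rpow_mul (by positivity)]
      rw [one_div_mul_cancel (by positivity), Real.rpow_one]
    have h3 : y ^ (2 * s + 2) = y ^ (2 * s) * y ^ 2 := by
      rw [Real.rpow_add hy, Real.rpow_two]
    have h4 : y ^ 2 ≤ y ^ (2 * s + 2) / (2 * s + 2) := by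
      rw [le_div_iff₀ (by positivity), h3, mul_comm]
      rw [h2] at h1
      gcongr
    nlinarith [sq_nonneg K, sq_nonneg y]

/-- The energy decreases and its potential part is bounded below, so the kinetic part stays bounded.
This is used before any decay of `f` is known. -/
theorem exists_abs_deriv_le (hs : 0 < s) (h : IsRadialSolution d s f f₁ f₂) :
    ∃ M : ℝ, 0 < M ∧ ∀ r, 1 ≤ r → |f₁ r| ≤ M := by
  obtain ⟨B, hB⟩ := exists_potential_ge hs
  have anti : AntitoneOn (energy s f f₁) (Ici 1) :=
    antitoneOn_of_hasDerivAt (fun r hr => h.hasDerivAt_energy hs (by linarith)) fun r hr => by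
      have : 0 ≤ (d : ℝ) / r := by positivity
      nlinarith [sq_nonneg (f₁ r)]
  set A := 2 * (energy s f f₁ 1 + B) with hA
  refine ⟨Real.sqrt A + 1, by positivity, fun r hr => ?_⟩
  have h1 := anti (mem_Ici.2 le_rfl) (mem_Ici.2 hr) hr
  have h2 := hB (f r) (h.pos r (by linarith))
  have h3 : f₁ r ^ 2 ≤ A := by
    simp only [energy] at h1 hA
    rw [hA]
    linarith
  have := Real.abs_le_sqrt h3
  linarith

/-- The consequences of decay at infinity for a radial solution. -/
theorem exists_decay (hs : 0 < s) (h : IsRadialSolution d s f f₁ f₂)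
    (h0 : Filter.Tendsto f Filter.atTop (nhds 0)) :
    ∃ R K : ℝ, 1 ≤ R ∧ 0 ≤ K ∧ ∀ r, R ≤ r →
      f r ≤ K * Real.exp (-(1 / 2) * r) ∧ |f₁ r| ≤ K * f r ∧ |f₂ r| ≤ K * f r := by
  have hpow : Filter.Tendsto (fun r => f r ^ (2 * s)) Filter.atTop (nhds 0) := by
    have := (Real.continuousAt_rpow_const 0 (2 * s) (Or.inr (by positivity))).tendsto.comp h0
    rwa [Real.zero_rpow (by positivity)] at this
  obtain ⟨R, hR⟩ := Filter.eventually_atTop.1 ((hpow.eventually (gt_mem_nhds (by norm_num :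
    (0 : ℝ) < 1 / 2))).and (Filter.eventually_ge_atTop (1 : ℝ)))
  have R1 : 1 ≤ R := (hR R le_rfl).2
  have rpos : ∀ r, R ≤ r → 0 < r := fun r hr => by linarith
  have fpos : ∀ r, R ≤ r → 0 < f r := fun r hr => h.pos r (rpos r hr)
  have hsplit : ∀ r, R ≤ r → f r ^ (2 * s + 1) = f r ^ (2 * s) * f r := fun r hr => by
    rw [Real.rpow_add (fpos r hr), Real.rpow_one]
  have hsource : ∀ r, R ≤ r → f r / 2 < f r - f r ^ (2 * s + 1) := fun r hr => by
    rw [hsplit r hr]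
    nlinarith [(hR r hr).1, fpos r hr]
  -- the flux is increasing
  have flux : StrictMonoOn (fun r => r ^ d * f₁ r) (Ici R) := by
    have hd : ∀ r, R ≤ r → HasDerivAt (fun r => r ^ d * f₁ r)
        (r ^ d * (f r - f r ^ (2 * s + 1))) r := fun r hr => by
      refine (((hasDerivAt_id r).pow d).mul (h.deriv₂ r (rpos r hr))).congr_deriv ?_
      rw [← h.eq r (rpos r hr)]
      have := (rpos r hr).ne'
      rcases Nat.eq_zero_or_pos d with rfl | hd
      · simp
      · obtain ⟨e, rfl⟩ := Nat.exists_eq_succ_of_ne_zero hd.ne'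
        simp only [id, Nat.succ_eq_add_one, Nat.add_sub_cancel, pow_succ, mul_one, Pi.pow_apply]
        field_simp
        ring
    refine strictMonoOn_of_deriv_pos (convex_Ici R)
      (fun x hx => (hd x hx).continuousAt.continuousWithinAt) fun x hx => ?_
    have hx' := interior_subset hx
    rw [(hd x hx').deriv]
    have := hsource x hx'
    have := fpos x hx'
    have := rpos x hx'
    exact mul_pos (by positivity) (by linarith)
  -- Once `f₁ ≥ 0`, the increasing flux keeps it so, and a positive nondecreasing `f` cannot tend to
  -- zero.
  have neg : ∀ r, R ≤ r → f₁ r < 0 := by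
    intro r hr
    by_contra hcon
    push Not at hcon
    have up : ∀ t, r ≤ t → 0 ≤ f₁ t := fun t ht => by
      have h1 := flux.monotoneOn hr (hr.trans ht) ht
      have h2 : 0 ≤ r ^ d * f₁ r := mul_nonneg (pow_nonneg (rpos r hr).le d) hcon
      exact nonneg_of_mul_nonneg_right (h2.trans h1) (pow_pos (rpos t (hr.trans ht)) d)
    have mono : MonotoneOn f (Ici r) := monotoneOn_of_hasDerivAt
      (fun t ht => h.deriv₁ t (rpos t (hr.trans ht))) up
    have := nonpos_of_monotoneOn mono h0 le_rfl
    linarith [fpos r hr]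
  have conv : ∀ r, R ≤ r → f r / 2 ≤ f₂ r := fun r hr => by
    have h1 := h.eq r (rpos r hr)
    have h2 := hsource r hr
    have h3 : 0 ≤ (d : ℝ) / r := div_nonneg (by positivity) (rpos r hr).le
    nlinarith [neg r hr]
  have mono1 : MonotoneOn f₁ (Ici R) := monotoneOn_of_hasDerivAt
    (fun t ht => h.deriv₂ t (rpos t ht)) fun t ht => by linarith [conv t ht, fpos t ht]
  -- The mean value theorem on `[r - 1, r]` yields an intermediate slope, and convexity says that
  -- the slope at `r` is larger, hence smaller in absolute value.
  have dbound : ∀ r, R + 1 ≤ r → |f₁ r| ≤ f (r - 1) := fun r hr => by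
    obtain ⟨ξ, hξ, he⟩ := exists_hasDerivAt_eq_slope f f₁ (by linarith : r - 1 < r)
      (fun x hx => (h.deriv₁ x (rpos x (by linarith [hx.1]))).continuousAt.continuousWithinAt)
      (fun x hx => h.deriv₁ x (rpos x (by linarith [hx.1])))
    have h1 : f₁ ξ ≤ f₁ r := mono1 (mem_Ici.2 (by linarith [hξ.1])) (mem_Ici.2 (by linarith)) hξ.2.le
    rw [he] at h1
    have h2 := fpos r (by linarith)
    have h3 := neg r (by linarith)
    rw [abs_of_neg h3]
    simp at h1
    linarith
  have lim1 : Filter.Tendsto f₁ Filter.atTop (nhds 0) := by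
    rw [tendsto_zero_iff_norm_tendsto_zero]
    have h1 : Filter.Tendsto (fun r => f (r - 1)) Filter.atTop (nhds 0) :=
      h0.comp (Filter.tendsto_atTop_add_const_right _ _ Filter.tendsto_id)
    refine squeeze_zero' (Filter.Eventually.of_forall fun _ => norm_nonneg _) ?_ h1
    filter_upwards [Filter.eventually_ge_atTop (R + 1)] with r hr
    exact dbound r hr
  -- lower bound for the logarithmic derivative, hence exponential decay
  have lower : ∀ r, R ≤ r → f₁ r ≤ -(1 / 2) * f r := by
    -- The derivative is `2 f₁ (f₂ - f / 2)`, a product of opposite signs. As the function decreases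
    -- to zero it is nonnegative, so `f₁² ≥ f² / 2`, which is stronger than needed.
    have anti : AntitoneOn (fun r => f₁ r ^ 2 - f r ^ 2 / 2) (Ici R) := by
      refine antitoneOn_of_hasDerivAt (g' := fun r => 2 * f₁ r * f₂ r - 2 * f r * f₁ r / 2)
        (fun r hr => ?_) fun r hr => ?_
      · have := ((h.deriv₂ r (rpos r hr)).pow 2).sub
          (((h.deriv₁ r (rpos r hr)).pow 2).div_const 2)
        refine this.congr_deriv ?_
        simp
      · nlinarith [neg r hr, conv r hr]
    have l0 : Filter.Tendsto (fun r => f₁ r ^ 2 - f r ^ 2 / 2) Filter.atTop (nhds 0) := by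
      have := (lim1.pow 2).sub ((h0.pow 2).div_const 2)
      simpa using this
    intro r hr
    have h1 := nonneg_of_antitoneOn anti l0 hr
    have h2 := neg r hr
    have h3 := fpos r hr
    by_contra hcon
    push Not at hcon
    nlinarith
  have expo : ∀ r, R ≤ r → f r ≤ f R * Real.exp (R / 2) * Real.exp (-(1 / 2) * r) := by
    have anti : AntitoneOn (fun r => f r * Real.exp (r / 2)) (Ici R) := by
      refine antitoneOn_of_hasDerivAt
        (g' := fun r => f₁ r * Real.exp (r / 2) + f r * (Real.exp (r / 2) * (1 / 2)))
        (fun r hr => ?_) fun r hr => ?_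
      · exact (h.deriv₁ r (rpos r hr)).mul (((hasDerivAt_id r).div_const 2).exp)
      · have := lower r hr
        have := Real.exp_pos (r / 2)
        nlinarith
    intro r hr
    have h1 := anti (mem_Ici.2 le_rfl) (mem_Ici.2 hr) hr
    simp only at h1
    have h2 : Real.exp (r / 2) * Real.exp (-(1 / 2) * r) = 1 := by
      rw [← Real.exp_add]; ring_nf; simp
    calc f r = f r * Real.exp (r / 2) * Real.exp (-(1 / 2) * r) := by rw [mul_assoc, h2, mul_one]
      _ ≤ _ := by gcongr
  -- upper bound for the logarithmic derivative
  set c : ℝ := d / R with hc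
  have c0 : 0 ≤ c := by positivity
  have upper : ∀ r, R ≤ r → |f₁ r| ≤ (1 + 2 * c) * f r := by
    -- The correction `c f f₁` with `c = d / R` outweighs the friction on `[R, ∞)`. The sum
    -- increases to zero and is therefore nonpositive, which gives `f₁² ≤ f² + 2 c f |f₁|`, a
    -- quadratic inequality for `|f₁| / f`.
    have mono : MonotoneOn (fun r => energy s f f₁ r + c * (f r * f₁ r)) (Ici R) := by
      refine monotoneOn_of_hasDerivAt
        (g' := fun r => -(d / r) * f₁ r ^ 2 + c * (f₁ r * f₁ r + f r * f₂ r))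
        (fun r hr => ?_) fun r hr => ?_
      · exact (h.hasDerivAt_energy hs (rpos r hr)).add
          (((h.deriv₁ r (rpos r hr)).mul (h.deriv₂ r (rpos r hr))).const_mul c)
      · have h1 : (d : ℝ) / r ≤ c := by rw [hc]; gcongr
        have h2 := fpos r hr
        have h3 := conv r hr
        have h4 : 0 ≤ c * (f r * f₂ r) := mul_nonneg c0 (mul_nonneg h2.le (by linarith))
        nlinarith [sq_nonneg (f₁ r)]
    have l0 : Filter.Tendsto (fun r => energy s f f₁ r + c * (f r * f₁ r)) Filter.atTop
        (nhds 0) := by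
      have hp : Filter.Tendsto (fun r => f r ^ (2 * s + 2)) Filter.atTop (nhds 0) := by
        have := (Real.continuousAt_rpow_const 0 (2 * s + 2)
          (Or.inr (by positivity))).tendsto.comp h0
        rwa [Real.zero_rpow (by positivity)] at this
      have := ((((lim1.pow 2).div_const 2).sub ((h0.pow 2).div_const 2)).add
        (hp.div_const (2 * s + 2))).add ((h0.mul lim1).const_mul c)
      simpa [energy] using this
    intro r hr
    have h1 := nonpos_of_monotoneOn mono l0 hr
    have h2 := neg r hr
    have h3 := fpos r hr
    have h4 : 0 ≤ f r ^ (2 * s + 2) / (2 * s + 2) := by positivity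
    simp only [energy] at h1
    rw [abs_of_neg h2]
    by_contra hcon
    push Not at hcon
    have h5 : 0 ≤ c * f r := by positivity
    nlinarith
  refine ⟨R, max (f R * Real.exp (R / 2)) (2 + (1 + c) * (1 + 2 * c)), R1,
    le_max_of_le_right (by positivity), fun r hr => ⟨?_, ?_, ?_⟩⟩
  · refine (expo r hr).trans ?_
    gcongr
    exact le_max_left _ _
  · refine (upper r hr).trans ?_
    have := fpos r hr
    gcongr
    refine le_max_of_le_right ?_
    nlinarith
  · have h1 := fpos r hr
    have h2 := upper r hr
    have h3 : (d : ℝ) / r ≤ c := by rw [hc]; gcongr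
    have h4 : (0 : ℝ) ≤ d / r := div_nonneg (by positivity) (rpos r hr).le
    have h5 := h.eq r (rpos r hr)
    have h6 := hsource r hr
    have h7 : 0 ≤ f r ^ (2 * s + 1) := by positivity
    have h8 : |d / r * f₁ r| ≤ c * ((1 + 2 * c) * f r) := by
      rw [abs_mul, abs_of_nonneg h4]
      gcongr
    have h9 : |f₂ r| ≤ (2 + (1 + c) * (1 + 2 * c)) * f r := by
      have e : f₂ r = f r - f r ^ (2 * s + 1) - d / r * f₁ r := by linarith
      rw [abs_le] at h8 ⊢
      have h10 : 0 ≤ (1 + 2 * c) * f r := by positivity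
      constructor <;> nlinarith
    refine h9.trans ?_
    gcongr
    exact le_max_right _ _

end IsRadialSolution

end

noncomputable section

/-! ### Pointwise bounds for the soliton profile -/

/-- The partial derivative of a real valued function. -/
def pd {N : ℕ} (i : Fin N) (g : Space N → ℝ) (x : Space N) : ℝ := fderiv ℝ g x (basisVec i)

theorem norm_basisVec {N : ℕ} (i : Fin N) : ‖(basisVec i : Space N)‖ = 1 := by simp [basisVec]

theorem contDiff_pd {N : ℕ} {i : Fin N} {g : Space N → ℝ} {n : WithTop ℕ∞}
    (hg : ContDiff ℝ (n + 1) g) : ContDiff ℝ n (pd i g) := by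
  unfold pd
  exact (hg.fderiv_right le_rfl).clm_apply contDiff_const

theorem laplacian_eq_sum_pd {N : ℕ} {g : Space N → ℝ} (hg : ContDiff ℝ 2 g) (x : Space N) :
    Laplacian.laplacian g x = ∑ i : Fin N, pd i (pd i g) x := by
  have h := congrFun (InnerProductSpace.laplacian_eq_iteratedFDeriv_orthonormalBasis g
    (EuclideanSpace.basisFun (Fin N) ℝ)) x
  rw [h]
  refine Finset.sum_congr rfl fun i _ => ?_
  rw [iteratedFDeriv_two_apply]
  simp only [pd]
  have hd : DifferentiableAt ℝ (fderiv ℝ g) x :=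
    (hg.fderiv_right (m := 1) le_rfl).differentiable (by simp) x
  have := (hd.hasFDerivAt.clm_apply (hasFDerivAt_const (basisVec i) x)).fderiv
  rw [show fderiv ℝ (pd i g) x = _ from this]
  simp [basisVec]

theorem hasFDerivAt_norm_of_ne {N : ℕ} {x : Space N} (hx : x ≠ 0) :
    HasFDerivAt (fun y : Space N => ‖y‖) (‖x‖⁻¹ • innerSL ℝ x) x := by
  have h1 := (hasStrictFDerivAt_norm_sq x).hasFDerivAt
  have h2 := h1.sqrt (by simpa using hx)
  simp only [Real.sqrt_sq (norm_nonneg _)] at h2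
  refine h2.congr_fderiv ?_
  ext y
  simp
  have : ‖x‖ ≠ 0 := by simpa using hx
  field_simp

theorem innerSL_basisVec {N : ℕ} (x : Space N) (i : Fin N) : innerSL ℝ x (basisVec i) = x i := by
  simp [basisVec, innerSL_apply_apply, EuclideanSpace.inner_single_right]

/-- First derivatives of a radial function. -/
theorem pd_radial {N : ℕ} {g : Space N → ℝ} {f : ℝ → ℝ} {f₁ : ℝ → ℝ}
    (hgf : ∀ x, g x = f ‖x‖) (h1 : ∀ r, 0 < r → HasDerivAt f (f₁ r) r) (i : Fin N) {x : Space N}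
    (hx : x ≠ 0) : pd i g x = f₁ ‖x‖ * (x i * ‖x‖⁻¹) := by
  have hr : 0 < ‖x‖ := norm_pos_iff.2 hx
  have := ((h1 _ hr).comp_hasFDerivAt x (hasFDerivAt_norm_of_ne hx)).fderiv
  rw [pd, show g = f ∘ fun y => ‖y‖ from funext hgf, this]
  simp only [smul_apply, innerSL_basisVec, smul_eq_mul]
  ring

/-- Second derivatives of a radial function. -/
theorem pd_pd_radial {N : ℕ} {g : Space N → ℝ} {f f₁ f₂ : ℝ → ℝ}
    (hgf : ∀ x, g x = f ‖x‖) (h1 : ∀ r, 0 < r → HasDerivAt f (f₁ r) r)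
    (h2 : ∀ r, 0 < r → HasDerivAt f₁ (f₂ r) r) (i j : Fin N) {x : Space N}
    (hx : x ≠ 0) : pd j (pd i g) x = f₂ ‖x‖ * (x i * x j / ‖x‖ ^ 2) +
      f₁ ‖x‖ / ‖x‖ * ((if i = j then 1 else 0) - x i * x j / ‖x‖ ^ 2) := by
  have hr : 0 < ‖x‖ := norm_pos_iff.2 hx
  have e : pd i g =ᶠ[nhds x] fun y => f₁ ‖y‖ * (y i * ‖y‖⁻¹) := by
    filter_upwards [isOpen_ne.mem_nhds hx] with y hy
    exact pd_radial hgf h1 i hy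
  have hn := hasFDerivAt_norm_of_ne hx
  have hi : HasFDerivAt (fun y : Space N => y i) (EuclideanSpace.proj i : Space N →L[ℝ] ℝ) x :=
    (EuclideanSpace.proj i : Space N →L[ℝ] ℝ).hasFDerivAt
  have hinv := (hasDerivAt_inv hr.ne').comp_hasFDerivAt x hn
  have H := (((h2 _ hr).comp_hasFDerivAt x hn).mul (hi.mul hinv)).fderiv
  rw [pd, e.fderiv_eq]
  have H' : fderiv ℝ (fun y : Space N => f₁ ‖y‖ * (y i * ‖y‖⁻¹)) x = _ := H
  rw [H']
  have hb : (basisVec j : Space N) i = if i = j then 1 else 0 := by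
    by_cases h : i = j <;> simp [basisVec, h]
  have hb' : (EuclideanSpace.proj i : Space N →L[ℝ] ℝ) (basisVec j) = if i = j then 1 else 0 := hb
  simp only [add_apply, smul_apply, innerSL_basisVec,
    smul_eq_mul, hb', Function.comp_apply, Pi.mul_apply]
  field_simp
  ring

theorem sum_pd_pd_radial {N : ℕ} {g : Space N → ℝ} {f f₁ f₂ : ℝ → ℝ}
    (hgf : ∀ x, g x = f ‖x‖) (h1 : ∀ r, 0 < r → HasDerivAt f (f₁ r) r)
    (h2 : ∀ r, 0 < r → HasDerivAt f₁ (f₂ r) r) {x : Space N}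
    (hx : x ≠ 0) : ∑ i, pd i (pd i g) x = f₂ ‖x‖ + (N - 1) / ‖x‖ * f₁ ‖x‖ := by
  have hr : ‖x‖ ≠ 0 := norm_ne_zero_iff.2 hx
  simp only [pd_pd_radial hgf h1 h2 _ _ hx, if_true]
  rw [Finset.sum_add_distrib, ← Finset.mul_sum, ← Finset.mul_sum, Finset.sum_sub_distrib,
    ← Finset.sum_div]
  have : ∑ i, x i * x i = ‖x‖ ^ 2 := by
    rw [EuclideanSpace.norm_sq_eq]
    exact Finset.sum_congr rfl fun i _ => by rw [Real.norm_eq_abs, sq_abs, sq]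
  rw [this]
  simp
  field_simp

theorem abs_coord_le {N : ℕ} (x : Space N) (i : Fin N) : |x i| ≤ ‖x‖ :=
  PiLp.norm_apply_le x i

/-- A square integrable radial function with bounded radial derivative vanishes at infinity. -/
theorem tendsto_zero_of_radial {N : ℕ} (hN : 1 ≤ N) {g : Space N → ℝ} {f f₁ : ℝ → ℝ}
    (hg : MemLp g 2 volume) (hgf : ∀ x, g x = f ‖x‖) (hpos : ∀ r, 0 < r → 0 < f r)
    (h1 : ∀ r, 0 < r → HasDerivAt f (f₁ r) r) {M : ℝ} (hM : 0 < M)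
    (hb : ∀ r, 1 ≤ r → |f₁ r| ≤ M) : Filter.Tendsto f Filter.atTop (nhds 0) := by
  set e : Space N := basisVec ⟨0, hN⟩ with he
  have sq : Integrable (fun x => ‖g x‖ ^ 2) volume := hg.integrable_norm_pow (p := 2) (by norm_num)
  rw [Metric.tendsto_atTop']
  intro ε hε
  -- The value `1` keeps a ball centred at distance at least `2` in the region where the derivative
  -- bound holds; `ε / (2 M)` keeps `g` above `ε / 2` on the ball if it exceeds `ε` at the centre.
  set ρ : ℝ := min 1 (ε / (2 * M)) with hρ
  have ρ0 : 0 < ρ := lt_min one_pos (by positivity)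
  -- The `L²` mass in a ball of fixed radius escaping to infinity vanishes, whereas a large value at
  -- the centre would give it a fixed positive mass.
  have lim : Filter.Tendsto (fun r : ℝ => ∫ x, (Metric.ball (r • e) ρ).indicator
      (fun x => ‖g x‖ ^ 2) x) Filter.atTop (nhds (∫ _ : Space N, (0 : ℝ))) := by
    refine tendsto_integral_filter_of_dominated_convergence (fun x => ‖g x‖ ^ 2)
      (Filter.Eventually.of_forall fun r => sq.1.indicator measurableSet_ball)
      (Filter.Eventually.of_forall fun r => Filter.Eventually.of_forall fun x => ?_) sq
      (Filter.Eventually.of_forall fun x => ?_)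
    · rw [Real.norm_of_nonneg (indicator_nonneg (fun x _ => by positivity) x)]
      exact indicator_le_self' (fun x _ => by positivity) x
    · refine tendsto_const_nhds.congr' ?_
      filter_upwards [Filter.eventually_ge_atTop (‖x‖ + ρ)] with r hr
      rw [indicator_of_notMem]
      intro hx
      rw [Metric.mem_ball, dist_eq_norm, norm_sub_rev] at hx
      have h2 : ‖r • e‖ = r := by
        rw [norm_smul, he, norm_basisVec, mul_one, Real.norm_of_nonneg]
        linarith [norm_nonneg x]
      have := norm_sub_norm_le (r • e) x
      linarith
  set V := volume.real (Metric.ball (0 : Space N) ρ) with hV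
  have V0 : 0 < V := ENNReal.toReal_pos (Metric.measure_ball_pos volume _ ρ0).ne'
    measure_ball_lt_top.ne
  rw [integral_zero] at lim
  have ev := lim.eventually (gt_mem_nhds (by positivity : 0 < (ε / 2) ^ 2 * V))
  obtain ⟨R, hR⟩ := Filter.eventually_atTop.1 ev
  refine ⟨max R 2, fun r hr => ?_⟩
  have hrR : R ≤ r := (le_max_left _ _).trans hr.le
  have hr2 : 2 ≤ r := (le_max_right _ _).trans hr.le
  rw [Real.dist_0_eq_abs, abs_of_pos (hpos r (by linarith))]
  by_contra hcon
  push Not at hcon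
  have low : ∀ x ∈ Metric.ball (r • e) ρ, ε / 2 ≤ g x := by
    intro x hx
    rw [Metric.mem_ball, dist_eq_norm] at hx
    have h2 : ‖r • e‖ = r := by
      rw [norm_smul, he, norm_basisVec, mul_one, Real.norm_of_nonneg (by linarith)]
    have h3 : |‖x‖ - r| < ρ := by
      have := abs_norm_sub_norm_le x (r • e)
      rw [h2] at this
      linarith
    have h4 : 1 ≤ ‖x‖ := by
      have := (abs_lt.1 h3).1
      have : ρ ≤ 1 := min_le_left _ _
      linarith
    have h5 := (convex_Ici (1 : ℝ)).norm_image_sub_le_of_norm_hasDerivWithin_le (f := f)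
      (f' := f₁) (C := M) (fun y hy => (h1 y (by linarith [mem_Ici.1 hy])).hasDerivWithinAt)
      (fun y hy => hb y hy) (mem_Ici.2 (by linarith : (1 : ℝ) ≤ r)) (mem_Ici.2 h4)
    rw [Real.norm_eq_abs, Real.norm_eq_abs] at h5
    have h6 : M * |‖x‖ - r| ≤ ε / 2 := by
      have : ρ ≤ ε / (2 * M) := min_le_right _ _
      have h7 : |‖x‖ - r| ≤ ε / (2 * M) := by linarith
      calc M * |‖x‖ - r| ≤ M * (ε / (2 * M)) := by gcongr
        _ = ε / 2 := by field_simp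
    rw [hgf]
    have := (abs_le.1 (h5.trans h6)).1
    linarith
  have big : (ε / 2) ^ 2 * V ≤ ∫ x, (Metric.ball (r • e) ρ).indicator (fun x => ‖g x‖ ^ 2) x := by
    rw [integral_indicator measurableSet_ball]
    have hv : V = volume.real (Metric.ball (r • e) ρ) := by
      rw [hV, measureReal_def, measureReal_def, Measure.addHaar_ball_center volume (r • e) ρ]
    rw [hv]
    refine setIntegral_ge_of_const_le_real measurableSet_ball measure_ball_lt_top.ne
      (fun x hx => ?_) sq.integrableOn
    have := low x hx
    rw [Real.norm_eq_abs, sq_abs]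
    gcongr
  linarith [hR r hrR]

/-- Along a ray the profile solves the radial equation with `d = N - 1`, which settles the exterior
of a ball. In the ball, compactness and positivity of `η` suffice. Bounding the derivatives by `η`,
and not only by an exponential, is what later tames negative powers of `η`. -/
theorem IsSolitonProfile.exists_bounds {N : ℕ} (hN : 1 ≤ N) {s : ℝ} (hs : 0 < s)
    {η : Space N → ℝ} (hη : IsSolitonProfile s η) :
    ∃ K : ℝ, 0 ≤ K ∧ (∀ x, η x ≤ K * Real.exp (-(1 / 2) * ‖x‖)) ∧
      (∀ i x, |pd i η x| ≤ K * η x) ∧ ∀ i j x, |pd j (pd i η) x| ≤ K * η x := by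
  set i₀ : Fin N := ⟨0, hN⟩ with hi₀
  set e : Space N := basisVec i₀ with he
  have ne : ∀ r : ℝ, 0 ≤ r → ‖r • e‖ = r := fun r hr => by
    rw [norm_smul, he, norm_basisVec, mul_one, Real.norm_of_nonneg hr]
  have C1 : ContDiff ℝ 1 (pd i₀ η) := contDiff_pd hη.contDiff
  have hgf : ∀ x, η x = (fun r : ℝ => η (r • e)) ‖x‖ := fun x =>
    hη.radial _ _ (ne _ (norm_nonneg x)).symm
  have hl : ∀ r : ℝ, HasDerivAt (fun r : ℝ => r • e) e r := fun r => by
    simpa using (hasDerivAt_id r).smul_const e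
  have h1 : ∀ r, 0 < r → HasDerivAt (fun r : ℝ => η (r • e)) (pd i₀ η (r • e)) r := fun r _ =>
    (hη.contDiff.differentiable (by simp) (r • e)).hasFDerivAt.comp_hasDerivAt r (hl r)
  have h2 : ∀ r, 0 < r → HasDerivAt (fun r : ℝ => pd i₀ η (r • e))
      (pd i₀ (pd i₀ η) (r • e)) r := fun r _ =>
    HasFDerivAt.comp_hasDerivAt (l := pd i₀ η) r
      (C1.differentiable (by simp) (r • e)).hasFDerivAt (hl r)
  have sol : IsRadialSolution (N - 1) s (fun r : ℝ => η (r • e)) (fun r => pd i₀ η (r • e))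
      (fun r => pd i₀ (pd i₀ η) (r • e)) := by
    refine ⟨fun r _ => hη.pos _, h1, h2, fun r hr => ?_⟩
    have hne : r • e ≠ 0 := by
      rw [← norm_ne_zero_iff, ne r hr.le]; exact hr.ne'
    have h3 := sum_pd_pd_radial hgf h1 h2 hne
    have h4 := hη.equation (r • e)
    rw [laplacian_eq_sum_pd hη.contDiff, h3, ne r hr.le] at h4
    rw [Nat.cast_sub hN, Nat.cast_one]
    linarith
  obtain ⟨M, hM, hb⟩ := sol.exists_abs_deriv_le hs
  have lim := tendsto_zero_of_radial hN hη.memL2 hgf sol.pos h1 hM hb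
  obtain ⟨R, K, hR, hK, hdec⟩ := sol.exists_decay hs lim
  have ratio : ∀ x : Space N, x ≠ 0 → ∀ i, |x i * ‖x‖⁻¹| ≤ 1 := fun x hx i => by
    rw [abs_mul, abs_of_nonneg (inv_nonneg.2 (norm_nonneg x)), ← div_eq_mul_inv]
    exact div_le_one_of_le₀ (abs_coord_le x i) (norm_nonneg x)
  -- The constant `3 K` comes from the Hessian of a radial function: `f₂` with a factor at most `1`,
  -- and `f₁ / |x|` with a factor at most `2`, where `|x| ≥ 1`.
  have out : ∀ x, R ≤ ‖x‖ → η x ≤ K * Real.exp (-(1 / 2) * ‖x‖) ∧ (∀ i, |pd i η x| ≤ K * η x) ∧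
      ∀ i j, |pd j (pd i η) x| ≤ 3 * K * η x := by
    intro x hx
    obtain ⟨d0, d1, d2⟩ := hdec _ hx
    have hgx : η (‖x‖ • e) = η x := (hgf x).symm
    rw [hgx] at d0 d1 d2
    have hn : 1 ≤ ‖x‖ := hR.trans hx
    have hx0 : x ≠ 0 := by
      rw [← norm_pos_iff]; linarith
    refine ⟨d0, fun i => ?_, fun i j => ?_⟩
    · rw [pd_radial hgf h1 i hx0, abs_mul]
      have := hη.pos x
      calc _ ≤ K * η x * 1 := by gcongr; exact ratio x hx0 i
        _ = _ := mul_one _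
    · rw [pd_pd_radial hgf h1 h2 i j hx0]
      have q : |x i * x j / ‖x‖ ^ 2| ≤ 1 := by
        have : x i * x j / ‖x‖ ^ 2 = (x i * ‖x‖⁻¹) * (x j * ‖x‖⁻¹) := by
          field_simp
        rw [this, abs_mul]
        exact mul_le_one₀ (ratio x hx0 i) (abs_nonneg _) (ratio x hx0 j)
      have q1 : |(if i = j then 1 else 0) - x i * x j / ‖x‖ ^ 2| ≤ 2 := by
        have q3 : |(if i = j then (1 : ℝ) else 0)| ≤ 1 := by split_ifs <;> simp
        rw [abs_le] at *
        constructor <;> linarith [q.1, q.2, q3.1, q3.2]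
      have q2 : |pd i₀ η (‖x‖ • e) / ‖x‖| ≤ K * η x := by
        rw [abs_div, abs_of_pos (by linarith : 0 < ‖x‖)]
        exact (div_le_self (abs_nonneg _) hn).trans d1
      have := hη.pos x
      calc _ ≤ |pd i₀ (pd i₀ η) (‖x‖ • e) * (x i * x j / ‖x‖ ^ 2)| + _ := abs_add_le _ _
        _ ≤ K * η x * 1 + K * η x * 2 := by
          rw [abs_mul, abs_mul]
          gcongr
        _ = _ := by ring
  have kc : IsCompact (Metric.closedBall (0 : Space N) R) := isCompact_closedBall _ _
  have cη := hη.contDiff.continuous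
  have bdd : ∀ g : Space N → ℝ, Continuous g → ∃ B, 0 ≤ B ∧ ∀ x, ‖x‖ ≤ R → |g x| ≤ B * η x := by
    intro g hg
    -- Continuity of the quotient on the compact ball turns boundedness of `g` into a bound by a
    -- multiple of `η`.
    have hq : Continuous (fun x => g x / η x) := hg.div₀ cη fun x => (hη.pos x).ne'
    obtain ⟨B, hB⟩ := kc.exists_bound_of_continuousOn hq.continuousOn
    refine ⟨B, (norm_nonneg _).trans (hB 0 (by simp; linarith)), fun x hx => ?_⟩
    have := hB x (by simpa using hx)
    rwa [norm_div, Real.norm_eq_abs, Real.norm_of_nonneg (hη.pos x).le, div_le_iff₀ (hη.pos x)]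
      at this
  obtain ⟨B0, hB0, hB0'⟩ := bdd (fun _ => 1) continuous_const
  obtain ⟨B3, hB3⟩ := kc.exists_bound_of_continuousOn cη.continuousOn
  choose B1 hB1 hB1' using fun i => bdd (pd i η)
    (contDiff_pd (n := 1) hη.contDiff).continuous
  choose B2 hB2 hB2' using fun i j => bdd (pd j (pd i η))
    (contDiff_pd (n := 0) (contDiff_pd (n := 1) hη.contDiff)).continuous
  have B3' : 0 ≤ B3 := (norm_nonneg _).trans (hB3 0 (by simp; linarith))
  set K' := 3 * K + B3 * Real.exp (1 / 2 * R) + ∑ i, B1 i + ∑ i, ∑ j, B2 i j with hK'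
  have s1 : 0 ≤ ∑ i, B1 i := Finset.sum_nonneg fun i _ => hB1 i
  have s2 : 0 ≤ ∑ i, ∑ j, B2 i j :=
    Finset.sum_nonneg fun i _ => Finset.sum_nonneg fun j _ => hB2 i j
  have s3 : 0 ≤ B3 * Real.exp (1 / 2 * R) := by positivity
  refine ⟨K', by positivity, fun x => ?_, fun i x => ?_, fun i j x => ?_⟩
  · rcases le_total R ‖x‖ with h | h
    · refine (out x h).1.trans ?_
      gcongr
      linarith
    · have h3 := hB3 x (by simpa using h)
      calc η x ≤ B3 * 1 := by rw [mul_one]; exact (le_abs_self _).trans h3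
        _ ≤ B3 * (Real.exp (1 / 2 * R) * Real.exp (-(1 / 2) * ‖x‖)) := by
          gcongr
          rw [← Real.exp_add]
          exact Real.one_le_exp (by linarith)
        _ = B3 * Real.exp (1 / 2 * R) * Real.exp (-(1 / 2) * ‖x‖) := by ring
        _ ≤ _ := by gcongr; linarith
  · have := hη.pos x
    rcases le_total R ‖x‖ with h | h
    · refine ((out x h).2.1 i).trans ?_
      gcongr
      linarith
    · refine (hB1' i x h).trans ?_
      gcongr
      have := Finset.single_le_sum (f := B1) (fun i _ => hB1 i) (Finset.mem_univ i)
      linarith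
  · have := hη.pos x
    rcases le_total R ‖x‖ with h | h
    · refine ((out x h).2.2 i j).trans ?_
      gcongr
      linarith
    · refine (hB2' i j x h).trans ?_
      gcongr
      have h4 := Finset.single_le_sum (f := fun j => B2 i j) (fun j _ => hB2 i j)
        (Finset.mem_univ j)
      have h5 := Finset.single_le_sum (f := fun i => ∑ j, B2 i j)
        (fun i _ => Finset.sum_nonneg fun j _ => hB2 i j) (Finset.mem_univ i)
      linarith

end

noncomputable section

/-! ### Rapidly decaying functions -/

/-- Decay faster than any power. -/
def Rapid {N : ℕ} (g : Space N → ℝ) : Prop :=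
  ∀ k : ℕ, ∃ C, 0 ≤ C ∧ ∀ x, (1 + ‖x‖) ^ k * |g x| ≤ C

theorem Rapid.of_abs_le {N : ℕ} {g h : Space N → ℝ} (hg : Rapid g) (K : ℝ)
    (hle : ∀ x, |h x| ≤ K * |g x|) : Rapid h := by
  intro k
  obtain ⟨C, hC0, hC⟩ := hg k
  refine ⟨|K| * C, by positivity, fun x => ?_⟩
  calc (1 + ‖x‖) ^ k * |h x| ≤ (1 + ‖x‖) ^ k * (|K| * |g x|) := by
        gcongr
        exact (hle x).trans (by gcongr; exact le_abs_self K)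
    _ = |K| * ((1 + ‖x‖) ^ k * |g x|) := by ring
    _ ≤ _ := by gcongr; exact hC x

theorem Rapid.add {N : ℕ} {g h : Space N → ℝ} (hg : Rapid g) (hh : Rapid h) :
    Rapid (fun x => g x + h x) := by
  intro k
  obtain ⟨C, hC0, hC⟩ := hg k
  obtain ⟨D, hD0, hD⟩ := hh k
  refine ⟨C + D, by positivity, fun x => ?_⟩
  calc (1 + ‖x‖) ^ k * |g x + h x| ≤ (1 + ‖x‖) ^ k * (|g x| + |h x|) := by
        gcongr; exact abs_add_le _ _
    _ ≤ _ := by rw [mul_add]; exact add_le_add (hC x) (hD x)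

theorem Rapid.bdd_mul {N : ℕ} {b g : Space N → ℝ} (hg : Rapid g) {B : ℝ} (hb : ∀ x, |b x| ≤ B) :
    Rapid (fun x => b x * g x) :=
  hg.of_abs_le B fun x => by rw [abs_mul]; gcongr; exact hb x

theorem Rapid.const_mul {N : ℕ} {g : Space N → ℝ} (c : ℝ) (hg : Rapid g) :
    Rapid (fun x => c * g x) := hg.bdd_mul (B := |c|) fun _ => le_rfl

theorem Rapid.coord_mul {N : ℕ} {g : Space N → ℝ} (j : Fin N) (hg : Rapid g) :
    Rapid (fun x => x j * g x) := by
  intro k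
  obtain ⟨C, hC0, hC⟩ := hg (k + 1)
  refine ⟨C, hC0, fun x => le_trans ?_ (hC x)⟩
  rw [abs_mul, pow_succ, mul_assoc]
  gcongr
  linarith [abs_coord_le x j]

theorem rapid_zero {N : ℕ} : Rapid (fun _ : Space N => (0 : ℝ)) :=
  fun _ => ⟨0, le_rfl, fun x => by simp⟩

theorem Rapid.sum {N : ℕ} {ι : Type*} (S : Finset ι) {g : ι → Space N → ℝ}
    (hg : ∀ i ∈ S, Rapid (g i)) : Rapid (fun x => ∑ i ∈ S, g i x) := by
  classical
  induction S using Finset.induction_on with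
  | empty => simpa using rapid_zero
  | insert a S ha ih =>
    simp only [Finset.sum_insert ha]
    exact (hg a (Finset.mem_insert_self a S)).add
      (ih fun i hi => hg i (Finset.mem_insert_of_mem hi))

theorem Rapid.exists_bound {N : ℕ} {g : Space N → ℝ} (hg : Rapid g) :
    ∃ B, 0 ≤ B ∧ ∀ x, |g x| ≤ B := by
  obtain ⟨C, hC0, hC⟩ := hg 0
  exact ⟨C, hC0, fun x => by simpa using hC x⟩

/-- The inequality `t^k / k! ≤ e^t` at `t = (1 + |x|) / 2` produces the constant. -/
theorem rapid_exp {N : ℕ} : Rapid (fun x : Space N => Real.exp (-(1 / 2) * ‖x‖)) := by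
  intro k
  refine ⟨(k.factorial : ℝ) * 2 ^ k * Real.exp (1 / 2), by positivity, fun x => ?_⟩
  have h := Real.pow_div_factorial_le_exp ((1 + ‖x‖) / 2) (by positivity) k
  rw [div_pow, div_div, div_le_iff₀ (by positivity)] at h
  rw [abs_of_pos (Real.exp_pos _)]
  calc (1 + ‖x‖) ^ k * Real.exp (-(1 / 2) * ‖x‖)
      ≤ Real.exp ((1 + ‖x‖) / 2) * (2 ^ k * k.factorial) * Real.exp (-(1 / 2) * ‖x‖) := by gcongr
    _ = (k.factorial : ℝ) * 2 ^ k *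
        (Real.exp ((1 + ‖x‖) / 2) * Real.exp (-(1 / 2) * ‖x‖)) := by ring
    _ = _ := by rw [← Real.exp_add]; congr 2; ring

theorem Rapid.exists_le_rpow {N : ℕ} {g : Space N → ℝ} (hg : Rapid g) (k : ℕ) :
    ∃ C, 0 ≤ C ∧ ∀ x, |g x| ≤ C * (1 + ‖x‖) ^ (-(k : ℝ)) := by
  obtain ⟨C, hC0, hC⟩ := hg k
  refine ⟨C, hC0, fun x => ?_⟩
  have hx : 0 < (1 + ‖x‖) ^ k := by positivity
  rw [Real.rpow_neg (by positivity), Real.rpow_natCast, ← div_eq_mul_inv, le_div_iff₀ hx, mul_comm]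
  exact hC x

theorem Rapid.integrable {N : ℕ} {g : Space N → ℝ} (hg : Rapid g) (hc : Continuous g) :
    Integrable g := by
  obtain ⟨C, hC0, hC⟩ := hg.exists_le_rpow (N + 1)
  have := (integrable_one_add_norm (E := Space N) (μ := volume) (r := ((N + 1 : ℕ) : ℝ))
    (by rw [finrank_euclideanSpace, Fintype.card_fin]; push_cast; linarith)).const_mul C
  exact this.mono' hc.aestronglyMeasurable (Filter.Eventually.of_forall hC)

theorem Rapid.mul {N : ℕ} {g h : Space N → ℝ} (hg : Rapid g) (hh : Rapid h) :
    Rapid (fun x => g x * h x) := by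
  obtain ⟨B, _, hB⟩ := hg.exists_bound
  exact hh.bdd_mul hB

theorem Rapid.memLp {N : ℕ} {g : Space N → ℝ} (hg : Rapid g) (hc : Continuous g) :
    MemLp g 2 volume := by
  rw [memLp_two_iff_integrable_sq hc.aestronglyMeasurable]
  simpa only [sq] using (hg.mul hg).integrable (hc.mul hc)

/-- `C¹` functions that decay rapidly together with their first derivatives. -/
structure Nice {N : ℕ} (g : Space N → ℝ) : Prop where
  contDiff : ContDiff ℝ 1 g
  rapid : Rapid g
  rapid_pd : ∀ i, Rapid (pd i g)

theorem Nice.continuous {N : ℕ} {g : Space N → ℝ} (hg : Nice g) : Continuous g :=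
  hg.contDiff.continuous

theorem Nice.continuous_pd {N : ℕ} {g : Space N → ℝ} (hg : Nice g) (i : Fin N) :
    Continuous (pd i g) := (contDiff_pd (n := 0) hg.contDiff).continuous

theorem Nice.memLp {N : ℕ} {g : Space N → ℝ} (hg : Nice g) : MemLp g 2 volume :=
  hg.rapid.memLp hg.continuous

theorem Nice.memLp_pd {N : ℕ} {g : Space N → ℝ} (hg : Nice g) (i : Fin N) :
    MemLp (pd i g) 2 volume := (hg.rapid_pd i).memLp (hg.continuous_pd i)

theorem pd_add {N : ℕ} {g h : Space N → ℝ} (hg : ContDiff ℝ 1 g) (hh : ContDiff ℝ 1 h)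
    (i : Fin N) : pd i (fun x => g x + h x) = fun x => pd i g x + pd i h x := by
  funext x
  have := ((hg.differentiable (by simp) x).hasFDerivAt.add
    (hh.differentiable (by simp) x).hasFDerivAt).fderiv
  rw [pd, show (fun x => g x + h x) = g + h from rfl, this]
  rfl

theorem pd_mul {N : ℕ} {g h : Space N → ℝ} (hg : ContDiff ℝ 1 g) (hh : ContDiff ℝ 1 h)
    (i : Fin N) : pd i (fun x => g x * h x) = fun x => pd i g x * h x + g x * pd i h x := by
  funext x
  have := ((hg.differentiable (by simp) x).hasFDerivAt.mul
    (hh.differentiable (by simp) x).hasFDerivAt).fderiv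
  rw [pd, show (fun x => g x * h x) = g * h from rfl, this]
  simp [pd]
  ring

theorem pd_const {N : ℕ} (c : ℝ) (i : Fin N) : pd i (fun _ : Space N => c) = fun _ => 0 := by
  funext x; simp [pd]

theorem pd_const_mul {N : ℕ} {g : Space N → ℝ} (hg : ContDiff ℝ 1 g) (c : ℝ) (i : Fin N) :
    pd i (fun x => c * g x) = fun x => c * pd i g x := by
  rw [pd_mul contDiff_const hg, pd_const]; simp

theorem contDiff_coord {N : ℕ} (j : Fin N) : ContDiff ℝ 1 (fun x : Space N => x j) :=
  (EuclideanSpace.proj j : Space N →L[ℝ] ℝ).contDiff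

theorem pd_coord {N : ℕ} (i j : Fin N) :
    pd i (fun x : Space N => x j) = fun _ => if i = j then 1 else 0 := by
  funext x
  have := (EuclideanSpace.proj j : Space N →L[ℝ] ℝ).hasFDerivAt (x := x)
  rw [pd, show (fun x : Space N => x j) = (EuclideanSpace.proj j : Space N →L[ℝ] ℝ) from rfl,
    this.fderiv]
  by_cases h : i = j
  · subst h; simp [basisVec]
  · simp [basisVec, h, Ne.symm h]

theorem pd_coord_mul {N : ℕ} {g : Space N → ℝ} (hg : ContDiff ℝ 1 g) (i j : Fin N) :
    pd i (fun x => x j * g x) = fun x => (if i = j then g x else 0) + x j * pd i g x := by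
  rw [pd_mul (contDiff_coord j) hg, pd_coord]
  funext x
  split_ifs <;> simp

theorem Nice.add {N : ℕ} {g h : Space N → ℝ} (hg : Nice g) (hh : Nice h) :
    Nice (fun x => g x + h x) :=
  ⟨hg.1.add hh.1, hg.2.add hh.2, fun i => by
    rw [pd_add hg.1 hh.1]; exact (hg.3 i).add (hh.3 i)⟩

theorem Nice.const_mul {N : ℕ} {g : Space N → ℝ} (c : ℝ) (hg : Nice g) :
    Nice (fun x => c * g x) :=
  ⟨contDiff_const.mul hg.1, hg.2.const_mul c, fun i => by
    rw [pd_const_mul hg.1]; exact (hg.3 i).const_mul c⟩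

theorem Nice.coord_mul {N : ℕ} {g : Space N → ℝ} (j : Fin N) (hg : Nice g) :
    Nice (fun x => x j * g x) :=
  ⟨(contDiff_coord j).mul hg.1, hg.2.coord_mul j, fun i => by
    rw [pd_coord_mul hg.1]
    refine Rapid.add ?_ ((hg.3 i).coord_mul j)
    split_ifs
    exacts [hg.2, rapid_zero]⟩

theorem nice_zero {N : ℕ} : Nice (fun _ : Space N => (0 : ℝ)) :=
  ⟨contDiff_const, rapid_zero, fun i => by rw [pd_const]; exact rapid_zero⟩

theorem Nice.sum {N : ℕ} {ι : Type*} (S : Finset ι) {g : ι → Space N → ℝ}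
    (hg : ∀ i ∈ S, Nice (g i)) : Nice (fun x => ∑ i ∈ S, g i x) := by
  classical
  induction S using Finset.induction_on with
  | empty => simpa using nice_zero
  | insert a S ha ih =>
    simp only [Finset.sum_insert ha]
    exact (hg a (Finset.mem_insert_self a S)).add
      (ih fun i hi => hg i (Finset.mem_insert_of_mem hi))

theorem pd_sum {N : ℕ} {ι : Type*} (S : Finset ι) {g : ι → Space N → ℝ}
    (hg : ∀ i ∈ S, ContDiff ℝ 1 (g i)) (j : Fin N) :
    pd j (fun x => ∑ i ∈ S, g i x) = fun x => ∑ i ∈ S, pd j (g i) x := by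
  funext x
  have := (HasFDerivAt.fun_sum (u := S) fun i hi =>
    ((hg i hi).differentiable (by simp) x).hasFDerivAt).fderiv
  rw [pd, this]
  simp [pd, sum_apply]

/-- Integration by parts for rapidly decaying functions. -/
theorem integral_pd_mul {N : ℕ} {g h : Space N → ℝ} (hg : Nice g) (hh : Nice h) (i : Fin N) :
    ∫ x, pd i g x * h x = - ∫ x, g x * pd i h x := by
  have := integral_mul_fderiv_eq_neg_fderiv_mul_of_integrable (μ := (volume : Measure (Space N)))
    (f := g) (g := h) (v := basisVec i)
    (((hg.rapid_pd i).mul hh.rapid).integrable ((hg.continuous_pd i).mul hh.continuous))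
    ((hg.rapid.mul (hh.rapid_pd i)).integrable (hg.continuous.mul (hh.continuous_pd i)))
    ((hg.rapid.mul hh.rapid).integrable (hg.continuous.mul hh.continuous))
    (fun x _ => hg.contDiff.differentiable (by simp) x)
    (fun x _ => hh.contDiff.differentiable (by simp) x)
  simp only [pd]
  rw [this, neg_neg]

/-! ### Pairing with real functions -/

/-- The bilinear pairing of a complex function with a real one. -/
def pair {N : ℕ} (w : Space N → ℂ) (g : Space N → ℝ) : ℂ := ∫ x, w x * (g x : ℂ)

theorem memLp_toC {N : ℕ} {g : Space N → ℝ} (hg : MemLp g 2 volume) :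
    MemLp (fun x => (g x : ℂ)) 2 volume := hg.ofReal

theorem integrable_pair {N : ℕ} {w : Space N → ℂ} {g : Space N → ℝ} (hw : MemLp w 2 volume)
    (hg : MemLp g 2 volume) : Integrable (fun x => w x * (g x : ℂ)) :=
  integrable_mul_of_memLp hw (memLp_toC hg)

theorem pair_add {N : ℕ} {w : Space N → ℂ} {g h : Space N → ℝ} (hw : MemLp w 2 volume)
    (hg : MemLp g 2 volume) (hh : MemLp h 2 volume) :
    pair w (fun x => g x + h x) = pair w g + pair w h := by
  rw [pair, pair, pair, ← integral_add (integrable_pair hw hg) (integrable_pair hw hh)]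
  simp [mul_add]

theorem pair_const_mul {N : ℕ} (w : Space N → ℂ) (g : Space N → ℝ) (c : ℝ) :
    pair w (fun x => c * g x) = c * pair w g := by
  rw [pair, pair, ← integral_const_mul]
  congr 1; funext x; push_cast; ring

theorem pair_sum {N : ℕ} {ι : Type*} (S : Finset ι) {w : Space N → ℂ} {g : ι → Space N → ℝ}
    (hw : MemLp w 2 volume) (hg : ∀ i ∈ S, MemLp (g i) 2 volume) :
    pair w (fun x => ∑ i ∈ S, g i x) = ∑ i ∈ S, pair w (g i) := by
  simp only [pair]
  rw [← integral_finsetSum _ fun i hi => integrable_pair hw (hg i hi)]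
  congr 1; funext x; push_cast; rw [Finset.mul_sum]

theorem partialDeriv_ofReal {N : ℕ} {g : Space N → ℝ} (hg : ContDiff ℝ 1 g) (i : Fin N)
    (x : Space N) : partialDeriv i (fun x => (g x : ℂ)) x = (pd i g x : ℂ) := by
  have := (Complex.ofRealCLM.hasFDerivAt.comp x
    ((hg.differentiable (by simp)) x).hasFDerivAt).fderiv
  rw [partialDeriv, show (fun x => (g x : ℂ)) = Complex.ofRealCLM ∘ g from rfl, this]; rfl

theorem memLp_partialDeriv_of_hasCompactSupport {N : ℕ} {w : Space N → ℂ} (hw : ContDiff ℝ ∞ w)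
    (hc : HasCompactSupport w) (i : Fin N) :
    MemLp (partialDeriv i w) 2 volume := by
  refine Continuous.memLp_of_hasCompactSupport ?_ (hc.fderiv_apply ℝ _)
  unfold partialDeriv
  exact (hw.continuous_fderiv (by simp)).clm_apply continuous_const

/-- The profile `g` has no compact support, so it is not a test function; instead `w` is
approximated in `H¹` by test functions. -/
theorem pair_weakPartial {N : ℕ} {w : Space N → ℂ} (hw : MemH1 w) {g : Space N → ℝ} (hg : Nice g)
    (i : Fin N) : pair (weakPartial i w) g = - pair w (pd i g) := by
  obtain ⟨v, vs, vc, -, v0, v1⟩ := hw.exists_approx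
  have vm : ∀ n, MemLp (v n) 2 volume := fun n =>
    (vs n).continuous.memLp_of_hasCompactSupport (vc n)
  have l1 := tendsto_integral_mul_of_l2
    (fun n => memLp_partialDeriv_of_hasCompactSupport (vs n) (vc n) i)
    (hw.memLp_weakPartial i) (memLp_toC hg.memLp) (v1 i)
  have l2 := (tendsto_integral_mul_of_l2 vm hw.1 (memLp_toC (hg.memLp_pd i)) v0).neg
  refine tendsto_nhds_unique l1 (l2.congr fun n => ?_)
  have := integral_mul_partialDeriv_of_hasCompactSupport (i := i) ((vs n).of_le (by simp)) (vc n)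
    (Complex.ofRealCLM.contDiff.comp hg.contDiff)
  simp only [Function.comp_def, Complex.ofRealCLM_apply, partialDeriv_ofReal hg.contDiff] at this
  simp only [mul_comm (v n _), mul_comm (partialDeriv i (v n) _)]
  exact this.symm

theorem partialDeriv_comm {N : ℕ} {v : Space N → ℂ} (hv : ContDiff ℝ 2 v) (i j : Fin N)
    (x : Space N) : partialDeriv i (partialDeriv j v) x = partialDeriv j (partialDeriv i v) x := by
  have hd : HasFDerivAt (fderiv ℝ v) (fderiv ℝ (fderiv ℝ v) x) x :=
    ((hv.fderiv_right (m := 1) le_rfl).differentiable (by simp) x).hasFDerivAt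
  have e : ∀ k l : Fin N, partialDeriv k (partialDeriv l v) x =
      fderiv ℝ (fderiv ℝ v) x (basisVec k) (basisVec l) := fun k l => by
    have := (hd.clm_apply (hasFDerivAt_const (basisVec l) x)).fderiv
    rw [partialDeriv, show fderiv ℝ (partialDeriv l v) x = _ from this]
    simp
  rw [e, e]
  exact (hv.contDiffAt.isSymmSndFDerivAt (by simp)).eq _ _

theorem pd_comm {N : ℕ} {v : Space N → ℝ} (hv : ContDiff ℝ 2 v) (i j : Fin N)
    (x : Space N) : pd i (pd j v) x = pd j (pd i v) x := by
  have hd : HasFDerivAt (fderiv ℝ v) (fderiv ℝ (fderiv ℝ v) x) x :=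
    ((hv.fderiv_right (m := 1) le_rfl).differentiable (by simp) x).hasFDerivAt
  have e : ∀ k l : Fin N, pd k (pd l v) x =
      fderiv ℝ (fderiv ℝ v) x (basisVec k) (basisVec l) := fun k l => by
    have := (hd.clm_apply (hasFDerivAt_const (basisVec l) x)).fderiv
    rw [pd, show fderiv ℝ (pd l v) x = _ from this]
    simp
  rw [e, e]
  exact (hv.contDiffAt.isSymmSndFDerivAt (by simp)).eq _ _

/-- Weak derivatives may be interchanged against a `C¹` function. -/
theorem pair_weakPartial_comm {N : ℕ} {w : Space N → ℂ} (hw : MemH1 w) {g : Space N → ℝ}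
    (hg : Nice g) (i j : Fin N) :
    pair (weakPartial i w) (pd j g) = pair (weakPartial j w) (pd i g) := by
  obtain ⟨v, vs, vc, -, v0, v1⟩ := hw.exists_approx
  have lim : ∀ k l : Fin N, Filter.Tendsto (fun n => ∫ x, partialDeriv k (v n) x * (pd l g x : ℂ))
      Filter.atTop (nhds (pair (weakPartial k w) (pd l g))) := fun k l =>
    tendsto_integral_mul_of_l2
      (fun n => memLp_partialDeriv_of_hasCompactSupport (vs n) (vc n) k)
      (hw.memLp_weakPartial k) (memLp_toC (hg.memLp_pd l)) (v1 k)
  have e : ∀ n (k l : Fin N), ∫ x, partialDeriv k (v n) x * (pd l g x : ℂ) =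
      - ∫ x, (g x : ℂ) * partialDeriv l (partialDeriv k (v n)) x := fun n k l => by
    have sd : ContDiff ℝ 1 (partialDeriv k (v n)) := by
      unfold partialDeriv
      exact ((vs n).fderiv_right (m := 1) (by norm_cast)).clm_apply contDiff_const
    have := integral_mul_partialDeriv_of_hasCompactSupport (i := l) (φ := partialDeriv k (v n)) sd
      ((vc n).fderiv_apply ℝ _) (Complex.ofRealCLM.contDiff.comp hg.contDiff)
    simp only [Function.comp_def, Complex.ofRealCLM_apply, partialDeriv_ofReal hg.contDiff] at this
    rw [this, neg_neg]
    simp only [mul_comm]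
  refine tendsto_nhds_unique (lim i j) ((lim j i).congr fun n => ?_)
  rw [e, e]
  congr 2
  funext x
  rw [partialDeriv_comm ((vs n).of_le (by norm_cast))]

end

noncomputable section

/-! ### The linearized equations in weak form -/

/-- The infinitesimal scaling `g / (2 s) + x · ∇ g / 2`. -/
def scaling {N : ℕ} (s : ℝ) (g : Space N → ℝ) (x : Space N) : ℝ :=
  1 / (2 * s) * g x + 1 / 2 * ∑ k : Fin N, x k * pd k g x

/-- The Dirichlet pairing `∑ᵢ ∫ ∂ᵢ w ∂ᵢ g`. -/
def gradPair {N : ℕ} (w : Space N → ℂ) (g : Space N → ℝ) : ℂ :=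
  ∑ i : Fin N, pair (weakPartial i w) (pd i g)

/-- The right-hand side `η - η ^ (2 s + 1)` of the soliton equation. -/
def source {N : ℕ} (s : ℝ) (η : Space N → ℝ) (x : Space N) : ℝ := η x - η x ^ (2 * s + 1)

namespace IsSolitonProfile

variable {N : ℕ} {s : ℝ} {η : Space N → ℝ}

theorem rapid (hN : 1 ≤ N) (hs : 0 < s) (hη : IsSolitonProfile s η) : Rapid η := by
  obtain ⟨K, hK, h, -⟩ := hη.exists_bounds hN hs
  exact rapid_exp.of_abs_le K fun x => by
    rw [abs_of_pos (hη.pos x), abs_of_pos (Real.exp_pos _)]; exact h x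

theorem nice (hN : 1 ≤ N) (hs : 0 < s) (hη : IsSolitonProfile s η) : Nice η := by
  obtain ⟨K, hK, -, h, -⟩ := hη.exists_bounds hN hs
  exact ⟨hη.contDiff.of_le (by norm_num), hη.rapid hN hs, fun i =>
    (hη.rapid hN hs).of_abs_le K fun x => by rw [abs_of_pos (hη.pos x)]; exact h i x⟩

theorem nice_pd (hN : 1 ≤ N) (hs : 0 < s) (hη : IsSolitonProfile s η) (i : Fin N) :
    Nice (pd i η) := by
  obtain ⟨K, hK, -, -, h⟩ := hη.exists_bounds hN hs
  exact ⟨contDiff_pd hη.contDiff, (hη.nice hN hs).rapid_pd i, fun j =>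
    (hη.rapid hN hs).of_abs_le K fun x => by rw [abs_of_pos (hη.pos x)]; exact h i j x⟩

theorem exists_rpow_bound (hN : 1 ≤ N) (hs : 0 < s) (hη : IsSolitonProfile s η) {p : ℝ}
    (hp : 0 ≤ p) : ∃ B, 0 ≤ B ∧ ∀ x, |η x ^ p| ≤ B := by
  obtain ⟨B, hB0, hB⟩ := (hη.rapid hN hs).exists_bound
  refine ⟨B ^ p, Real.rpow_nonneg hB0 _, fun x => ?_⟩
  rw [abs_of_nonneg (Real.rpow_nonneg (hη.pos x).le _)]
  exact Real.rpow_le_rpow (hη.pos x).le ((le_abs_self _).trans (hB x)) hp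

theorem continuous_rpow (hη : IsSolitonProfile s η) (p : ℝ) : Continuous (fun x => η x ^ p) :=
  hη.contDiff.continuous.rpow_const fun x => Or.inl (hη.pos x).ne'

theorem pd_source (hη : IsSolitonProfile s η) (i : Fin N) :
    pd i (source s η) = fun x => (1 - (2 * s + 1) * η x ^ (2 * s)) * pd i η x := by
  funext x
  have h1 := (hη.contDiff.differentiable (by simp) x).hasFDerivAt
  have h2 := h1.sub (h1.rpow_const (p := 2 * s + 1) (Or.inl (hη.pos x).ne'))
  rw [pd, show source s η = η - fun x => η x ^ (2 * s + 1) from rfl, h2.fderiv]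
  simp only [add_sub_cancel_right, sub_apply, smul_apply, smul_eq_mul, pd]
  ring

theorem nice_source (hN : 1 ≤ N) (hs : 0 < s) (hη : IsSolitonProfile s η) :
    Nice (source s η) := by
  have hn := hη.nice hN hs
  obtain ⟨B, hB0, hB⟩ := hη.exists_rpow_bound hN hs (p := 2 * s) (by positivity)
  refine ⟨?_, ?_, fun i => ?_⟩
  · exact hn.contDiff.sub (hn.contDiff.rpow_const_of_ne fun x => (hη.pos x).ne')
  · have : source s η = fun x => (1 - η x ^ (2 * s)) * η x := by
      funext x
      rw [source, Real.rpow_add (hη.pos x), Real.rpow_one]; ring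
    rw [this]
    refine hn.rapid.bdd_mul (B := 1 + B) fun x => ?_
    exact (abs_sub _ _).trans (by simpa using hB x)
  · rw [hη.pd_source]
    refine (hn.rapid_pd i).bdd_mul (B := 1 + (2 * s + 1) * B) fun x => ?_
    refine (abs_sub _ _).trans ?_
    rw [abs_one, abs_mul, abs_of_pos (by positivity : 0 < 2 * s + 1)]
    gcongr
    exact hB x

theorem sum_pd_pd (hη : IsSolitonProfile s η) (x : Space N) :
    ∑ i, pd i (pd i η) x = source s η x := by
  have := hη.equation x
  rw [laplacian_eq_sum_pd hη.contDiff] at this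
  rw [source]; linarith

theorem nice_scaling (hN : 1 ≤ N) (hs : 0 < s) (hη : IsSolitonProfile s η) :
    Nice (scaling s η) :=
  ((hη.nice hN hs).const_mul _).add
    ((Nice.sum _ fun k _ => (hη.nice_pd hN hs k).coord_mul k).const_mul _)

theorem pd_scaling (hN : 1 ≤ N) (hs : 0 < s) (hη : IsSolitonProfile s η) (i : Fin N) :
    pd i (scaling s η) = fun x => (1 / (2 * s) + 1 / 2) * pd i η x +
      1 / 2 * ∑ k, x k * pd i (pd k η) x := by
  have hn := hη.nice hN hs
  have hk := hη.nice_pd hN hs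
  have hs1 : ContDiff ℝ 1 fun x : Space N => ∑ k : Fin N, x k * pd k η x :=
    (Nice.sum _ fun k _ => (hk k).coord_mul k).contDiff
  have : scaling s η = fun x => 1 / (2 * s) * η x + 1 / 2 * ∑ k : Fin N, x k * pd k η x := rfl
  rw [this, pd_add (contDiff_const.mul hn.1) (contDiff_const.mul hs1), pd_const_mul hn.1,
    pd_const_mul hs1, pd_sum _ fun k _ => ((hk k).coord_mul k).contDiff]
  funext x
  simp only [pd_coord_mul (hk _).contDiff, Finset.sum_add_distrib, Finset.sum_ite_eq,
    Finset.mem_univ, if_true]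
  ring

theorem gradPair_of_nice {w : Space N → ℂ} (hw : MemH1 w) {g : Space N → ℝ}
    (hg : ∀ i, Nice (pd i g)) :
    gradPair w g = - pair w (fun x => ∑ i, pd i (pd i g) x) := by
  rw [gradPair, pair_sum _ hw.1 fun i _ => (hg i).memLp_pd i, ← Finset.sum_neg_distrib]
  exact Finset.sum_congr rfl fun i _ => pair_weakPartial hw (hg i) i

theorem gradPair_profile (hN : 1 ≤ N) (hs : 0 < s) (hη : IsSolitonProfile s η)
    {w : Space N → ℂ} (hw : MemH1 w) : gradPair w η = - pair w (source s η) := by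
  rw [gradPair_of_nice hw (hη.nice_pd hN hs)]
  simp only [hη.sum_pd_pd]

/-- Weak form of `L₋ (x_j η) = -2 ∂_j η`, due to the commutator of the Laplacian with `x_j`; it is
the infinitesimal Galilei invariance. -/
theorem gradPair_coord (hN : 1 ≤ N) (hs : 0 < s) (hη : IsSolitonProfile s η)
    {w : Space N → ℂ} (hw : MemH1 w) (j : Fin N) :
    gradPair w (fun x => x j * η x) =
      - pair w (fun x => x j * source s η x) - 2 * pair w (pd j η) := by
  have hn := hη.nice hN hs
  have hk := hη.nice_pd hN hs
  have e1 : ∀ i, pd i (fun x => x j * η x) = fun x => (if i = j then η x else 0) + x j * pd i η x :=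
    fun i => pd_coord_mul hn.1 i j
  have nif : ∀ i, Nice fun x => if i = j then η x else 0 := fun i => by
    split_ifs
    exacts [hn, nice_zero]
  have n1 : ∀ i, Nice (pd i fun x => x j * η x) := fun i => by
    rw [e1]
    exact (nif i).add ((hk i).coord_mul j)
  rw [gradPair_of_nice hw n1]
  have e2 : (fun x => ∑ i, pd i (pd i fun x => x j * η x) x) =
      fun x => x j * source s η x + 2 * pd j η x := by
    funext x
    have e3 : ∀ i, pd i (pd i fun x => x j * η x) x =
        2 * (if i = j then pd j η x else 0) + x j * pd i (pd i η) x := fun i => by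
      rw [e1, pd_add (nif i).contDiff ((hk i).coord_mul j).contDiff, pd_coord_mul (hk i).contDiff]
      by_cases h : i = j
      · subst h; simp only [if_true]; ring
      · simp [h, pd_const]
    simp only [e3, Finset.sum_add_distrib, ← Finset.mul_sum, hη.sum_pd_pd]
    simp
    ring
  rw [e2, pair_add hw.1 ((hη.nice_source hN hs).coord_mul j).memLp ((hk j).const_mul 2).memLp,
    pair_const_mul]
  push_cast
  ring

/-- Weak form of `L₊ ∂_j η = 0`. As `η` is only `C²`, the Laplacian cannot be applied to `∂_j η`;
the indices are exchanged through `pair_weakPartial_comm`, so that the profile equation is used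
before `∂_j` is moved back. -/
theorem gradPair_pd (hN : 1 ≤ N) (hs : 0 < s) (hη : IsSolitonProfile s η)
    {w : Space N → ℂ} (hw : MemH1 w) (j : Fin N) :
    gradPair w (pd j η) = - pair w (pd j (source s η)) := by
  have hk := hη.nice_pd hN hs
  have e : gradPair w (pd j η) = pair (weakPartial j w) (source s η) := by
    have : source s η = fun x => ∑ i, pd i (pd i η) x := funext fun x => (hη.sum_pd_pd x).symm
    rw [this, pair_sum _ (hw.memLp_weakPartial j) fun i _ => (hk i).memLp_pd i, gradPair]
    refine Finset.sum_congr rfl fun i _ => ?_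
    rw [← pair_weakPartial_comm hw (hk i)]
    congr 1
    funext x
    exact pd_comm hη.contDiff i j x
  rw [e, pair_weakPartial hw (hη.nice_source hN hs)]

/-- Weak form of `L₊ Λη = -η`: formally, differentiate `-Δη_μ + μ η_μ = η_μ^{2s+1}` at `μ = 1`.
Third derivatives of `η` are again avoided by exchanging indices, now with extra terms from the
coordinate weights. -/
theorem gradPair_scaling (hN : 1 ≤ N) (hs : 0 < s) (hη : IsSolitonProfile s η)
    {w : Space N → ℂ} (hw : MemH1 w) :
    gradPair w (scaling s η) =
      - pair w (fun x => (1 - (2 * s + 1) * η x ^ (2 * s)) * scaling s η x) - pair w η := by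
  have hn := hη.nice hN hs
  have hk := hη.nice_pd hN hs
  have hF := hη.nice_source hN hs
  set A := gradPair w η with hA
  -- second derivatives
  have key : ∀ k : Fin N, ∑ i, pair (weakPartial i w) (fun x => x k * pd i (pd k η) x) =
      - A + pair (weakPartial k w) (pd k η) + pair (weakPartial k w) (fun x => x k * source s η x) := by
    intro k
    have e1 : ∀ i, pair (weakPartial i w) (fun x => x k * pd i (pd k η) x) =
        - pair (weakPartial i w) (pd i η) + pair (weakPartial k w)
          (fun x => (if i = k then pd k η x else 0) + x k * pd i (pd i η) x) := fun i => by
      have n1 : Nice (fun x => x k * pd i η x) := (hk i).coord_mul k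
      have h1 := pair_weakPartial_comm hw n1 i k
      rw [pd_coord_mul (hk i).contDiff, pd_coord_mul (hk i).contDiff] at h1
      simp only [if_true] at h1
      rw [pair_add (hw.memLp_weakPartial i) (hk i).memLp
        ((((hk i).rapid_pd k).coord_mul k).memLp
          ((contDiff_coord k).continuous.mul ((hk i).continuous_pd k)))] at h1
      have h2 : (fun x => x k * pd i (pd k η) x) = fun x => x k * pd k (pd i η) x := by
        funext x; rw [pd_comm hη.contDiff]
      have h3 : (fun x => (if i = k then pd k η x else 0) + x k * pd i (pd i η) x) =
          fun x => (if i = k then pd i η x else 0) + x k * pd i (pd i η) x := by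
        funext x
        by_cases h : i = k
        · subst h; rfl
        · simp [h]
      rw [h2, h3, ← h1]
      ring
    simp only [e1, Finset.sum_add_distrib, Finset.sum_neg_distrib]
    rw [← pair_sum _ (hw.memLp_weakPartial k)]
    · have e2 : (fun x => ∑ i, ((if i = k then pd k η x else 0) + x k * pd i (pd i η) x)) =
          fun x => pd k η x + x k * source s η x := by
        funext x
        rw [Finset.sum_add_distrib, ← Finset.mul_sum, hη.sum_pd_pd]
        simp
      rw [e2, pair_add (hw.memLp_weakPartial k) (hk k).memLp (hF.coord_mul k).memLp, hA, gradPair]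
      ring
    · intro i _
      have nif : Nice fun x => if i = k then pd k η x else 0 := by
        split_ifs
        exacts [hk k, nice_zero]
      exact nif.memLp.add ((((hk i).rapid_pd i).coord_mul k).memLp
          ((contDiff_coord k).continuous.mul ((hk i).continuous_pd i)))
  have key2 : ∀ k : Fin N, pair (weakPartial k w) (fun x => x k * source s η x) =
      - pair w (source s η) - pair w (fun x => x k * pd k (source s η) x) := fun k => by
    rw [pair_weakPartial hw (hF.coord_mul k), pd_coord_mul hF.contDiff]
    simp only [if_true]
    rw [pair_add hw.1 hF.memLp (((hF.rapid_pd k).coord_mul k).memLp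
      ((contDiff_coord k).continuous.mul (hF.continuous_pd k)))]
    ring
  have hA2 : A = - pair w (source s η) := hη.gradPair_profile hN hs hw
  have mk : ∀ i k, MemLp (fun x => x k * pd i (pd k η) x) 2 volume := fun i k =>
    (((hk k).rapid_pd i).coord_mul k).memLp
      ((contDiff_coord k).continuous.mul ((hk k).continuous_pd i))
  have e0 : gradPair w (scaling s η) = (1 / (2 * s) + 1 / 2) * A +
      1 / 2 * ∑ k, ∑ i, pair (weakPartial i w) (fun x => x k * pd i (pd k η) x) := by
    have e1 : ∀ i, pair (weakPartial i w) (pd i (scaling s η)) =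
        (1 / (2 * s) + 1 / 2) * pair (weakPartial i w) (pd i η) +
        1 / 2 * ∑ k, pair (weakPartial i w) (fun x => x k * pd i (pd k η) x) := fun i => by
      have m2 : MemLp (fun x => ∑ k, x k * pd i (pd k η) x) 2 volume :=
        memLp_finsetSum _ fun k _ => mk i k
      rw [hη.pd_scaling hN hs, pair_add (hw.memLp_weakPartial i) ((hk i).const_mul _).memLp
        (m2.const_mul _), pair_const_mul, pair_const_mul,
        pair_sum _ (hw.memLp_weakPartial i) fun k _ => mk i k]
      push_cast
      ring
    rw [gradPair, Finset.sum_congr rfl fun i _ => e1 i, Finset.sum_add_distrib, ← Finset.mul_sum,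
      ← Finset.mul_sum, Finset.sum_comm, hA, gradPair]
  have e3 : ∑ k, ∑ i, pair (weakPartial i w) (fun x => x k * pd i (pd k η) x) =
      A - ∑ k : Fin N, pair w (fun x => x k * pd k (source s η) x) := by
    simp only [key, key2, ← hA2, Finset.sum_add_distrib, Finset.sum_sub_distrib]
    have : ∑ k, pair (weakPartial k w) (pd k η) = A := rfl
    rw [this]
    simp
    ring
  rw [e0, e3, ← pair_sum _ hw.1 fun k _ => ((hF.rapid_pd k).coord_mul k).memLp
    ((contDiff_coord k).continuous.mul (hF.continuous_pd k))]
  set S : Space N → ℝ := fun x => ∑ k : Fin N, x k * pd k (source s η) x with hS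
  have nS : MemLp S 2 volume := memLp_finsetSum _ fun k _ => ((hF.rapid_pd k).coord_mul k).memLp
    ((contDiff_coord k).continuous.mul (hF.continuous_pd k))
  -- The linearised potential acting on `Λη` is rewritten through the source and its radial
  -- derivative; the leftover `-η` is the inhomogeneity in `L₊ Λη = -η`.
  have e4 : (fun x => (1 - (2 * s + 1) * η x ^ (2 * s)) * scaling s η x) =
      fun x => (1 / (2 * s) + 1) * source s η x + ((-1) * η x + 1 / 2 * S x) := by
    funext x
    have h1 : S x = (1 - (2 * s + 1) * η x ^ (2 * s)) * ∑ k : Fin N, x k * pd k η x := by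
      rw [hS, Finset.mul_sum]
      refine Finset.sum_congr rfl fun k _ => ?_
      rw [hη.pd_source]; ring
    rw [h1, scaling, source, Real.rpow_add (hη.pos x), Real.rpow_one]
    field_simp
    ring
  have m5 : MemLp (fun x => (-1) * η x + 1 / 2 * S x) 2 volume :=
    (hn.const_mul _).memLp.add (nS.const_mul _)
  rw [e4, pair_add hw.1 (hF.const_mul _).memLp m5,
    pair_add hw.1 (hn.const_mul _).memLp (nS.const_mul _), pair_const_mul, pair_const_mul,
    pair_const_mul, hA2]
  push_cast
  ring

end IsSolitonProfile

end

noncomputable section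

/-! ### The symmetry group -/

theorem integral_comp_affine {N : ℕ} {E : Type*} [NormedAddCommGroup E] [NormedSpace ℝ E]
    (F : Space N → E) (r : ℝ) (a : Space N) :
    ∫ x, F (r • (x - a)) = |(r ^ N)⁻¹| • ∫ y, F y := by
  rw [integral_sub_right_eq_self (fun x => F (r • x)) a, Measure.integral_comp_smul,
    finrank_euclideanSpace, Fintype.card_fin]

/-- The factor by which `T_σ` scales the `L²` inner product. -/
def massFactor (N : ℕ) (s μ : ℝ) : ℝ := μ ^ (1 / s - (N : ℝ) / 2)

theorem massFactor_eq (N : ℕ) {s μ : ℝ} (hs : 0 < s) (hμ : 0 < μ) :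
    massFactor N s μ = |(Real.sqrt μ ^ N)⁻¹| * (μ ^ (1 / (2 * s))) ^ 2 := by
  have h1 : Real.sqrt μ ^ N = μ ^ ((N : ℝ) / 2) := by
    rw [Real.sqrt_eq_rpow, ← Real.rpow_natCast, ← Real.rpow_mul hμ.le]; congr 1; ring
  have h2 : (μ ^ (1 / (2 * s))) ^ 2 = μ ^ (1 / s) := by
    rw [← Real.rpow_natCast, ← Real.rpow_mul hμ.le]; congr 1; push_cast; field_simp
  rw [h1, h2, abs_of_nonneg (inv_nonneg.2 (Real.rpow_nonneg hμ.le _)), massFactor,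
    Real.rpow_sub hμ]
  field_simp

theorem massFactor_pos (N : ℕ) (s : ℝ) {μ : ℝ} (hμ : 0 < μ) : 0 < massFactor N s μ :=
  Real.rpow_pos_of_pos hμ _

/-- The phase factor of `T_σ`, in the moving frame. -/
def phase {N : ℕ} (σ : Param N) (y : Space N) : ℂ :=
  Complex.exp (Complex.I * (((1 / 2) * inner ℝ σ.v ((Real.sqrt σ.μ)⁻¹ • y) + σ.γ : ℝ) : ℂ))

theorem phase_mul_conj {N : ℕ} (σ : Param N) (y : Space N) : phase σ y * conj (phase σ y) = 1 := by
  rw [Complex.mul_conj, Complex.normSq_eq_norm_sq, phase, mul_comm Complex.I,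
    Complex.norm_exp_ofReal_mul_I]
  simp

theorem norm_phase {N : ℕ} (σ : Param N) (y : Space N) : ‖phase σ y‖ = 1 := by
  rw [phase, mul_comm Complex.I, Complex.norm_exp_ofReal_mul_I]

theorem trans_apply_eq {N : ℕ} (s : ℝ) {σ : Param N} (hμ : 0 < σ.μ) (u : Space N → ℂ)
    (x : Space N) :
    trans s σ u x = phase σ (Real.sqrt σ.μ • (x - σ.a)) * ((σ.μ ^ (1 / (2 * s)) : ℝ) : ℂ) *
      u (Real.sqrt σ.μ • (x - σ.a)) := by
  have h1 : Real.sqrt σ.μ ≠ 0 := (Real.sqrt_pos.2 hμ).ne'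
  rw [trans, phase, smul_smul, inv_mul_cancel₀ h1, one_smul]

theorem inv_smul_add_eq {N : ℕ} {σ : Param N} (hμ : 0 < σ.μ) (x : Space N) :
    (Real.sqrt σ.μ)⁻¹ • (Real.sqrt σ.μ • (x - σ.a)) + σ.a = x := by
  have h1 : Real.sqrt σ.μ ≠ 0 := (Real.sqrt_pos.2 hμ).ne'
  rw [smul_smul, inv_mul_cancel₀ h1, one_smul, sub_add_cancel]

/-- The phases cancel, and the Jacobian combines with the squared amplitude: `T_σ` is unitary up to
a constant depending only on `μ`. -/
theorem integral_trans_mul_conj {N : ℕ} {s : ℝ} (hs : 0 < s) {σ : Param N} (hμ : 0 < σ.μ)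
    (u v : Space N → ℂ) :
    ∫ x, trans s σ u x * conj (trans s σ v x) = massFactor N s σ.μ * ∫ y, u y * conj (v y) := by
  have h := integral_comp_affine
    (fun y => ((((σ.μ ^ (1 / (2 * s))) ^ 2 : ℝ)) : ℂ) * (u y * conj (v y))) (Real.sqrt σ.μ) σ.a
  rw [integral_const_mul _ (fun y => u y * conj (v y)), Complex.real_smul] at h
  rw [massFactor_eq N hs hμ, Complex.ofReal_mul, mul_assoc, ← h]
  congr 1
  funext x
  rw [trans_apply_eq s hμ, trans_apply_eq s hμ]
  simp only [map_mul, Complex.conj_ofReal]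
  have := phase_mul_conj σ (Real.sqrt σ.μ • (x - σ.a))
  push_cast
  linear_combination ((σ.μ ^ (1 / (2 * s)) : ℝ) : ℂ) ^ 2 * u (Real.sqrt σ.μ • (x - σ.a)) *
    conj (v (Real.sqrt σ.μ • (x - σ.a))) * this

theorem norm_trans {N : ℕ} (s : ℝ) {σ : Param N} (hμ : 0 < σ.μ) (u : Space N → ℂ) (x : Space N) :
    ‖trans s σ u x‖ = σ.μ ^ (1 / (2 * s)) * ‖u (Real.sqrt σ.μ • (x - σ.a))‖ := by
  rw [trans_apply_eq s hμ, norm_mul, norm_mul, norm_phase, one_mul, Complex.norm_real,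
    Real.norm_of_nonneg (Real.rpow_nonneg hμ.le _)]

theorem memLp_trans {N : ℕ} {s : ℝ} {σ : Param N} (hμ : 0 < σ.μ) {u : Space N → ℂ}
    (hu : MemLp u 2 volume) : MemLp (trans s σ u) 2 volume := by
  have hr : Real.sqrt σ.μ ≠ 0 := (Real.sqrt_pos.2 hμ).ne'
  have qmp : Measure.QuasiMeasurePreserving (fun x : Space N => Real.sqrt σ.μ • (x - σ.a))
      volume volume := by
    refine ⟨by fun_prop, ?_⟩
    have h1 : Measure.map (fun x : Space N => Real.sqrt σ.μ • (x - σ.a)) volume =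
        Measure.map (fun x : Space N => Real.sqrt σ.μ • x)
          (Measure.map (fun x : Space N => x - σ.a) volume) := by
      rw [Measure.map_map (by fun_prop) (by fun_prop)]; rfl
    rw [h1, (measurePreserving_sub_right volume σ.a).map_eq, Measure.map_addHaar_smul _ hr]
    exact Measure.smul_absolutelyContinuous
  have meas : AEStronglyMeasurable (trans s σ u) volume := by
    have hm := hu.1.comp_quasiMeasurePreserving qmp
    unfold trans
    refine AEStronglyMeasurable.mul (Continuous.aestronglyMeasurable ?_) hm
    fun_prop
  rw [memLp_two_iff_integrable_sq_norm meas]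
  have h1 : Integrable (fun x => ‖u x‖ ^ 2) := hu.integrable_norm_pow (p := 2) (by norm_num)
  have h2 := ((h1.comp_smul hr).comp_sub_right σ.a).const_mul ((σ.μ ^ (1 / (2 * s))) ^ 2)
  refine h2.congr (Filter.Eventually.of_forall fun x => ?_)
  simp only [norm_trans s hμ, mul_pow]

theorem contDiff_phase {N : ℕ} (σ : Param N) : ContDiff ℝ ∞ (phase σ) := by
  unfold phase
  have h1 : ContDiff ℝ ∞ (fun y : Space N => inner ℝ σ.v ((Real.sqrt σ.μ)⁻¹ • y)) :=
    contDiff_const.inner ℝ (contDiff_const_smul _)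
  have h2 : ContDiff ℝ ∞ (fun y : Space N =>
      (((1 / 2) * inner ℝ σ.v ((Real.sqrt σ.μ)⁻¹ • y) + σ.γ : ℝ) : ℂ)) :=
    Complex.ofRealCLM.contDiff.comp ((contDiff_const.mul h1).add contDiff_const)
  exact (contDiff_const.mul h2).cexp

theorem inner_basisVec {N : ℕ} (v : Space N) (i : Fin N) : inner ℝ v (basisVec i) = v i := by
  simp [basisVec, EuclideanSpace.inner_single_right]

theorem hasFDerivAt_phase {N : ℕ} (σ : Param N) (y : Space N) :
    HasFDerivAt (phase σ) (fderiv ℝ (phase σ) y) y ∧ ∀ i, fderiv ℝ (phase σ) y (basisVec i) =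
      phase σ y * (Complex.I * ((σ.v i / (2 * Real.sqrt σ.μ) : ℝ) : ℂ)) := by
  have hl : HasFDerivAt (fun y : Space N => (1 / 2) * inner ℝ σ.v ((Real.sqrt σ.μ)⁻¹ • y) + σ.γ)
      (((1 / 2) * (Real.sqrt σ.μ)⁻¹) • innerSL ℝ σ.v) y := by
    have h1 := (((innerSL ℝ σ.v).hasFDerivAt (x := y)).const_smul
      ((1 / 2) * (Real.sqrt σ.μ)⁻¹)).add_const σ.γ
    refine h1.congr_of_eventuallyEq (Filter.Eventually.of_forall fun z => ?_)
    simp [inner_smul_right, mul_assoc]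
  have h2 := ((Complex.ofRealCLM.hasFDerivAt.comp y hl).const_mul Complex.I).cexp
  have h3 : HasFDerivAt (phase σ) _ y := h2
  refine ⟨h3.differentiableAt.hasFDerivAt, fun i => ?_⟩
  rw [h3.fderiv]
  simp [phase, inner_basisVec]
  ring

/-- The test function is pulled back to the moving frame together with the phase. Differentiating
that phase produces the momentum shift `i v_i / 2`. -/
theorem isWeakPartial_trans {N : ℕ} {s : ℝ} {σ : Param N} (hμ : 0 < σ.μ) {i : Fin N}
    {u g : Space N → ℂ} (hu : LocallyIntegrable u volume) (hg : LocallyIntegrable g volume)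
    (H : IsWeakPartial i u g) :
    IsWeakPartial i (trans s σ u) (trans s σ fun y =>
      (Real.sqrt σ.μ : ℂ) * g y + Complex.I * ((σ.v i / 2 : ℝ) : ℂ) * u y) := by
  refine isWeakPartial_of_complex fun φ hφ hc => ?_
  have hr0 := Real.sqrt_pos.2 hμ
  set r := Real.sqrt σ.μ with hr
  set c : ℂ := ((σ.μ ^ (1 / (2 * s)) : ℝ) : ℂ) with hcdef
  set Φ : Space N → ℂ := fun y => phase σ y * φ (r⁻¹ • y + σ.a) with hΦ
  have sφ : ContDiff ℝ ∞ (fun y : Space N => φ (r⁻¹ • y + σ.a)) :=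
    hφ.comp ((contDiff_const_smul _).add contDiff_const)
  have sΦ : ContDiff ℝ ∞ Φ := (contDiff_phase σ).mul sφ
  have kφ : HasCompactSupport (fun y : Space N => φ (r⁻¹ • y + σ.a)) :=
    hc.comp_homeomorph ((Homeomorph.smulOfNeZero r⁻¹ (inv_ne_zero hr0.ne')).trans
      (Homeomorph.addRight σ.a))
  have kΦ : HasCompactSupport Φ := kφ.mul_left
  have dΦ : ∀ y, partialDeriv i Φ y =
      phase σ y * ((r⁻¹ : ℝ) * partialDeriv i φ (r⁻¹ • y + σ.a)) +
        Complex.I * ((σ.v i / (2 * r) : ℝ) : ℂ) * Φ y := fun y => by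
    obtain ⟨p1, p2⟩ := hasFDerivAt_phase σ y
    have haff : HasFDerivAt (fun y : Space N => r⁻¹ • y + σ.a)
        (r⁻¹ • ContinuousLinearMap.id ℝ (Space N)) y :=
      ((hasFDerivAt_id y).const_smul r⁻¹).add_const σ.a
    have h1 := ((hφ.differentiable (by simp) (r⁻¹ • y + σ.a)).hasFDerivAt).comp y haff
    have h2 := (p1.mul h1).fderiv
    rw [partialDeriv, show Φ = phase σ * (φ ∘ fun y => r⁻¹ • y + σ.a) from rfl, h2]
    simp only [add_apply, smul_apply, p2, smul_eq_mul, Function.comp_apply, Pi.mul_apply,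
      ContinuousLinearMap.coe_comp, ContinuousLinearMap.coe_id', id, map_smul, Complex.real_smul,
      partialDeriv]
    push_cast
    ring
  have HΦ := isWeakPartial_complex hu hg H sΦ kΦ
  have cd : Continuous (partialDeriv i Φ) := by
    unfold partialDeriv
    exact (sΦ.continuous_fderiv (by simp)).clm_apply continuous_const
  have I1 := integrable_mul_of_locallyIntegrable hu cd (kΦ.fderiv_apply ℝ _)
  have I2 := integrable_mul_of_locallyIntegrable hu sΦ.continuous kΦ
  have I3 := integrable_mul_of_locallyIntegrable hg sΦ.continuous kΦ
  have L := integral_comp_affine (fun y => c * ((r : ℂ) * (u y * partialDeriv i Φ y) -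
      Complex.I * ((σ.v i / 2 : ℝ) : ℂ) * (u y * Φ y))) r σ.a
  have R := integral_comp_affine (fun y => c * ((r : ℂ) * (g y * Φ y) +
      Complex.I * ((σ.v i / 2 : ℝ) : ℂ) * (u y * Φ y))) r σ.a
  have L' : ∫ y, c * ((r : ℂ) * (u y * partialDeriv i Φ y) -
      Complex.I * ((σ.v i / 2 : ℝ) : ℂ) * (u y * Φ y)) = c * ((r : ℂ) * (- ∫ y, g y * Φ y) -
      Complex.I * ((σ.v i / 2 : ℝ) : ℂ) * ∫ y, u y * Φ y) := by
    rw [integral_const_mul, integral_sub (I1.const_mul _) (I2.const_mul _), integral_const_mul,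
      integral_const_mul, HΦ]
  have R' : ∫ y, c * ((r : ℂ) * (g y * Φ y) +
      Complex.I * ((σ.v i / 2 : ℝ) : ℂ) * (u y * Φ y)) = c * ((r : ℂ) * (∫ y, g y * Φ y) +
      Complex.I * ((σ.v i / 2 : ℝ) : ℂ) * ∫ y, u y * Φ y) := by
    rw [integral_const_mul, integral_add (I3.const_mul _) (I2.const_mul _), integral_const_mul,
      integral_const_mul]
  rw [L'] at L
  rw [R'] at R
  have hrC : (r : ℂ) ≠ 0 := by exact_mod_cast hr0.ne'
  have eL : ∫ x, trans s σ u x * partialDeriv i φ x = ∫ x, c * ((r : ℂ) *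
      (u (r • (x - σ.a)) * partialDeriv i Φ (r • (x - σ.a))) -
      Complex.I * ((σ.v i / 2 : ℝ) : ℂ) * (u (r • (x - σ.a)) * Φ (r • (x - σ.a)))) := by
    congr 1; funext x
    rw [dΦ, trans_apply_eq s hμ, inv_smul_add_eq hμ]
    push_cast
    field_simp
    ring
  have eR : ∫ x, trans s σ (fun y => (r : ℂ) * g y + Complex.I * ((σ.v i / 2 : ℝ) : ℂ) * u y) x *
      φ x = ∫ x, c * ((r : ℂ) * (g (r • (x - σ.a)) * Φ (r • (x - σ.a))) +
      Complex.I * ((σ.v i / 2 : ℝ) : ℂ) * (u (r • (x - σ.a)) * Φ (r • (x - σ.a)))) := by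
    congr 1; funext x
    rw [trans_apply_eq s hμ, hΦ]
    simp only
    rw [inv_smul_add_eq hμ]
    ring
  rw [eL, L, eR, R, Complex.real_smul, Complex.real_smul]
  ring

theorem memLp_trans_partial {N : ℕ} {σ : Param N} {i : Fin N}
    {u g : Space N → ℂ} (hu : MemLp u 2 volume) (hg : MemLp g 2 volume) :
    MemLp (fun y => (Real.sqrt σ.μ : ℂ) * g y + Complex.I * ((σ.v i / 2 : ℝ) : ℂ) * u y) 2 volume :=
  (hg.const_mul _).add (hu.const_mul _)

theorem MemH1.trans {N : ℕ} {s : ℝ} {σ : Param N} (hμ : 0 < σ.μ) {u : Space N → ℂ}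
    (hu : MemH1 u) : MemH1 (trans s σ u) :=
  ⟨memLp_trans hμ hu.1, fun i => ⟨_, memLp_trans hμ
    (memLp_trans_partial (i := i) hu.1 (hu.memLp_weakPartial i)),
    isWeakPartial_trans hμ hu.1.locallyIntegrable_two
      (hu.memLp_weakPartial i).locallyIntegrable_two (hu.isWeakPartial i)⟩⟩

theorem MemH1.weakPartial_trans {N : ℕ} {s : ℝ} {σ : Param N} (hμ : 0 < σ.μ) {u : Space N → ℂ}
    (hu : MemH1 u) (i : Fin N) : weakPartial i (SolitonNLS.trans s σ u) =ᵐ[volume]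
      SolitonNLS.trans s σ fun y =>
        (Real.sqrt σ.μ : ℂ) * weakPartial i u y + Complex.I * ((σ.v i / 2 : ℝ) : ℂ) * u y :=
  weakPartial_ae_eq (memLp_trans hμ (memLp_trans_partial hu.1 (hu.memLp_weakPartial i)))
    (isWeakPartial_trans hμ hu.1.locallyIntegrable_two
      (hu.memLp_weakPartial i).locallyIntegrable_two (hu.isWeakPartial i))

/-- The inverse group element. -/
def Param.inv {N : ℕ} (σ : Param N) : Param N where
  a := -(Real.sqrt σ.μ • σ.a)
  v := -((Real.sqrt σ.μ)⁻¹ • σ.v)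
  γ := -σ.γ + (1 / 2) * inner ℝ σ.v σ.a
  μ := σ.μ⁻¹

/-- Inverses stay in the family, so every property of `trans` transfers to `transInv`. -/
theorem transInv_eq_trans {N : ℕ} (s : ℝ) {σ : Param N} (hμ : 0 < σ.μ) (u : Space N → ℂ) :
    transInv s σ u = trans s σ.inv u := by
  funext y
  have h1 : Real.sqrt σ.μ ≠ 0 := (Real.sqrt_pos.2 hμ).ne'
  have e1 : (Real.sqrt σ.μ)⁻¹ • (y - -(Real.sqrt σ.μ • σ.a)) = (Real.sqrt σ.μ)⁻¹ • y + σ.a := by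
    rw [sub_neg_eq_add, smul_add, smul_smul, inv_mul_cancel₀ h1, one_smul]
  simp only [transInv, trans, Param.inv, Real.sqrt_inv, e1, Real.inv_rpow hμ.le]
  congr 3
  rw [← mul_neg]
  congr 1
  rw [← Complex.ofReal_neg]
  congr 1
  rw [sub_neg_eq_add, inner_add_right, inner_neg_left, inner_neg_left, inner_smul_left,
    inner_smul_left, inner_smul_right, inner_smul_right]
  simp only [conj_trivial]
  field_simp
  ring

theorem MemH1.transInv {N : ℕ} {s : ℝ} {σ : Param N} (hμ : 0 < σ.μ) {u : Space N → ℂ}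
    (hu : MemH1 u) : MemH1 (transInv s σ u) := by
  rw [transInv_eq_trans s hμ]
  exact hu.trans (inv_pos.2 hμ)

/-- Gauge invariance removes the phase and homogeneity extracts the amplitude. This is the origin of
`μ^{s̃/s}`; for `p = s` the factor is `μ` itself. -/
theorem powNL_trans {N : ℕ} {s : ℝ} (hs : 0 < s) (p : ℝ) {σ : Param N} (hμ : 0 < σ.μ)
    (u : Space N → ℂ) (x : Space N) :
    powNL p (trans s σ u x) = ((σ.μ ^ (p / s) : ℝ) : ℂ) * trans s σ (fun y => powNL p (u y)) x := by
  have h1 : (σ.μ ^ (1 / (2 * s))) ^ (2 * p) = σ.μ ^ (p / s) := by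
    rw [← Real.rpow_mul hμ.le]; congr 1; field_simp
  rw [powNL, norm_trans s hμ, Real.mul_rpow (Real.rpow_nonneg hμ.le _) (norm_nonneg _), h1,
    trans_apply_eq s hμ, trans_apply_eq s hμ, powNL]
  push_cast
  ring

end

noncomputable section

/-! ### Pointwise estimates for the nonlinearity -/

theorem norm_powNL {p : ℝ} (hp : 0 ≤ p) (z : ℂ) : ‖powNL p z‖ = ‖z‖ ^ (2 * p + 1) := by
  rw [powNL, norm_mul, Complex.norm_real, Real.norm_of_nonneg (Real.rpow_nonneg (norm_nonneg _) _),
    Real.rpow_add_one' (norm_nonneg _) (by positivity)]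

theorem continuous_powNL {p : ℝ} (hp : 0 ≤ p) : Continuous (powNL p) := by
  unfold powNL
  have : Continuous fun z : ℂ => ‖z‖ ^ (2 * p) :=
    continuous_norm.rpow_const fun _ => Or.inr (by positivity)
  fun_prop

/-- Away from the origin all lower powers are absorbed into the top power `P`, at the price of a
constant depending on `δ`. -/
theorem rpow_le_of_le {δ t e P : ℝ} (hδ : 0 < δ) (ht : δ ≤ t) (he : e ≤ P) :
    t ^ e ≤ δ ^ (e - P) * t ^ P := by
  have ht0 : 0 < t := hδ.trans_le ht
  have h1 : t ^ e = t ^ (e - P) * t ^ P := by rw [← Real.rpow_add ht0]; congr 1; ring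
  rw [h1]
  gcongr ?_ * _
  exact Real.rpow_le_rpow_of_nonpos hδ ht (by linarith)

theorem norm_one_add_rpow_le {δ e P : ℝ} (hδ : 0 < δ) (he0 : 0 ≤ e) (he : e ≤ P) {z : ℂ}
    (hz : δ ≤ ‖z‖) : ‖1 + z‖ ^ e ≤ (1 / δ + 1) ^ e * δ ^ (e - P) * ‖z‖ ^ P := by
  have h1 : ‖1 + z‖ ≤ (1 / δ + 1) * ‖z‖ := by
    have h2 : 1 ≤ 1 / δ * ‖z‖ := by
      rw [one_div, ← div_eq_inv_mul]; exact (one_le_div hδ).2 hz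
    calc ‖1 + z‖ ≤ 1 + ‖z‖ := by simpa using norm_add_le (1 : ℂ) z
      _ ≤ _ := by linarith
  calc ‖1 + z‖ ^ e ≤ ((1 / δ + 1) * ‖z‖) ^ e := Real.rpow_le_rpow (norm_nonneg _) h1 he0
    _ = (1 / δ + 1) ^ e * ‖z‖ ^ e := Real.mul_rpow (by positivity) (norm_nonneg _)
    _ ≤ (1 / δ + 1) ^ e * (δ ^ (e - P) * ‖z‖ ^ P) := by
        gcongr
        exact rpow_le_of_le hδ hz he
    _ = _ := by ring

/-- Near `1` a power is Lipschitz with respect to the base point `1`. -/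
theorem exists_rpow_sub_one_le (p : ℝ) :
    ∃ δ L : ℝ, 0 < δ ∧ δ ≤ 1 / 2 ∧ 0 ≤ L ∧ ∀ t : ℝ, |t| ≤ δ → |(1 + t) ^ p - 1| ≤ L * |t| := by
  have hd : DifferentiableAt ℝ (fun t : ℝ => (1 + t) ^ p) 0 :=
    (DifferentiableAt.rpow_const (by fun_prop) (Or.inl (by norm_num)))
  obtain ⟨L, hL⟩ := hd.isBigO_sub.bound
  obtain ⟨δ, hδ, h⟩ := Metric.eventually_nhds_iff.1 hL
  refine ⟨min (δ / 2) (1 / 2), |L|, by positivity, min_le_right _ _, abs_nonneg _, fun t ht => ?_⟩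
  have h1 := h (y := t) (by
    rw [Real.dist_0_eq_abs]
    exact lt_of_le_of_lt (ht.trans (min_le_left _ _)) (by linarith))
  simp only [add_zero, Real.one_rpow, sub_zero, Real.norm_eq_abs] at h1
  exact h1.trans (by gcongr; exact le_abs_self L)

/-- Second order Taylor estimate for a power at `1`. -/
theorem exists_rpow_taylor_le (p : ℝ) :
    ∃ δ L : ℝ, 0 < δ ∧ δ ≤ 1 / 2 ∧ 0 ≤ L ∧
      ∀ t : ℝ, |t| ≤ δ → |(1 + t) ^ p - 1 - p * t| ≤ L * |t| ^ 2 := by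
  -- The derivative of the remainder is `p ((1 + x)^{p-1} - 1)`, which is Lipschitz at zero; the
  -- mean value inequality then gives a second factor `|t|`.
  obtain ⟨δ, L, hδ, hδ2, hL, h⟩ := exists_rpow_sub_one_le (p - 1)
  refine ⟨δ, |p| * L, hδ, hδ2, by positivity, fun t ht => ?_⟩
  have hder : ∀ x ∈ Icc (-|t|) |t|, HasDerivWithinAt (fun x : ℝ => (1 + x) ^ p - 1 - p * x)
      (p * ((1 + x) ^ (p - 1) - 1)) (Icc (-|t|) |t|) x := fun x hx => by
    have hx1 : 0 < 1 + x := by linarith [hx.1]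
    have := ((((hasDerivAt_id x).const_add 1).rpow_const (p := p) (Or.inl hx1.ne')).sub_const 1).sub
      ((hasDerivAt_id x).const_mul p)
    refine (this.congr_deriv ?_).hasDerivWithinAt
    simp; ring
  have hb : ∀ x ∈ Icc (-|t|) |t|, ‖p * ((1 + x) ^ (p - 1) - 1)‖ ≤ |p| * L * |t| := fun x hx => by
    have hx' : |x| ≤ |t| := abs_le.2 hx
    rw [Real.norm_eq_abs, abs_mul, mul_assoc]
    gcongr
    exact (h x (hx'.trans ht)).trans (by gcongr)
  have := (convex_Icc (-|t|) |t|).norm_image_sub_le_of_norm_hasDerivWithin_le hder hb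
    (x := 0) (y := t) ⟨by simp, abs_nonneg t⟩ ⟨neg_abs_le t, le_abs_self t⟩
  simp only [add_zero, Real.one_rpow, sub_self, mul_zero, sub_zero, Real.norm_eq_abs] at this
  rw [sq, ← mul_assoc]
  exact this

theorem exists_norm_powNL_one_sub_le {p : ℝ} (hp : 0 ≤ p) : ∃ C, 0 ≤ C ∧ ∀ z : ℂ,
    ‖powNL p (1 + z) - 1‖ ≤ C * (‖z‖ + ‖z‖ ^ (2 * p + 1)) := by
  obtain ⟨δ, L, hδ, hδ2, hL, h⟩ := exists_rpow_sub_one_le (2 * p)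
  set P := 2 * p + 1 with hP
  set B := (1 / δ + 1) ^ P * δ ^ (P - P) + δ ^ (0 - P) with hB
  have B0 : 0 ≤ B := by positivity
  refine ⟨(2 * L + 1) + B, by positivity, fun z => ?_⟩
  have hzP : 0 ≤ ‖z‖ ^ P := Real.rpow_nonneg (norm_nonneg _) _
  rcases le_total ‖z‖ δ with hz | hz
  · have ht : |‖1 + z‖ - 1| ≤ ‖z‖ := by
      have := abs_norm_sub_norm_le (1 + z) 1
      simpa using this
    have h1 := h (‖1 + z‖ - 1) (ht.trans hz)
    rw [add_sub_cancel] at h1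
    have e : powNL p (1 + z) - 1 = ((‖1 + z‖ ^ (2 * p) - 1 : ℝ) : ℂ) * (1 + z) + z := by
      rw [powNL]; push_cast; ring
    have h2 : ‖1 + z‖ ≤ 2 := by
      have := (abs_le.1 ht).2; linarith
    calc ‖powNL p (1 + z) - 1‖ ≤ |‖1 + z‖ ^ (2 * p) - 1| * ‖1 + z‖ + ‖z‖ := by
          rw [e]
          refine (norm_add_le _ _).trans ?_
          rw [norm_mul, Complex.norm_real, Real.norm_eq_abs]
      _ ≤ (L * ‖z‖) * 2 + ‖z‖ := by
          gcongr
          exact h1.trans (by gcongr)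
      _ ≤ _ := by
          have : 0 ≤ B * (‖z‖ + ‖z‖ ^ P) := by positivity
          have : 0 ≤ (2 * L + 1) * ‖z‖ ^ P := by positivity
          nlinarith
  · have h1 := norm_one_add_rpow_le hδ (by positivity : 0 ≤ P) le_rfl hz
    have h2 := rpow_le_of_le hδ hz (by positivity : (0 : ℝ) ≤ P)
    rw [Real.rpow_zero] at h2
    calc ‖powNL p (1 + z) - 1‖ ≤ ‖1 + z‖ ^ P + 1 := by
          refine (norm_sub_le _ _).trans ?_
          rw [norm_powNL hp, norm_one]
      _ ≤ B * ‖z‖ ^ P := by rw [hB, add_mul]; gcongr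
      _ ≤ _ := by
          have : 0 ≤ B * ‖z‖ := by positivity
          have : 0 ≤ (2 * L + 1) * (‖z‖ + ‖z‖ ^ P) := by positivity
          nlinarith

/-- For small `z` write `|1 + z|² = 1 + q` with `q = 2 Re z + |z|²`, so that only a Taylor expansion
in one real variable is needed. For large `z` every term is at most a constant times `|z|^P`. -/
theorem exists_norm_powNL_one_taylor_le {p P : ℝ} (hp : 0 ≤ p) (hP2 : 2 ≤ P)
    (hP : 2 * p + 1 ≤ P) : ∃ C, 0 ≤ C ∧ ∀ z : ℂ,
    ‖powNL p (1 + z) - 1 - z - ((2 * p * z.re : ℝ) : ℂ)‖ ≤ C * (‖z‖ ^ 2 + ‖z‖ ^ P) := by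
  obtain ⟨δ₀, L, hδ₀, hδ2, hL, h⟩ := exists_rpow_taylor_le p
  -- The factor `3` accounts for `|q| ≤ 3 |z|`.
  set δ := δ₀ / 3 with hδd
  have hδ : 0 < δ := by positivity
  set B := (1 / δ + 1) ^ (2 * p + 1) * δ ^ (2 * p + 1 - P) + δ ^ (0 - P) +
    (1 + 2 * p) * δ ^ (1 - P) with hB
  have B0 : 0 ≤ B := by positivity
  refine ⟨(18 * L + 4 * p) + B, by positivity, fun z => ?_⟩
  have hzP : 0 ≤ ‖z‖ ^ P := Real.rpow_nonneg (norm_nonneg _) _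
  have hre := Complex.abs_re_le_norm z
  rcases le_total ‖z‖ δ with hz | hz
  · set q := 2 * z.re + ‖z‖ ^ 2 with hq
    have hz1 : ‖z‖ ≤ 1 := by linarith
    have hqz : |q| ≤ 3 * ‖z‖ := by
      rw [abs_le] at hre ⊢
      constructor <;> nlinarith [norm_nonneg z]
    have hnq : ‖1 + z‖ ^ 2 = 1 + q := by
      rw [← Complex.normSq_eq_norm_sq, hq, ← Complex.normSq_eq_norm_sq, Complex.normSq_apply,
        Complex.normSq_apply]
      simp; ring
    have hpow : ‖1 + z‖ ^ (2 * p) = (1 + q) ^ p := by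
      rw [← hnq, ← Real.rpow_natCast, ← Real.rpow_mul (norm_nonneg _)]; norm_num
    have h1 := h q (hqz.trans (by linarith))
    have h2 : ‖1 + z‖ ≤ 2 := by
      have := norm_add_le (1 : ℂ) z
      rw [norm_one] at this
      linarith
    have e : powNL p (1 + z) - 1 - z - ((2 * p * z.re : ℝ) : ℂ) =
        (((1 + q) ^ p - 1 - p * q : ℝ) : ℂ) * (1 + z) + ((p * ‖z‖ ^ 2 : ℝ) : ℂ) * (1 + z) +
          ((2 * p * z.re : ℝ) : ℂ) * z := by
      rw [powNL, hpow, hq]; push_cast; ring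
    have b1 : ‖(((1 + q) ^ p - 1 - p * q : ℝ) : ℂ) * (1 + z)‖ ≤ L * (3 * ‖z‖) ^ 2 * 2 := by
      rw [norm_mul, Complex.norm_real, Real.norm_eq_abs]
      gcongr
      exact h1.trans (by gcongr)
    have b2 : ‖((p * ‖z‖ ^ 2 : ℝ) : ℂ) * (1 + z)‖ ≤ p * ‖z‖ ^ 2 * 2 := by
      rw [norm_mul, Complex.norm_real, Real.norm_of_nonneg (by positivity)]
      gcongr
    have b3 : ‖((2 * p * z.re : ℝ) : ℂ) * z‖ ≤ 2 * p * ‖z‖ * ‖z‖ := by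
      rw [norm_mul, Complex.norm_real, Real.norm_eq_abs, abs_mul,
        abs_of_nonneg (by positivity : 0 ≤ 2 * p)]
      gcongr
    rw [e]
    refine (norm_add₃_le.trans (add_le_add (add_le_add b1 b2) b3)).trans ?_
    have : 0 ≤ B * (‖z‖ ^ 2 + ‖z‖ ^ P) := by positivity
    have : 0 ≤ (18 * L + 4 * p) * ‖z‖ ^ P := by positivity
    nlinarith
  · have h1 := norm_one_add_rpow_le hδ (by positivity : 0 ≤ 2 * p + 1) hP hz
    have h2 := rpow_le_of_le hδ hz (by linarith : (0 : ℝ) ≤ P)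
    have h3 := rpow_le_of_le hδ hz (by linarith : (1 : ℝ) ≤ P)
    rw [Real.rpow_zero] at h2
    rw [Real.rpow_one] at h3
    have b3 : ‖((2 * p * z.re : ℝ) : ℂ)‖ ≤ 2 * p * ‖z‖ := by
      rw [Complex.norm_real, Real.norm_eq_abs, abs_mul,
        abs_of_nonneg (by positivity : 0 ≤ 2 * p)]
      gcongr
    calc ‖powNL p (1 + z) - 1 - z - ((2 * p * z.re : ℝ) : ℂ)‖
        ≤ ‖1 + z‖ ^ (2 * p + 1) + 1 + ‖z‖ + 2 * p * ‖z‖ := by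
          refine (norm_sub_le _ _).trans (add_le_add ?_ b3)
          refine (norm_sub_le _ _).trans (add_le_add ?_ le_rfl)
          refine (norm_sub_le _ _).trans ?_
          rw [norm_powNL hp, norm_one]
      _ = ‖1 + z‖ ^ (2 * p + 1) + 1 + (1 + 2 * p) * ‖z‖ := by ring
      _ ≤ (1 / δ + 1) ^ (2 * p + 1) * δ ^ (2 * p + 1 - P) * ‖z‖ ^ P + δ ^ (0 - P) * ‖z‖ ^ P +
          (1 + 2 * p) * (δ ^ (1 - P) * ‖z‖ ^ P) := by gcongr
      _ = B * ‖z‖ ^ P := by rw [hB]; ring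
      _ ≤ _ := by
          have : 0 ≤ B * ‖z‖ ^ 2 := by positivity
          have : 0 ≤ (18 * L + 4 * p) * (‖z‖ ^ 2 + ‖z‖ ^ P) := by positivity
          nlinarith

theorem powNL_real_mul {p a : ℝ} (ha : 0 < a) (z : ℂ) :
    powNL p ((a : ℂ) * z) = ((a ^ (2 * p + 1) : ℝ) : ℂ) * powNL p z := by
  rw [powNL, powNL, norm_mul, Complex.norm_real, Real.norm_of_nonneg ha.le,
    Real.mul_rpow ha.le (norm_nonneg _), Real.rpow_add ha, Real.rpow_one]
  push_cast
  ring

/-- Lipschitz type estimate of the nonlinearity around a positive real number. -/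
theorem exists_norm_powNL_sub_le {p : ℝ} (hp : 0 ≤ p) : ∃ C, 0 ≤ C ∧ ∀ (a : ℝ), 0 < a → ∀ z : ℂ,
    ‖powNL p (a + z) - ((a ^ (2 * p + 1) : ℝ) : ℂ)‖ ≤
      C * (a ^ (2 * p) * ‖z‖ + ‖z‖ ^ (2 * p + 1)) := by
  obtain ⟨C, hC0, hC⟩ := exists_norm_powNL_one_sub_le hp
  refine ⟨C, hC0, fun a ha z => ?_⟩
  have haC : (a : ℂ) ≠ 0 := by exact_mod_cast ha.ne'
  -- Homogeneity reduces the estimate to base point `1`.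
  obtain ⟨ζ, rfl⟩ : ∃ ζ, z = a * ζ := ⟨z / a, by field_simp⟩
  have e : powNL p (a + a * ζ) - ((a ^ (2 * p + 1) : ℝ) : ℂ) =
      ((a ^ (2 * p + 1) : ℝ) : ℂ) * (powNL p (1 + ζ) - 1) := by
    have e0 : powNL p (a + a * ζ) = ((a ^ (2 * p + 1) : ℝ) : ℂ) * powNL p (1 + ζ) := by
      rw [← powNL_real_mul ha, mul_add, mul_one]
    rw [e0]
    ring
  rw [e, norm_mul, Complex.norm_real, Real.norm_of_nonneg (by positivity), norm_mul,
    Complex.norm_real, Real.norm_of_nonneg ha.le, Real.mul_rpow ha.le (norm_nonneg _)]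
  calc a ^ (2 * p + 1) * ‖powNL p (1 + ζ) - 1‖
      ≤ a ^ (2 * p + 1) * (C * (‖ζ‖ + ‖ζ‖ ^ (2 * p + 1))) := by gcongr; exact hC ζ
    _ = _ := by rw [Real.rpow_add ha, Real.rpow_one]; ring

/-- Quadratic estimate of the Taylor remainder of the nonlinearity around a positive number. -/
theorem exists_norm_powNL_taylor_le {p P : ℝ} (hp : 0 ≤ p) (hP2 : 2 ≤ P)
    (hP : 2 * p + 1 ≤ P) : ∃ C, 0 ≤ C ∧ ∀ (a : ℝ), 0 < a → ∀ z : ℂ,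
    ‖powNL p (a + z) - ((a ^ (2 * p + 1) : ℝ) : ℂ) - ((a ^ (2 * p) : ℝ) : ℂ) * z
        - ((2 * p * a ^ (2 * p) * z.re : ℝ) : ℂ)‖ ≤
      C * (a ^ (2 * p - 1) * ‖z‖ ^ 2 + a ^ (2 * p + 1 - P) * ‖z‖ ^ P) := by
  obtain ⟨C, hC0, hC⟩ := exists_norm_powNL_one_taylor_le hp hP2 hP
  refine ⟨C, hC0, fun a ha z => ?_⟩
  have haC : (a : ℂ) ≠ 0 := by exact_mod_cast ha.ne'
  obtain ⟨ζ, rfl⟩ : ∃ ζ, z = a * ζ := ⟨z / a, by field_simp⟩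
  have e0 : powNL p (a + a * ζ) = ((a ^ (2 * p + 1) : ℝ) : ℂ) * powNL p (1 + ζ) := by
    rw [← powNL_real_mul ha, mul_add, mul_one]
  have e1 : a ^ (2 * p + 1) = a ^ (2 * p) * a := by rw [Real.rpow_add ha, Real.rpow_one]
  have e : powNL p (a + a * ζ) - ((a ^ (2 * p + 1) : ℝ) : ℂ) - ((a ^ (2 * p) : ℝ) : ℂ) * (a * ζ)
        - ((2 * p * a ^ (2 * p) * ((a : ℂ) * ζ).re : ℝ) : ℂ) =
      ((a ^ (2 * p + 1) : ℝ) : ℂ) * (powNL p (1 + ζ) - 1 - ζ - ((2 * p * ζ.re : ℝ) : ℂ)) := by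
    rw [e0, e1, Complex.re_ofReal_mul]
    push_cast
    ring
  rw [e, norm_mul, Complex.norm_real, Real.norm_of_nonneg (by positivity), norm_mul,
    Complex.norm_real, Real.norm_of_nonneg ha.le, Real.mul_rpow ha.le (norm_nonneg _)]
  have e2 : a ^ (2 * p - 1) * (a * ‖ζ‖) ^ 2 = a ^ (2 * p + 1) * ‖ζ‖ ^ 2 := by
    rw [mul_pow, ← mul_assoc, ← Real.rpow_natCast a 2, ← Real.rpow_add ha]
    congr 2; push_cast; ring
  have e3 : a ^ (2 * p + 1 - P) * (a ^ P * ‖ζ‖ ^ P) = a ^ (2 * p + 1) * ‖ζ‖ ^ P := by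
    rw [← mul_assoc, ← Real.rpow_add ha]; congr 2; ring
  rw [e2, e3]
  calc _ ≤ a ^ (2 * p + 1) * (C * (‖ζ‖ ^ 2 + ‖ζ‖ ^ P)) := by gcongr; exact hC ζ
    _ = _ := by ring

end

noncomputable section

/-! ### Integrated estimates for the nonlinearities around the soliton -/

theorem exists_one_add_mul_exp_le {e : ℝ} (he : 0 < e) :
    ∃ B, 0 ≤ B ∧ ∀ r : ℝ, 0 ≤ r → (1 + r) * Real.exp (-(1 / 2) * r * e) ≤ B := by
  refine ⟨1 + 2 / e, by positivity, fun r hr => ?_⟩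
  have h1 := Real.add_one_le_exp (1 / 2 * r * e)
  have h2 : (1 + r) ≤ (1 + 2 / e) * Real.exp (1 / 2 * r * e) := by
    have : (1 + 2 / e) * (1 / 2 * r * e + 1) = 1 + r + (2 / e + 1 / 2 * r * e) := by
      field_simp; ring
    have h3 : (1 + 2 / e) * (1 / 2 * r * e + 1) ≤ (1 + 2 / e) * Real.exp (1 / 2 * r * e) := by
      gcongr
    have : 0 ≤ 2 / e + 1 / 2 * r * e := by positivity
    linarith
  calc (1 + r) * Real.exp (-(1 / 2) * r * e)
      ≤ (1 + 2 / e) * Real.exp (1 / 2 * r * e) * Real.exp (-(1 / 2) * r * e) := by gcongr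
    _ = 1 + 2 / e := by
      rw [mul_assoc, ← Real.exp_add, show 1 / 2 * r * e + -(1 / 2) * r * e = 0 by ring,
        Real.exp_zero, mul_one]

/-- `g` is controlled by `(1 + |x|) η`. -/
def Controlled {N : ℕ} (η g : Space N → ℝ) : Prop :=
  ∃ K, 0 ≤ K ∧ ∀ x, |g x| ≤ K * ((1 + ‖x‖) * η x)

/-- The hypothesis gives `2 q + 1 < (N + 2) / (N - 2)`, which lies below the critical Sobolev
exponent. -/
theorem max_two_le_sobolev {N : ℕ} {q : ℝ} (hq : 3 ≤ N → q < 2 / ((N : ℝ) - 2)) :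
    3 ≤ N → max 2 (2 * q + 1) ≤ 2 * N / (N - 2) := by
  intro h3
  have h : (3 : ℝ) ≤ N := by exact_mod_cast h3
  have h2 : (0 : ℝ) < N - 2 := by linarith
  have := (lt_div_iff₀ h2).1 (hq h3)
  refine max_le ?_ ?_ <;> rw [le_div_iff₀ h2] <;> nlinarith

theorem soliton_exponent_lt {N : ℕ} {s : ℝ} (hs : s < 2 / (N : ℝ)) :
    3 ≤ N → s < 2 / ((N : ℝ) - 2) := by
  intro h3
  have h : (3 : ℝ) ≤ N := by exact_mod_cast h3
  exact hs.trans (div_lt_div_of_pos_left (by norm_num) (by linarith) (by linarith))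

namespace IsSolitonProfile

variable {N : ℕ} {s : ℝ} {η : Space N → ℝ}

theorem exists_weight_bound (hN : 1 ≤ N) (hs : 0 < s) (hη : IsSolitonProfile s η) {e : ℝ}
    (he : 0 < e) : ∃ B, 0 ≤ B ∧ ∀ x, (1 + ‖x‖) * η x ^ e ≤ B := by
  obtain ⟨K, hK, h, -⟩ := hη.exists_bounds hN hs
  obtain ⟨B, hB0, hB⟩ := exists_one_add_mul_exp_le he
  refine ⟨K ^ e * B, by positivity, fun x => ?_⟩
  calc (1 + ‖x‖) * η x ^ e ≤ (1 + ‖x‖) * (K * Real.exp (-(1 / 2) * ‖x‖)) ^ e := by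
        gcongr
        exacts [(hη.pos x).le, h x]
    _ = K ^ e * ((1 + ‖x‖) * Real.exp (-(1 / 2) * ‖x‖ * e)) := by
        rw [Real.mul_rpow hK (Real.exp_pos _).le, ← Real.exp_mul]; ring
    _ ≤ _ := by gcongr; exact hB _ (norm_nonneg _)

theorem rapid_rpow (hN : 1 ≤ N) (hs : 0 < s) (hη : IsSolitonProfile s η) {p : ℝ}
    (hp : 0 ≤ p) : Rapid (fun x => η x ^ (p + 1)) := by
  obtain ⟨B, -, hB⟩ := hη.exists_rpow_bound hN hs hp
  have : (fun x => η x ^ (p + 1)) = fun x => η x ^ p * η x := by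
    funext x; rw [Real.rpow_add (hη.pos x), Real.rpow_one]
  rw [this]
  exact (hη.rapid hN hs).bdd_mul hB

theorem aestronglyMeasurable_powNL (hη : IsSolitonProfile s η) {p : ℝ} (hp : 0 ≤ p)
    {w : Space N → ℂ} (hw : MemH1 w) :
    AEStronglyMeasurable (fun x => powNL p (toC η x + w x)) :=
  (continuous_powNL hp).comp_aestronglyMeasurable
    ((Complex.continuous_ofReal.comp hη.contDiff.continuous).aestronglyMeasurable.add
      hw.1.aestronglyMeasurable)

/-- Quadratic estimate for the remainder of the focusing nonlinearity. -/
theorem exists_taylor_bound (hN : 1 ≤ N) (hs : 0 < s) (hsN : s < 2 / (N : ℝ))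
    (hη : IsSolitonProfile s η) {g : Space N → ℝ} (hg : Continuous g) (hgη : Controlled η g) :
    ∃ C, 0 ≤ C ∧ ∀ w : Space N → ℂ, MemH1 w → normH1 w ≤ 1 →
      Integrable (fun x => (powNL s (toC η x + w x) - ((η x ^ (2 * s + 1) : ℝ) : ℂ)
        - ((η x ^ (2 * s) : ℝ) : ℂ) * w x - ((2 * s * η x ^ (2 * s) * (w x).re : ℝ) : ℂ))
          * (g x : ℂ)) ∧
      ‖∫ x, (powNL s (toC η x + w x) - ((η x ^ (2 * s + 1) : ℝ) : ℂ)
        - ((η x ^ (2 * s) : ℝ) : ℂ) * w x - ((2 * s * η x ^ (2 * s) * (w x).re : ℝ) : ℂ))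
          * (g x : ℂ)‖ ≤ C * normH1 w ^ 2 := by
  set P := max 2 (2 * s + 1) with hP
  have P2 : 2 ≤ P := le_max_left _ _
  have Ps : 2 * s + 1 ≤ P := le_max_right _ _
  -- The remainder carries `η^{2s-1}` and `η^{2s+1-P}`, whose exponents may be negative. The test
  -- profile supplies one more power of `η`, so the exponents become `2 s` and `2 s + 2 - P`; both
  -- are positive and beat the weight `1 + |x|`.
  have e2 : 0 < 2 * s + 2 - P := by
    have : P < 2 * s + 2 := max_lt (by linarith) (by linarith)
    linarith
  obtain ⟨C, hC0, hC⟩ := exists_norm_powNL_taylor_le hs.le P2 Ps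
  obtain ⟨K, hK0, hK⟩ := hgη
  obtain ⟨B, hB0, hB⟩ := hη.exists_weight_bound hN hs (e := 2 * s) (by linarith)
  obtain ⟨B', hB0', hB'⟩ := hη.exists_weight_bound hN hs e2
  obtain ⟨S, hS0, hS⟩ := exists_integral_rpow_le hN P P2
    (max_two_le_sobolev (soliton_exponent_lt hsN))
  refine ⟨C * K * (B + B' * S), by positivity, fun w hw hw1 => ?_⟩
  obtain ⟨iP, bP⟩ := hS w hw hw1
  have i2 : Integrable (fun x => ‖w x‖ ^ 2) := hw.1.integrable_norm_pow (by simp)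
  have ib : Integrable (fun x => C * K * (B * ‖w x‖ ^ 2 + B' * ‖w x‖ ^ P)) :=
    ((i2.const_mul B).add (iP.const_mul B')).const_mul (C * K)
  have bd : ∀ x, ‖(powNL s (toC η x + w x) - ((η x ^ (2 * s + 1) : ℝ) : ℂ)
        - ((η x ^ (2 * s) : ℝ) : ℂ) * w x - ((2 * s * η x ^ (2 * s) * (w x).re : ℝ) : ℂ))
          * (g x : ℂ)‖ ≤ C * K * (B * ‖w x‖ ^ 2 + B' * ‖w x‖ ^ P) := fun x => by
    have hx := hη.pos x
    rw [norm_mul, Complex.norm_real, Real.norm_eq_abs]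
    have r1 : η x ^ (2 * s - 1) * η x = η x ^ (2 * s) := by
      rw [← Real.rpow_add_one hx.ne']; congr 1; ring
    have r2 : η x ^ (2 * s + 1 - P) * η x = η x ^ (2 * s + 2 - P) := by
      rw [← Real.rpow_add_one hx.ne']; congr 1; ring
    calc _ ≤ C * (η x ^ (2 * s - 1) * ‖w x‖ ^ 2 + η x ^ (2 * s + 1 - P) * ‖w x‖ ^ P) *
          (K * ((1 + ‖x‖) * η x)) := by
            gcongr
            · exact hC _ hx _
            · exact hK x
      _ = C * K * (((1 + ‖x‖) * (η x ^ (2 * s - 1) * η x)) * ‖w x‖ ^ 2 +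
          ((1 + ‖x‖) * (η x ^ (2 * s + 1 - P) * η x)) * ‖w x‖ ^ P) := by ring
      _ ≤ _ := by
        rw [r1, r2]
        gcongr
        exacts [hB x, hB' x]
  have meas : AEStronglyMeasurable (fun x => (powNL s (toC η x + w x) -
        ((η x ^ (2 * s + 1) : ℝ) : ℂ)
        - ((η x ^ (2 * s) : ℝ) : ℂ) * w x - ((2 * s * η x ^ (2 * s) * (w x).re : ℝ) : ℂ))
          * (g x : ℂ)) := by
    have c1 := hη.continuous_rpow (2 * s)
    have c2 := hη.continuous_rpow (2 * s + 1)
    have mw := hw.1.aestronglyMeasurable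
    refine AEStronglyMeasurable.mul ?_ (Complex.continuous_ofReal.comp hg).aestronglyMeasurable
    refine AEStronglyMeasurable.sub (AEStronglyMeasurable.sub (AEStronglyMeasurable.sub
      (hη.aestronglyMeasurable_powNL hs.le hw) ?_) ?_) ?_
    · exact (Complex.continuous_ofReal.comp c2).aestronglyMeasurable
    · exact (Complex.continuous_ofReal.comp c1).aestronglyMeasurable.mul mw
    · exact Complex.continuous_ofReal.comp_aestronglyMeasurable
        ((continuous_const.mul c1).aestronglyMeasurable.mul
          (Complex.continuous_re.comp_aestronglyMeasurable mw))
  refine ⟨ib.mono' meas (Filter.Eventually.of_forall bd), ?_⟩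
  refine (norm_integral_le_of_norm_le ib (Filter.Eventually.of_forall bd)).trans ?_
  rw [integral_const_mul, integral_add (i2.const_mul B) (iP.const_mul B'), integral_const_mul,
    integral_const_mul]
  have q2 : ∫ x, ‖w x‖ ^ 2 ≤ normH1 w ^ 2 := by
    rw [← l2_sq hw.1]
    have := hw.l2_le
    have := l2_nonneg w
    gcongr
  calc _ ≤ C * K * (B * normH1 w ^ 2 + B' * (S * normH1 w ^ 2)) := by gcongr
    _ = _ := by ring

/-- Lipschitz estimate for the perturbation. -/
theorem exists_lipschitz_bound (hN : 1 ≤ N) (hs : 0 < s) (hη : IsSolitonProfile s η) {p : ℝ}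
    (hp : 0 ≤ p) (hpN : 3 ≤ N → p < 2 / ((N : ℝ) - 2)) (L : ℝ) {g : Space N → ℝ}
    (hg : Continuous g) (hgr : Rapid g) :
    ∃ C, 0 ≤ C ∧ ∀ l : Space N → ℝ, AEStronglyMeasurable l → (∀ᵐ x, |l x| ≤ L) →
      ∀ w : Space N → ℂ, MemH1 w → normH1 w ≤ 1 →
      Integrable (fun x => (l x : ℂ) *
        (powNL p (toC η x + w x) - ((η x ^ (2 * p + 1) : ℝ) : ℂ)) * (g x : ℂ)) ∧
      ‖∫ x, (l x : ℂ) *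
        (powNL p (toC η x + w x) - ((η x ^ (2 * p + 1) : ℝ) : ℂ)) * (g x : ℂ)‖
          ≤ C * normH1 w := by
  set P := max 2 (2 * p + 1) with hP
  have P2 : 2 ≤ P := le_max_left _ _
  have Ps : 2 * p + 1 ≤ P := le_max_right _ _
  obtain ⟨C, hC0, hC⟩ := exists_norm_powNL_sub_le hp
  obtain ⟨K, hK0, hK⟩ := hgr.exists_bound
  obtain ⟨B, hB0, hB⟩ := hη.exists_rpow_bound hN hs (p := 2 * p) (by linarith)
  obtain ⟨S, hS0, hS⟩ := exists_integral_rpow_le hN P P2 (max_two_le_sobolev hpN)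
  have hgm := hgr.memLp hg
  refine ⟨|L| * C * ((B + 1) * l2 (toC g) + K * S),
    by have := l2_nonneg (toC g); positivity, fun l hl hlL w hw hw1 => ?_⟩
  obtain ⟨iP, bP⟩ := hS w hw hw1
  have wn : MemLp (fun x => (‖w x‖ : ℂ)) 2 volume := hw.1.norm.ofReal
  have i1 : Integrable (fun x => ‖w x‖ * |g x|) := by
    have := (integrable_mul_of_memLp hw.1 (memLp_toC hgm)).norm
    simpa only [norm_mul, Complex.norm_real, Real.norm_eq_abs] using this
  have b1 : ∫ x, ‖w x‖ * |g x| ≤ l2 w * l2 (toC g) := by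
    have hgn : MemLp (fun x => ((|g x| : ℝ) : ℂ)) 2 volume := memLp_toC hgm.abs
    have h := norm_integral_mul_le wn hgn
    have e1 : l2 (fun x => (‖w x‖ : ℂ)) = l2 w := by
      unfold l2; congr 1
      exact eLpNorm_congr_norm_ae (Filter.Eventually.of_forall fun x => by simp)
    have e2 : l2 (fun x => ((|g x| : ℝ) : ℂ)) = l2 (toC g) := by
      unfold l2; congr 1
      exact eLpNorm_congr_norm_ae (Filter.Eventually.of_forall fun x => by simp [toC])
    rw [e1, e2] at h
    refine le_trans ?_ h
    have : (fun x => (‖w x‖ : ℂ) * ((|g x| : ℝ) : ℂ)) = fun x => ((‖w x‖ * |g x| : ℝ) : ℂ) := by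
      funext x; push_cast; rfl
    rw [this, integral_complex_ofReal, Complex.norm_real]
    exact Real.le_norm_self _
  have ib : Integrable (fun x => |L| * C * ((B + 1) * (‖w x‖ * |g x|) + K * ‖w x‖ ^ P)) :=
    ((i1.const_mul (B + 1)).add (iP.const_mul K)).const_mul (|L| * C)
  have bd : ∀ᵐ x, ‖(l x : ℂ) *
        (powNL p (toC η x + w x) - ((η x ^ (2 * p + 1) : ℝ) : ℂ)) * (g x : ℂ)‖ ≤
      |L| * C * ((B + 1) * (‖w x‖ * |g x|) + K * ‖w x‖ ^ P) := by
    filter_upwards [hlL] with x hlx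
    have hx := hη.pos x
    rw [norm_mul, norm_mul, Complex.norm_real, Complex.norm_real, Real.norm_eq_abs,
      Real.norm_eq_abs]
    -- The exponent lies between `1` and `P`, so this power splits into a term for Cauchy–Schwarz
    -- and a term for Sobolev.
    have hw' : ‖w x‖ ^ (2 * p + 1) ≤ ‖w x‖ + ‖w x‖ ^ P := by
      rcases le_total ‖w x‖ 1 with h | h
      · have : ‖w x‖ ^ (2 * p + 1) ≤ ‖w x‖ ^ (1 : ℝ) := by
          rcases eq_or_lt_of_le (norm_nonneg (w x)) with h0 | h0
          · rw [← h0, Real.zero_rpow (by linarith), Real.zero_rpow one_ne_zero]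
          · exact Real.rpow_le_rpow_of_exponent_ge h0 h (by linarith)
        rw [Real.rpow_one] at this
        have : 0 ≤ ‖w x‖ ^ P := by positivity
        linarith
      · have := Real.rpow_le_rpow_of_exponent_le h Ps
        linarith [norm_nonneg (w x)]
    have hBx : η x ^ (2 * p) ≤ B := (le_abs_self _).trans (hB x)
    calc _ ≤ |L| * (C * (η x ^ (2 * p) * ‖w x‖ + ‖w x‖ ^ (2 * p + 1))) * |g x| := by
            have h1 : |l x| ≤ |L| := hlx.trans (le_abs_self L)
            have h2 := hC _ hx (w x)
            exact mul_le_mul_of_nonneg_right (mul_le_mul h1 h2 (norm_nonneg _) (abs_nonneg L))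
              (abs_nonneg _)
      _ ≤ |L| * (C * (B * ‖w x‖ + (‖w x‖ + ‖w x‖ ^ P))) * |g x| := by gcongr
      _ = |L| * C * ((B + 1) * (‖w x‖ * |g x|) + |g x| * ‖w x‖ ^ P) := by ring
      _ ≤ _ := by gcongr; exact hK x
  have meas : AEStronglyMeasurable (fun x => (l x : ℂ) *
        (powNL p (toC η x + w x) - ((η x ^ (2 * p + 1) : ℝ) : ℂ)) * (g x : ℂ)) :=
    ((Complex.continuous_ofReal.comp_aestronglyMeasurable hl).mul
      ((hη.aestronglyMeasurable_powNL hp hw).sub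
        (Complex.continuous_ofReal.comp (hη.continuous_rpow _)).aestronglyMeasurable)).mul
      (Complex.continuous_ofReal.comp hg).aestronglyMeasurable
  refine ⟨ib.mono' meas bd, ?_⟩
  refine (norm_integral_le_of_norm_le ib bd).trans ?_
  rw [integral_const_mul, integral_add (i1.const_mul _) (iP.const_mul _), integral_const_mul,
    integral_const_mul]
  have n0 := normH1_nonneg w
  have q1 : ∫ x, ‖w x‖ * |g x| ≤ normH1 w * l2 (toC g) :=
    b1.trans (mul_le_mul_of_nonneg_right hw.l2_le (l2_nonneg _))
  have q2 : S * normH1 w ^ 2 ≤ S * normH1 w := by gcongr; nlinarith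
  calc _ ≤ |L| * C * ((B + 1) * (normH1 w * l2 (toC g)) + K * (S * normH1 w)) := by
        gcongr; exact bP.trans q2
    _ = _ := by ring

theorem integrable_perturbation (hN : 1 ≤ N) (hs : 0 < s) (hη : IsSolitonProfile s η) {p : ℝ}
    (hp : 0 ≤ p) {L : ℝ} {l g : Space N → ℝ} (hg : Continuous g) (hgr : Rapid g)
    (hl : AEStronglyMeasurable l) (hlL : ∀ᵐ x, |l x| ≤ L) :
    Integrable (fun x => (l x : ℂ) * ((η x ^ (2 * p + 1) : ℝ) : ℂ) * (g x : ℂ)) := by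
  have h := ((hη.rapid_rpow hN hs (p := 2 * p) (by linarith)).mul hgr).integrable
    ((hη.continuous_rpow (2 * p + 1)).mul hg)
  have := (h.bdd_mul hl (c := L) (by simpa only [Real.norm_eq_abs] using hlL)).ofReal (𝕜 := ℂ)
  refine this.congr (Filter.Eventually.of_forall fun x => ?_)
  simp [mul_assoc]

theorem norm_integral_perturbation_le (hN : 1 ≤ N) (hs : 0 < s) (hη : IsSolitonProfile s η)
    {p : ℝ} (hp : 0 ≤ p) (L : ℝ) {g : Space N → ℝ} (hg : Continuous g) (hgr : Rapid g) :
    ∃ C, 0 ≤ C ∧ ∀ l : Space N → ℝ, (∀ᵐ x, |l x| ≤ L) →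
      ‖∫ x, (l x : ℂ) * ((η x ^ (2 * p + 1) : ℝ) : ℂ) * (g x : ℂ)‖ ≤ C := by
  have h := ((hη.rapid_rpow hN hs (p := 2 * p) (by linarith)).mul hgr).integrable
    ((hη.continuous_rpow (2 * p + 1)).mul hg)
  refine ⟨∫ x, |L| * |η x ^ (2 * p + 1) * g x|, integral_nonneg fun x => by positivity,
    fun l hlL => norm_integral_le_of_norm_le (h.abs.const_mul _) ?_⟩
  filter_upwards [hlL] with x hx
  rw [norm_mul, norm_mul, Complex.norm_real, Complex.norm_real, Complex.norm_real, mul_assoc,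
    ← norm_mul, Real.norm_eq_abs, Real.norm_eq_abs]
  exact mul_le_mul_of_nonneg_right (hx.trans (le_abs_self L)) (abs_nonneg _)

end IsSolitonProfile

end

noncomputable section

/-! ### The energy gradient in the moving frame -/

theorem contDiff_toC {N : ℕ} {g : Space N → ℝ} {n : WithTop ℕ∞} (hg : ContDiff ℝ n g) :
    ContDiff ℝ n (toC g) := Complex.ofRealCLM.contDiff.comp hg

theorem Nice.memLp_partialDeriv_toC {N : ℕ} {g : Space N → ℝ} (hg : Nice g) (i : Fin N) :
    MemLp (partialDeriv i (toC g)) 2 volume := by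
  have : partialDeriv i (toC g) = fun x => (pd i g x : ℂ) := by
    funext x; exact partialDeriv_ofReal hg.contDiff i x
  rw [this]
  exact memLp_toC (hg.memLp_pd i)

theorem Nice.memH1_toC {N : ℕ} {g : Space N → ℝ} (hg : Nice g) : MemH1 (toC g) :=
  memH1_of_contDiff (contDiff_toC hg.contDiff) (memLp_toC hg.memLp) hg.memLp_partialDeriv_toC

theorem Nice.weakPartial_toC {N : ℕ} {g : Space N → ℝ} (hg : Nice g) (i : Fin N) :
    weakPartial i (toC g) =ᵐ[volume] fun x => (pd i g x : ℂ) := by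
  refine (weakPartial_of_contDiff (contDiff_toC hg.contDiff) (hg.memLp_partialDeriv_toC i)).trans ?_
  exact Filter.Eventually.of_forall fun x => partialDeriv_ofReal hg.contDiff i x

/-- The pairing of `-Δu + u - |u|^{2s} u` with a real function. -/
def staticPair {N : ℕ} (s : ℝ) (u : Space N → ℂ) (g : Space N → ℝ) : ℂ :=
  gradPair u g + pair u g - pair (fun y => powNL s (u y)) g

/-- The pairing of the perturbation `λ |u|^{2p} u` with a real function. -/
def pertPair {N : ℕ} (p : ℝ) (l : Space N → ℝ) (u : Space N → ℂ) (g : Space N → ℝ) : ℂ :=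
  ∫ y, (l y : ℂ) * powNL p (u y) * (g y : ℂ)

/-- The potential in the moving frame. -/
def frameLam {N : ℕ} (lam : Space N → ℝ) (σ : Param N) (y : Space N) : ℝ :=
  lam ((Real.sqrt σ.μ)⁻¹ • y + σ.a)

theorem integral_trans_mul_conj_toC {N : ℕ} {s : ℝ} (hs : 0 < s) {σ : Param N} (hμ : 0 < σ.μ)
    (u : Space N → ℂ) (g : Space N → ℝ) :
    ∫ x, trans s σ u x * conj (trans s σ (toC g) x) = massFactor N s σ.μ * pair u g := by
  rw [integral_trans_mul_conj hs hμ, pair]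
  simp [toC]

theorem integral_comb4 {N : ℕ} {f₁ f₂ f₃ f₄ : Space N → ℂ} (h₁ : Integrable f₁)
    (h₂ : Integrable f₂) (h₃ : Integrable f₃) (h₄ : Integrable f₄) (c₁ c₂ c₃ c₄ : ℂ) :
    ∫ y, (c₁ * f₁ y - c₂ * f₂ y + c₃ * f₃ y + c₄ * f₄ y) =
      c₁ * (∫ y, f₁ y) - c₂ * (∫ y, f₂ y) + c₃ * (∫ y, f₃ y) + c₄ * ∫ y, f₄ y := by
  have k : Integrable (fun y => c₁ * f₁ y - c₂ * f₂ y) := (h₁.const_mul c₁).sub (h₂.const_mul c₂)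
  have k' : Integrable (fun y => c₁ * f₁ y - c₂ * f₂ y + c₃ * f₃ y) := k.add (h₃.const_mul c₃)
  rw [integral_add k' (h₄.const_mul c₄), integral_add k (h₃.const_mul c₃),
    integral_sub (h₁.const_mul c₁) (h₂.const_mul c₂)]
  simp only [integral_const_mul]

/-- Of the two mixed terms, the one with the derivative on `u` is integrated by parts; it then
equals the other, and together they form the transport term. -/
theorem integral_weakPartial_trans {N : ℕ} {s : ℝ} (hs : 0 < s) {σ : Param N} (hμ : 0 < σ.μ)
    {u : Space N → ℂ} (hu : MemH1 u) {g : Space N → ℝ} (hg : Nice g) (i : Fin N) :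
    ∫ x, weakPartial i (trans s σ u) x * conj (weakPartial i (trans s σ (toC g)) x) =
      massFactor N s σ.μ * (σ.μ * pair (weakPartial i u) (pd i g)
        + Complex.I * (Real.sqrt σ.μ * σ.v i) * pair u (pd i g)
        + (σ.v i ^ 2 / 4 : ℝ) * pair u g) := by
  have e1 := hu.weakPartial_trans (s := s) hμ i
  have e2 := hg.memH1_toC.weakPartial_trans (s := s) hμ i
  rw [show ∫ x, weakPartial i (trans s σ u) x * conj (weakPartial i (trans s σ (toC g)) x) = _ from
    integral_congr_ae (e1.mul (e2.fun_comp conj))]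
  simp only [Pi.mul_apply, Function.comp_def]
  rw [integral_trans_mul_conj hs hμ]
  congr 1
  have e3 := hg.weakPartial_toC i
  have sq : (Real.sqrt σ.μ : ℂ) * (Real.sqrt σ.μ : ℂ) = σ.μ := by
    exact_mod_cast Real.mul_self_sqrt hμ.le
  have j1 := integrable_pair (hu.memLp_weakPartial i) (hg.memLp_pd i)
  have j2 := integrable_pair (hu.memLp_weakPartial i) hg.memLp
  have j3 := integrable_pair hu.1 (hg.memLp_pd i)
  have j4 := integrable_pair hu.1 hg.memLp
  have : ∫ y, ((Real.sqrt σ.μ : ℂ) * weakPartial i u y + Complex.I * ((σ.v i / 2 : ℝ) : ℂ) * u y) *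
      conj ((Real.sqrt σ.μ : ℂ) * weakPartial i (toC g) y +
        Complex.I * ((σ.v i / 2 : ℝ) : ℂ) * toC g y) =
      ∫ y, ((((σ.μ : ℂ) * (weakPartial i u y * (pd i g y : ℂ))
        - (Complex.I * (Real.sqrt σ.μ * (σ.v i / 2 : ℝ))) * (weakPartial i u y * (g y : ℂ)))
        + (Complex.I * (Real.sqrt σ.μ * (σ.v i / 2 : ℝ))) * (u y * (pd i g y : ℂ)))
        + ((σ.v i ^ 2 / 4 : ℝ) : ℂ) * (u y * (g y : ℂ))) := by
    refine integral_congr_ae ?_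
    filter_upwards [e3] with y hy
    rw [hy]
    simp only [map_add, map_mul, Complex.conj_ofReal, Complex.conj_I, toC]
    rw [← sq]
    push_cast
    linear_combination (σ.v i ^ 2 / 4 * u y * g y : ℂ) * (-1 : ℂ) * Complex.I_mul_I
  rw [this, integral_comb4 j1 j2 j3 j4]
  have h := pair_weakPartial hu hg i
  simp only [pair] at h ⊢
  rw [h]
  push_cast
  ring

/-- Galilei and scaling covariance of the energy gradient. The terms in `v` are those that the free
motion of the parameters will cancel. -/
theorem energyGradPairing_trans {N : ℕ} {s : ℝ} (hs : 0 < s) (st : ℝ) (lam : Space N → ℝ) (ε : ℝ)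
    {σ : Param N} (hμ : 0 < σ.μ) {u : Space N → ℂ} (hu : MemH1 u) {g : Space N → ℝ}
    (hg : Nice g) :
    energyGradPairing s st lam ε (trans s σ u) (trans s σ (toC g)) =
      massFactor N s σ.μ * (σ.μ * (gradPair u g - pair (fun y => powNL s (u y)) g)
        + Complex.I * Real.sqrt σ.μ * ∑ i, σ.v i * pair u (pd i g)
        + (‖σ.v‖ ^ 2 / 4 : ℝ) * pair u g
        + (ε * σ.μ ^ (st / s) : ℝ) * pertPair st (frameLam lam σ) u g) := by
  have h1 : ∫ x, powNL s (trans s σ u x) * conj (trans s σ (toC g) x) =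
      massFactor N s σ.μ * (σ.μ * pair (fun y => powNL s (u y)) g) := by
    simp only [powNL_trans hs s hμ, mul_assoc]
    rw [integral_const_mul, integral_trans_mul_conj_toC hs hμ, div_self hs.ne', Real.rpow_one]
    ring
  have h2 : ∫ x, (lam x : ℂ) * powNL st (trans s σ u x) * conj (trans s σ (toC g) x) =
      massFactor N s σ.μ * ((σ.μ ^ (st / s) : ℝ) * pertPair st (frameLam lam σ) u g) := by
    have : ∀ x, (lam x : ℂ) * powNL st (trans s σ u x) * conj (trans s σ (toC g) x) =
        ((σ.μ ^ (st / s) : ℝ) : ℂ) * (trans s σ (fun y => (frameLam lam σ y : ℂ) * powNL st (u y)) x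
          * conj (trans s σ (toC g) x)) := fun x => by
      rw [powNL_trans hs st hμ, trans_apply_eq s hμ (fun y => powNL st (u y)),
        trans_apply_eq s hμ (fun y => (frameLam lam σ y : ℂ) * powNL st (u y)), frameLam,
        inv_smul_add_eq hμ]
      ring
    simp only [this]
    rw [integral_const_mul, integral_trans_mul_conj_toC hs hμ]
    simp only [pair, pertPair]
    ring
  rw [energyGradPairing, h1, h2, Finset.sum_congr rfl fun i _ =>
    integral_weakPartial_trans hs hμ hu hg i, ← Finset.mul_sum, Finset.sum_add_distrib,
    Finset.sum_add_distrib, ← Finset.mul_sum, ← Finset.sum_mul, gradPair]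
  have e1 : ∑ i, Complex.I * (Real.sqrt σ.μ * σ.v i : ℂ) * pair u (pd i g) =
      Complex.I * Real.sqrt σ.μ * ∑ i, (σ.v i : ℂ) * pair u (pd i g) := by
    rw [Finset.mul_sum]; exact Finset.sum_congr rfl fun i _ => by ring
  have e2 : ∑ i, ((σ.v i ^ 2 / 4 : ℝ) : ℂ) = ((‖σ.v‖ ^ 2 / 4 : ℝ) : ℂ) := by
    rw [EuclideanSpace.real_norm_sq_eq, Finset.sum_div]; push_cast; rfl
  rw [e1, e2]
  push_cast
  ring

end

noncomputable section

/-! ### Dependence of moving profiles on the parameters -/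

/-- A square integrable weight. -/
def weight {N : ℕ} (x : Space N) : ℝ := ((1 + ‖x‖) ^ (N + 1))⁻¹

theorem weight_pos {N : ℕ} (x : Space N) : 0 < weight x := by unfold weight; positivity

theorem memLp_weight {N : ℕ} : MemLp (weight : Space N → ℝ) 2 volume := by
  have hc : Continuous (weight : Space N → ℝ) := by
    unfold weight
    exact Continuous.inv₀ (by fun_prop) fun x => by positivity
  rw [memLp_two_iff_integrable_sq hc.aestronglyMeasurable]
  have := integrable_one_add_norm (E := Space N) (μ := volume) (r := ((2 * (N + 1) : ℕ) : ℝ))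
    (by rw [finrank_euclideanSpace, Fintype.card_fin]; push_cast; linarith)
  refine this.congr (Filter.Eventually.of_forall fun x => ?_)
  simp only [weight]
  rw [Real.rpow_neg (by positivity), Real.rpow_natCast, inv_pow, ← pow_mul, mul_comm 2]

/-- Decay is uniform over affine maps with scale bounded below and bounded shift, since `1 + |x|` is
then at most a multiple of `1 + |r x - b|`. -/
theorem Rapid.exists_affine_bound {N : ℕ} {g : Space N → ℝ} (hg : Rapid g) (k : ℕ) {r₀ : ℝ}
    (hr₀ : 0 < r₀) (B : ℝ) : ∃ C, 0 ≤ C ∧ ∀ r : ℝ, r₀ ≤ r → ∀ b : Space N, ‖b‖ ≤ B → ∀ x,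
      (1 + ‖x‖) ^ k * |g (r • x - b)| ≤ C := by
  obtain ⟨C, hC0, hC⟩ := hg k
  refine ⟨(1 + (|B| + 1) / r₀) ^ k * C, by positivity, fun r hr b hb x => ?_⟩
  set y := r • x - b with hy
  have h1 : r * ‖x‖ ≤ ‖y‖ + |B| := by
    have : r • x = y + b := by rw [hy, sub_add_cancel]
    rw [← Real.norm_of_nonneg (hr₀.le.trans hr), ← norm_smul, this]
    exact (norm_add_le _ _).trans (by gcongr; exact hb.trans (le_abs_self B))
  have h2 : ‖x‖ ≤ (‖y‖ + |B|) / r₀ := by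
    rw [le_div_iff₀ hr₀]
    nlinarith [norm_nonneg x]
  have h3 : 1 + ‖x‖ ≤ (1 + (|B| + 1) / r₀) * (1 + ‖y‖) := by
    have : (1 + (|B| + 1) / r₀) * (1 + ‖y‖) =
      1 + (‖y‖ + |B|) / r₀ + (‖y‖ + 1 / r₀ + |B| / r₀ * ‖y‖) := by field_simp; ring
    rw [this]
    have : 0 ≤ ‖y‖ + 1 / r₀ + |B| / r₀ * ‖y‖ := by positivity
    linarith
  calc (1 + ‖x‖) ^ k * |g y| ≤ ((1 + (|B| + 1) / r₀) * (1 + ‖y‖)) ^ k * |g y| := by gcongr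
    _ = (1 + (|B| + 1) / r₀) ^ k * ((1 + ‖y‖) ^ k * |g y|) := by rw [mul_pow]; ring
    _ ≤ _ := by gcongr; exact hC y

/-- A modulated, rescaled and translated profile. -/
def wave {N : ℕ} (g : Space N → ℝ) (p : Space N) (q m r : ℝ) (b x : Space N) : ℂ :=
  Complex.exp (Complex.I * ((inner ℝ p x + q : ℝ) : ℂ)) * (m : ℂ) * (g (r • x - b) : ℂ)

/-- In these parameters the argument `r x - b` and the phase are affine, so the parameter domain is
convex and a mean value estimate applies. -/
theorem trans_toC_eq_wave {N : ℕ} (s : ℝ) (σ : Param N) (g : Space N → ℝ) :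
    trans s σ (toC g) = wave g ((1 / 2 : ℝ) • σ.v) (σ.γ - 1 / 2 * inner ℝ σ.v σ.a)
      (σ.μ ^ (1 / (2 * s))) (Real.sqrt σ.μ) (Real.sqrt σ.μ • σ.a) := by
  funext x
  rw [trans, wave, toC, smul_sub, inner_smul_left, inner_sub_right]
  congr 5
  simp
  ring

theorem norm_exp_I_sub_le (a b : ℝ) :
    ‖Complex.exp (Complex.I * (b : ℂ)) - Complex.exp (Complex.I * (a : ℂ))‖ ≤ |b - a| := by
  have : Complex.exp (Complex.I * (b : ℂ)) - Complex.exp (Complex.I * (a : ℂ)) =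
      Complex.exp (Complex.I * (a : ℂ)) * (Complex.exp (Complex.I * ((b - a : ℝ) : ℂ)) - 1) := by
    rw [mul_sub, ← Complex.exp_add]; congr 2
    · push_cast; ring
    · ring
  rw [this, norm_mul, mul_comm Complex.I, Complex.norm_exp_ofReal_mul_I, one_mul]
  exact Real.norm_exp_I_mul_ofReal_sub_one_le

theorem fderiv_apply_eq_sum_pd {N : ℕ} (g : Space N → ℝ) (y z : Space N) :
    fderiv ℝ g y z = ∑ i, z i * pd i g y := by
  have hz : z = ∑ i, z i • (basisVec i : Space N) := by
    have := ((EuclideanSpace.basisFun (Fin N) ℝ).sum_repr z).symm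
    simpa [basisVec] using this
  conv_lhs => rw [hz]
  rw [map_sum]
  simp [pd]

theorem norm_fderiv_le_sum_pd {N : ℕ} (g : Space N → ℝ) (y : Space N) :
    ‖fderiv ℝ g y‖ ≤ ∑ i, |pd i g y| := by
  refine ContinuousLinearMap.opNorm_le_bound _ (Finset.sum_nonneg fun i _ => abs_nonneg _)
    fun z => ?_
  rw [fderiv_apply_eq_sum_pd, Finset.sum_mul]
  refine (norm_sum_le _ _).trans (Finset.sum_le_sum fun i _ => ?_)
  rw [Real.norm_eq_abs, abs_mul, mul_comm]
  gcongr
  exact abs_coord_le z i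

/-- Varying the phase or the scale costs a factor `1 + |x|`. Decay of order `N + 2` pays for it and
leaves the square integrable `weight`. -/
theorem Nice.exists_wave_sub_le {N : ℕ} {g : Space N → ℝ} (hg : Nice g) {r₀ : ℝ} (hr₀ : 0 < r₀)
    (B M : ℝ) : ∃ C, 0 ≤ C ∧ ∀ (p p' : Space N) (q q' m m' r r' : ℝ) (b b' : Space N),
      r₀ ≤ r → r₀ ≤ r' → ‖b‖ ≤ B → ‖b'‖ ≤ B → |m| ≤ M → |m'| ≤ M → ∀ x,
      ‖wave g p' q' m' r' b' x - wave g p q m r b x‖ ≤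
        C * (‖p' - p‖ + |q' - q| + |m' - m| + |r' - r| + ‖b' - b‖) * weight x := by
  obtain ⟨C, hC0, hC⟩ := hg.rapid.exists_affine_bound (N + 2) hr₀ B
  choose D hD0 hD using fun i => (hg.rapid_pd i).exists_affine_bound (N + 2) hr₀ B
  refine ⟨|M| * C + C + |M| * ∑ i, D i, by
    have := Finset.sum_nonneg fun i (_ : i ∈ Finset.univ) => hD0 i
    positivity, fun p p' q q' m m' r r' b b' hr hr' hb hb' hm hm' x => ?_⟩
  have hm := hm.trans (le_abs_self M)
  have hm' := hm'.trans (le_abs_self M)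
  have S0 := Finset.sum_nonneg fun i (_ : i ∈ Finset.univ) => hD0 i
  have hw := weight_pos x
  have conv : ∀ {c K : ℝ}, (1 + ‖x‖) ^ (N + 2) * c ≤ K → (1 + ‖x‖) * c ≤ K * weight x :=
    fun {c K} h => by
      rw [weight, ← div_eq_mul_inv, le_div_iff₀ (by positivity)]
      calc (1 + ‖x‖) * c * (1 + ‖x‖) ^ (N + 1) = (1 + ‖x‖) ^ (N + 2) * c := by ring
        _ ≤ K := h
  have b1 : (1 + ‖x‖) * |g (r' • x - b')| ≤ C * weight x := conv (hC r' hr' b' hb' x)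
  have b2 : |g (r' • x - b')| ≤ C * weight x :=
    le_trans (by nlinarith [norm_nonneg x, abs_nonneg (g (r' • x - b'))]) b1
  have b3 : |g (r' • x - b') - g (r • x - b)| ≤
      (∑ i, D i) * weight x * (|r' - r| + ‖b' - b‖) := by
    -- Points of the segment are again of the form `r'' x - b''` with admissible scale and shift, so
    -- the uniform decay applies along it.
    have hfd : ∀ z ∈ segment ℝ (r • x - b) (r' • x - b'),
        ‖fderiv ℝ g z‖ ≤ (∑ i, D i) * weight x / (1 + ‖x‖) := by
      rintro z ⟨α, β, hα, hβ, hαβ, rfl⟩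
      have e : α • (r • x - b) + β • (r' • x - b') =
          (α * r + β * r') • x - (α • b + β • b') := by module
      rw [e]
      refine (norm_fderiv_le_sum_pd _ _).trans ?_
      rw [Finset.sum_mul, Finset.sum_div]
      refine Finset.sum_le_sum fun i _ => ?_
      rw [le_div_iff₀ (by positivity), mul_comm]
      refine conv (hD i _ ?_ _ ?_ x)
      · calc r₀ = α * r₀ + β * r₀ := by rw [← add_mul, hαβ, one_mul]
          _ ≤ _ := by gcongr
      · calc ‖α • b + β • b'‖ ≤ α * B + β * B := by
              refine (norm_add_le _ _).trans ?_
              rw [norm_smul, norm_smul, Real.norm_of_nonneg hα, Real.norm_of_nonneg hβ]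
              gcongr
          _ = B := by rw [← add_mul, hαβ, one_mul]
    have h := Convex.norm_image_sub_le_of_norm_fderiv_le (𝕜 := ℝ)
      (fun z _ => hg.contDiff.differentiable (by simp) z) hfd (convex_segment _ _)
      (left_mem_segment ℝ (r • x - b) (r' • x - b')) (right_mem_segment ℝ _ _)
    rw [← Real.norm_eq_abs]
    refine h.trans ?_
    have e : (r' • x - b') - (r • x - b) = (r' - r) • x - (b' - b) := by module
    have : ‖(r' • x - b') - (r • x - b)‖ ≤ (|r' - r| + ‖b' - b‖) * (1 + ‖x‖) := by
      rw [e]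
      refine (norm_sub_le _ _).trans ?_
      rw [norm_smul, Real.norm_eq_abs]
      nlinarith [norm_nonneg x, norm_nonneg (b' - b), abs_nonneg (r' - r)]
    calc _ ≤ (∑ i, D i) * weight x / (1 + ‖x‖) * ((|r' - r| + ‖b' - b‖) * (1 + ‖x‖)) := by
          gcongr
      _ = _ := by field_simp
  set θ := inner ℝ p x + q
  set θ' := inner ℝ p' x + q'
  have bθ : |θ' - θ| ≤ (‖p' - p‖ + |q' - q|) * (1 + ‖x‖) := by
    have : θ' - θ = inner ℝ (p' - p) x + (q' - q) := by
      simp only [θ, θ', inner_sub_left]; ring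
    rw [this]
    refine (abs_add_le _ _).trans ?_
    have := abs_real_inner_le_norm (p' - p) x
    nlinarith [norm_nonneg x, norm_nonneg (p' - p), abs_nonneg (q' - q)]
  have bθ' : ‖Complex.exp (Complex.I * (θ' : ℂ)) - Complex.exp (Complex.I * (θ : ℂ))‖ *
      |g (r' • x - b')| ≤ (‖p' - p‖ + |q' - q|) * (C * weight x) := by
    calc _ ≤ (‖p' - p‖ + |q' - q|) * (1 + ‖x‖) * |g (r' • x - b')| := by
          gcongr
          exact (norm_exp_I_sub_le _ _).trans bθ
      _ = (‖p' - p‖ + |q' - q|) * ((1 + ‖x‖) * |g (r' • x - b')|) := by ring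
      _ ≤ _ := by gcongr
  have e : wave g p' q' m' r' b' x - wave g p q m r b x =
      (m' : ℂ) * ((Complex.exp (Complex.I * (θ' : ℂ)) - Complex.exp (Complex.I * (θ : ℂ))) *
        (g (r' • x - b') : ℂ)) +
      Complex.exp (Complex.I * (θ : ℂ)) * (((m' - m : ℝ) : ℂ) * (g (r' • x - b') : ℂ)) +
      Complex.exp (Complex.I * (θ : ℂ)) * ((m : ℂ) *
        ((g (r' • x - b') - g (r • x - b) : ℝ) : ℂ)) := by
    change Complex.exp (Complex.I * (θ' : ℂ)) * (m' : ℂ) * (g (r' • x - b') : ℂ) -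
      Complex.exp (Complex.I * (θ : ℂ)) * (m : ℂ) * (g (r • x - b) : ℂ) = _
    push_cast
    ring
  rw [e]
  refine norm_add₃_le.trans ?_
  simp only [norm_mul, mul_comm Complex.I, Complex.norm_exp_ofReal_mul_I, one_mul,
    Complex.norm_real, Real.norm_eq_abs]
  simp only [mul_comm Complex.I] at bθ'
  calc _ ≤ |M| * ((‖p' - p‖ + |q' - q|) * (C * weight x)) + |m' - m| * (C * weight x) +
        |M| * ((∑ i, D i) * weight x * (|r' - r| + ‖b' - b‖)) := by gcongr
    _ = ((‖p' - p‖ + |q' - q|) * (|M| * C) + |m' - m| * C +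
        (|r' - r| + ‖b' - b‖) * (|M| * ∑ i, D i)) * weight x := by ring
    _ ≤ _ := by
      gcongr
      have := norm_nonneg (p' - p)
      have := abs_nonneg (q' - q)
      have := abs_nonneg (m' - m)
      have := abs_nonneg (r' - r)
      have := norm_nonneg (b' - b)
      have := abs_nonneg M
      nlinarith [mul_nonneg this hC0, mul_nonneg this S0, mul_nonneg (abs_nonneg (m' - m)) (mul_nonneg this hC0),
        mul_nonneg (abs_nonneg (m' - m)) (mul_nonneg this S0),
        mul_nonneg (add_nonneg (norm_nonneg (p' - p)) (abs_nonneg (q' - q))) hC0,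
        mul_nonneg (add_nonneg (norm_nonneg (p' - p)) (abs_nonneg (q' - q))) (mul_nonneg this S0),
        mul_nonneg (add_nonneg (abs_nonneg (r' - r)) (norm_nonneg (b' - b))) hC0,
        mul_nonneg (add_nonneg (abs_nonneg (r' - r)) (norm_nonneg (b' - b))) (mul_nonneg this hC0)]

/-- Moving profiles are Lipschitz in time at every point, uniformly with respect to a square
integrable weight. -/
theorem Nice.exists_trans_sub_le {N : ℕ} {g : Space N → ℝ} (hg : Nice g) (s : ℝ) {S : Set ℝ}
    {t₀ : ℝ} {σ : ℝ → Param N} (hμ : 0 < (σ t₀).μ)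
    (ha : DifferentiableWithinAt ℝ (fun t => (σ t).a) S t₀)
    (hv : DifferentiableWithinAt ℝ (fun t => (σ t).v) S t₀)
    (hγ : DifferentiableWithinAt ℝ (fun t => (σ t).γ) S t₀)
    (hm : DifferentiableWithinAt ℝ (fun t => (σ t).μ) S t₀) :
    ∃ C, 0 ≤ C ∧ ∀ᶠ t in nhdsWithin t₀ S, ∀ x,
      ‖trans s (σ t) (toC g) x - trans s (σ t₀) (toC g) x‖ ≤ C * |t - t₀| * weight x := by
  have dp := hv.const_smul (1 / 2 : ℝ)
  have dq := hγ.sub ((hv.inner ℝ ha).const_mul (1 / 2))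
  have dm := hm.rpow_const (p := 1 / (2 * s)) (Or.inl hμ.ne')
  have dr := hm.sqrt hμ.ne'
  have db := dr.smul ha
  have hr0 : 0 < Real.sqrt (σ t₀).μ := Real.sqrt_pos.2 hμ
  -- Half the scale at `t₀`, and shift and amplitude bounds enlarged by `1`, remain valid for nearby
  -- times by continuity.
  obtain ⟨C, hC0, hC⟩ := hg.exists_wave_sub_le (half_pos hr0)
    (‖Real.sqrt (σ t₀).μ • (σ t₀).a‖ + 1) (|(σ t₀).μ ^ (1 / (2 * s))| + 1)
  obtain ⟨L₁, h₁⟩ := dp.isBigO_sub.bound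
  obtain ⟨L₂, h₂⟩ := dq.isBigO_sub.bound
  obtain ⟨L₃, h₃⟩ := dm.isBigO_sub.bound
  obtain ⟨L₄, h₄⟩ := dr.isBigO_sub.bound
  obtain ⟨L₅, h₅⟩ := db.isBigO_sub.bound
  have c₃ := dm.continuousWithinAt.abs.tendsto.eventually_lt_const (lt_add_one _)
  have c₄ := dr.continuousWithinAt.tendsto.eventually_const_lt (half_lt_self hr0)
  have c₅ := db.continuousWithinAt.norm.tendsto.eventually_lt_const (lt_add_one _)
  refine ⟨C * (|L₁| + |L₂| + |L₃| + |L₄| + |L₅|), by positivity, ?_⟩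
  filter_upwards [h₁, h₂, h₃, h₄, h₅, c₃, c₄, c₅] with t h₁ h₂ h₃ h₄ h₅ c₃ c₄ c₅ x
  rw [trans_toC_eq_wave, trans_toC_eq_wave]
  refine (hC _ _ _ _ _ _ _ _ _ _ (half_le_self hr0.le) c₄.le (by linarith) c₅.le (by linarith)
    c₃.le x).trans ?_
  have hw := weight_pos x
  have up : ∀ {A L : ℝ}, A ≤ L * |t - t₀| → A ≤ |L| * |t - t₀| := fun {A L} h =>
    h.trans (mul_le_mul_of_nonneg_right (le_abs_self L) (abs_nonneg _))
  rw [mul_assoc C (|L₁| + |L₂| + |L₃| + |L₄| + |L₅|)]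
  refine mul_le_mul_of_nonneg_right (mul_le_mul_of_nonneg_left ?_ hC0) hw.le
  simp only [add_mul]
  exact add_le_add (add_le_add (add_le_add (add_le_add (up h₁) (up h₂)) (up h₃)) (up h₄)) (up h₅)

end

noncomputable section

/-! ### Time derivatives of pairings with moving profiles -/

/-- The real part of the Lie algebra action on a real function. -/
def actRe {N : ℕ} (s : ℝ) (X : LieAlg N) (g : Space N → ℝ) (y : Space N) : ℝ :=
  -(∑ i, X (.inl i) * pd i g y) + X (.inr (.inr 1)) * scaling s g y

/-- The imaginary part of the Lie algebra action on a real function. -/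
def actIm {N : ℕ} (X : LieAlg N) (g : Space N → ℝ) (y : Space N) : ℝ :=
  (∑ i, X (.inr (.inl i)) * (y i * g y)) + X (.inr (.inr 0)) * g y

theorem toC_apply {N : ℕ} (g : Space N → ℝ) (x : Space N) : toC g x = (g x : ℂ) := rfl

theorem gen_scaling_toC {N : ℕ} (s : ℝ) {g : Space N → ℝ} (hg : ContDiff ℝ 1 g) :
    gen s (.inr (.inr 1)) (toC g) = toC (scaling s g) := by
  funext y
  have h : ∀ i, partialDeriv i (toC g) y = (pd i g y : ℂ) := fun i =>
    partialDeriv_ofReal hg i y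
  simp only [gen, toC_apply, scaling, h]
  push_cast
  ring

theorem gen_translation_toC {N : ℕ} (s : ℝ) {g : Space N → ℝ} (hg : ContDiff ℝ 1 g) (i : Fin N) :
    gen s (.inl i) (toC g) = toC (fun y => -pd i g y) := by
  funext y
  have h : partialDeriv i (toC g) y = (pd i g y : ℂ) := partialDeriv_ofReal hg i y
  simp only [gen, h, toC_apply]
  push_cast
  rfl

theorem act_toC {N : ℕ} (s : ℝ) (X : LieAlg N) {g : Space N → ℝ} (hg : ContDiff ℝ 1 g)
    (y : Space N) :
    act s X (toC g) y = (actRe s X g y : ℂ) + Complex.I * (actIm X g y : ℂ) := by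
  rw [act, Fintype.sum_sum_type, Fintype.sum_sum_type, Fin.sum_univ_two, gen_scaling_toC s hg]
  have e1 : ∑ i, (X (.inl i) : ℂ) * gen s (.inl i) (toC g) y =
      -∑ i, (X (.inl i) : ℂ) * (pd i g y : ℂ) := by
    rw [← Finset.sum_neg_distrib]
    refine Finset.sum_congr rfl fun i _ => ?_
    rw [gen_translation_toC s hg, toC_apply]
    push_cast
    ring
  have e2 : ∑ i, (X (.inr (.inl i)) : ℂ) * gen s (.inr (.inl i)) (toC g) y =
      Complex.I * ∑ i, (X (.inr (.inl i)) : ℂ) * ((y i : ℂ) * (g y : ℂ)) := by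
    rw [Finset.mul_sum]
    refine Finset.sum_congr rfl fun i _ => ?_
    simp only [gen, toC_apply]
    ring
  rw [e1, e2]
  simp only [actRe, actIm, gen, toC_apply]
  push_cast
  ring

theorem pair_actRe {N : ℕ} (s : ℝ) (X : LieAlg N) {u : Space N → ℂ} (hu : MemLp u 2 volume)
    {g : Space N → ℝ} (hg : ∀ i, MemLp (pd i g) 2 volume) (hΛ : MemLp (scaling s g) 2 volume) :
    pair u (actRe s X g) = -(∑ i, (X (.inl i) : ℂ) * pair u (pd i g)) +
      X (.inr (.inr 1)) * pair u (scaling s g) := by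
  have h1 : actRe s X g = fun y => (-1) * (∑ i, X (.inl i) * pd i g y) +
      X (.inr (.inr 1)) * scaling s g y := by funext y; rw [actRe, neg_one_mul]
  have m1 : ∀ i ∈ Finset.univ, MemLp (fun y => X (.inl i) * pd i g y) 2 volume :=
    fun i _ => (hg i).const_mul _
  have m2 : MemLp (fun y => ∑ i, X (.inl i) * pd i g y) 2 volume := by
    simpa using memLp_finsetSum _ m1
  rw [h1, pair_add hu (m2.const_mul _) (hΛ.const_mul _), pair_const_mul, pair_sum _ hu m1,
    pair_const_mul]
  simp only [pair_const_mul]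
  push_cast
  ring

theorem pair_actIm {N : ℕ} (X : LieAlg N) {u : Space N → ℂ} (hu : MemLp u 2 volume)
    {g : Space N → ℝ} (hg : MemLp g 2 volume) (hx : ∀ i, MemLp (fun y => y i * g y) 2 volume) :
    pair u (actIm X g) = (∑ i, (X (.inr (.inl i)) : ℂ) * pair u (fun y => y i * g y)) +
      X (.inr (.inr 0)) * pair u g := by
  have m1 : ∀ i ∈ Finset.univ, MemLp (fun y => X (.inr (.inl i)) * (y i * g y)) 2 volume :=
    fun i _ => (hx i).const_mul _
  have m2 : MemLp (fun y => ∑ i, X (.inr (.inl i)) * (y i * g y)) 2 volume := by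
    simpa using memLp_finsetSum _ m1
  have h1 : actIm X g = fun y => (∑ i, X (.inr (.inl i)) * (y i * g y)) +
      X (.inr (.inr 0)) * g y := rfl
  rw [h1, pair_add hu m2 (hg.const_mul _), pair_sum _ hu m1]
  simp only [pair_const_mul]

/-- The pointwise form of `∂_t T_σ = T_σ X(σ)`: the chain rule, regrouped by generators at the point
`y = √μ (x - a)`. -/
theorem hasDerivWithinAt_trans_toC {N : ℕ} {s : ℝ} {g : Space N → ℝ} (hg : ContDiff ℝ 1 g)
    {S : Set ℝ} {t₀ : ℝ} {σ : ℝ → Param N} (hμ : 0 < (σ t₀).μ) {a' v' : Space N} {γ' μ' : ℝ}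
    (ha : HasDerivWithinAt (fun t => (σ t).a) a' S t₀)
    (hv : HasDerivWithinAt (fun t => (σ t).v) v' S t₀)
    (hγ : HasDerivWithinAt (fun t => (σ t).γ) γ' S t₀)
    (hm : HasDerivWithinAt (fun t => (σ t).μ) μ' S t₀) (x : Space N) :
    HasDerivWithinAt (fun t => trans s (σ t) (toC g) x)
      (trans s (σ t₀) (act s (coeffs (fun i => a' i * Real.sqrt (σ t₀).μ)
        (fun i => v' i / (2 * Real.sqrt (σ t₀).μ)) (γ' - inner ℝ a' (σ t₀).v / 2)
        (μ' / (σ t₀).μ)) (toC g)) x) S t₀ := by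
  have hr0 : 0 < Real.sqrt (σ t₀).μ := Real.sqrt_pos.2 hμ
  have dx : HasDerivWithinAt (fun t => x - (σ t).a) (-a') S t₀ := by
    simpa using ha.const_sub x
  have dθ := ((hv.inner ℝ dx).const_mul (1 / 2 : ℝ)).add hγ
  have dE := (dθ.ofReal_comp.const_mul Complex.I).cexp
  have dM := (hm.rpow_const (p := 1 / (2 * s)) (Or.inl hμ.ne')).ofReal_comp
  have dY := (hm.sqrt hμ.ne').smul dx
  have dg := ((hg.differentiable (by simp)
    (Real.sqrt (σ t₀).μ • (x - (σ t₀).a))).hasFDerivAt.comp_hasDerivWithinAt t₀ dY).ofReal_comp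
  have d := (dE.mul dM).mul dg
  refine d.congr_deriv ?_
  rw [trans, act_toC s _ hg, fderiv_apply_eq_sum_pd]
  set y := Real.sqrt (σ t₀).μ • (x - (σ t₀).a) with hy
  have M1 : (σ t₀).μ ^ (1 / (2 * s) - 1) = (σ t₀).μ ^ (1 / (2 * s)) / (σ t₀).μ := by
    rw [Real.rpow_sub hμ, Real.rpow_one]
  have sq : Real.sqrt (σ t₀).μ * Real.sqrt (σ t₀).μ = (σ t₀).μ := Real.mul_self_sqrt hμ.le
  have e0 : μ' / (2 * Real.sqrt (σ t₀).μ) = 1 / 2 * (μ' / (σ t₀).μ) * Real.sqrt (σ t₀).μ := by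
    rw [div_eq_iff (by positivity)]
    have : 1 / 2 * (μ' / (σ t₀).μ) * Real.sqrt (σ t₀).μ * (2 * Real.sqrt (σ t₀).μ) =
      μ' / (σ t₀).μ * (Real.sqrt (σ t₀).μ * Real.sqrt (σ t₀).μ) := by ring
    rw [this, sq, div_mul_cancel₀ _ hμ.ne']
  have e1 : ∑ i, (Real.sqrt (σ t₀).μ • -a' + (μ' / (2 * Real.sqrt (σ t₀).μ)) •
      (x - (σ t₀).a)) i * pd i g y = -(∑ i, a' i * Real.sqrt (σ t₀).μ * pd i g y) +
        1 / 2 * (μ' / (σ t₀).μ) * ∑ i, y i * pd i g y := by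
    rw [← Finset.sum_neg_distrib, Finset.mul_sum, ← Finset.sum_add_distrib, e0]
    refine Finset.sum_congr rfl fun i _ => ?_
    have : y i = Real.sqrt (σ t₀).μ * (x i - (σ t₀).a i) := rfl
    rw [this]
    simp only [PiLp.add_apply, PiLp.smul_apply, PiLp.neg_apply, PiLp.sub_apply, smul_eq_mul]
    ring
  have e2 : inner ℝ v' (x - (σ t₀).a) =
      2 * ∑ i, v' i / (2 * Real.sqrt (σ t₀).μ) * y i := by
    rw [PiLp.inner_apply, Finset.mul_sum]
    refine Finset.sum_congr rfl fun i _ => ?_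
    have : y i = Real.sqrt (σ t₀).μ * (x i - (σ t₀).a i) := rfl
    rw [this]
    simp only [PiLp.sub_apply, RCLike.inner_apply, conj_trivial]
    field_simp
  have e3 : ∑ i, v' i / (2 * Real.sqrt (σ t₀).μ) * (y i * g y) =
      (∑ i, v' i / (2 * Real.sqrt (σ t₀).μ) * y i) * g y := by
    rw [Finset.sum_mul]; exact Finset.sum_congr rfl fun i _ => by ring
  have cI : ∀ (c d : ℝ), (![c, d] : Fin 2 → ℝ) 0 = c ∧ (![c, d] : Fin 2 → ℝ) 1 = d :=
    fun c d => ⟨rfl, rfl⟩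
  have e4 : (g ∘ ((fun y => Real.sqrt (σ y).μ) • fun t => x - (σ t).a)) t₀ = g y := rfl
  simp only [Pi.mul_apply, Pi.add_apply, e4, e1, e2, actRe, actIm, coeffs, Sum.elim_inl,
    Sum.elim_inr, M1, scaling, inner_neg_right, cI, e3, real_inner_comm a' (σ t₀).v]
  push_cast
  ring

/-- Product rule for the pairing of a weakly differentiable path with a path that is differentiable
pointwise with a square integrable difference quotient bound. -/
theorem hasDerivWithinAt_integral_mul_conj {N : ℕ} {S : Set ℝ} {t₀ : ℝ} (ht₀ : t₀ ∈ S)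
    {ψ G : ℝ → Space N → ℂ} {G' : Space N → ℂ} {D : ℂ} {H : Space N → ℝ} (hH : MemLp H 2 volume)
    (hψ : ∀ t ∈ S, MemLp (ψ t) 2 volume) (hG : ∀ t ∈ S, MemLp (G t) 2 volume)
    (hψc : Filter.Tendsto (fun t => l2 fun x => ψ t x - ψ t₀ x) (nhdsWithin t₀ S) (nhds 0))
    (hD : HasDerivWithinAt (fun t => ∫ x, ψ t x * conj (G t₀ x)) D S t₀)
    (hGd : ∀ x, HasDerivWithinAt (fun t => G t x) (G' x) S t₀)
    (hGH : ∀ᶠ t in nhdsWithin t₀ S, ∀ x, ‖G t x - G t₀ x‖ ≤ |t - t₀| * H x) :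
    HasDerivWithinAt (fun t => ∫ x, ψ t x * conj (G t x))
      (D + ∫ x, ψ t₀ x * conj (G' x)) S t₀ := by
  have hψ₀ := hψ t₀ ht₀
  have hG₀ := hG t₀ ht₀
  have hHC : MemLp (fun x => (H x : ℂ)) 2 volume := memLp_toC hH
  have hsub : nhdsWithin t₀ (S \ {t₀}) ≤ nhdsWithin t₀ S := nhdsWithin_mono _ sdiff_subset
  -- The product is split as `ψ(t) G(t₀) + ψ(t₀) (G(t) - G(t₀)) + (ψ(t) - ψ(t₀)) (G(t) - G(t₀))`.
  -- The first term is differentiable by hypothesis, the second by dominated convergence of slopes,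
  -- and the third is `o(1)` in `L²` times `O(|t - t₀|)`.
  have B : HasDerivWithinAt (fun t => ∫ x, ψ t₀ x * conj (G t x - G t₀ x))
      (∫ x, ψ t₀ x * conj (G' x)) S t₀ := by
    rw [hasDerivWithinAt_iff_tendsto_slope]
    have e : ∀ t, slope (fun t => ∫ x, ψ t₀ x * conj (G t x - G t₀ x)) t₀ t =
        ∫ x, ψ t₀ x * conj (slope (fun r => G r x) t₀ t) := fun t => by
      simp only [slope_def_module, sub_self, map_zero, mul_zero, integral_zero, sub_zero,
        Complex.real_smul, map_mul, Complex.conj_ofReal]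
      rw [← integral_const_mul]
      congr 1
      funext x
      ring
    refine Filter.Tendsto.congr (fun t => (e t).symm) ?_
    refine tendsto_integral_filter_of_dominated_convergence (fun x => ‖ψ t₀ x * (H x : ℂ)‖)
      ?_ ?_ (integrable_mul_of_memLp hψ₀ hHC).norm ?_
    · filter_upwards [self_mem_nhdsWithin] with t ht
      exact hψ₀.1.mul (Complex.continuous_conj.comp_aestronglyMeasurable
        (((hG t ht.1).1.sub hG₀.1).const_smul _))
    · filter_upwards [self_mem_nhdsWithin, hsub hGH] with t ht hb
      refine Filter.Eventually.of_forall fun x => ?_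
      have ht' : 0 < |t - t₀| := abs_pos.2 (sub_ne_zero.2 ht.2)
      rw [norm_mul, norm_mul, RCLike.norm_conj, slope_def_module, norm_smul, norm_inv,
        Real.norm_eq_abs, Complex.norm_real]
      gcongr
      rw [inv_mul_le_iff₀ ht']
      exact (hb x).trans (by gcongr; exact Real.le_norm_self _)
    · refine Filter.Eventually.of_forall fun x => ?_
      exact tendsto_const_nhds.mul ((Complex.continuous_conj.tendsto _).comp
        (hasDerivWithinAt_iff_tendsto_slope.1 (hGd x)))
  have E : HasDerivWithinAt
      (fun t => ∫ x, (ψ t x - ψ t₀ x) * conj (G t x - G t₀ x)) 0 S t₀ := by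
    rw [hasDerivWithinAt_iff_isLittleO]
    simp only [sub_self, zero_mul, integral_zero, sub_zero, smul_zero]
    rw [Asymptotics.isLittleO_iff]
    intro c hc
    have hc' : 0 < c / (l2 (fun x => (H x : ℂ)) + 1) := by
      have := l2_nonneg (fun x => (H x : ℂ)); positivity
    filter_upwards [self_mem_nhdsWithin, hGH, hψc.eventually_lt_const hc'] with t ht hb hl
    have m1 : MemLp (fun x => ψ t x - ψ t₀ x) 2 volume := (hψ t ht).sub hψ₀
    have m2 : MemLp (fun x => G t x - G t₀ x) 2 volume := (hG t ht).sub hG₀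
    have h1 := norm_integral_mul_conj_le m1 m2
    have h2 : l2 (fun x => G t x - G t₀ x) ≤ |t - t₀| * l2 (fun x => (H x : ℂ)) := by
      have := eLpNorm_le_mul_eLpNorm_of_ae_le_mul (p := 2) (μ := volume) (c := |t - t₀|)
        (f := fun x => G t x - G t₀ x) (g := fun x => (H x : ℂ))
        (Filter.Eventually.of_forall fun x => (hb x).trans
          (by rw [Complex.norm_real]; gcongr; exact Real.le_norm_self _))
      have h3 := ENNReal.toReal_mono
        (ENNReal.mul_ne_top ENNReal.ofReal_ne_top hHC.eLpNorm_ne_top) this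
      rwa [ENNReal.toReal_mul, ENNReal.toReal_ofReal (abs_nonneg _)] at h3
    have n1 := l2_nonneg (fun x => (H x : ℂ))
    calc _ ≤ _ := h1
      _ ≤ c / (l2 (fun x => (H x : ℂ)) + 1) * (|t - t₀| * l2 (fun x => (H x : ℂ))) := by
        gcongr
        exact l2_nonneg _
      _ = c * |t - t₀| * (l2 (fun x => (H x : ℂ)) / (l2 (fun x => (H x : ℂ)) + 1)) := by ring
      _ ≤ c * |t - t₀| * 1 := by
        gcongr
        rw [div_le_one (by positivity)]
        linarith
      _ = c * ‖t - t₀‖ := by rw [mul_one, Real.norm_eq_abs]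
  have K := (hD.add B).add E
  rw [add_zero] at K
  refine K.congr_of_eventuallyEq_of_mem ?_ ht₀
  filter_upwards [self_mem_nhdsWithin] with t ht
  have m1 : MemLp (fun x => ψ t x - ψ t₀ x) 2 volume := (hψ t ht).sub hψ₀
  have m2 : MemLp (fun x => G t x - G t₀ x) 2 volume := (hG t ht).sub hG₀
  have i1 := integrable_mul_conj (hψ t ht) hG₀
  have i2 := integrable_mul_conj hψ₀ m2
  have i3 := integrable_mul_conj m1 m2
  simp only [Pi.add_apply]
  have i12 : Integrable (fun x => ψ t x * conj (G t₀ x) + ψ t₀ x * conj (G t x - G t₀ x)) :=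
    i1.add i2
  rw [← integral_add i1 i2, ← integral_add i12 i3]
  congr 1
  funext x
  simp only [map_sub]
  ring

end

noncomputable section

/-! ### Evolution of pairings with moving profiles -/

theorem Nice.rapid_scaling {N : ℕ} {g : Space N → ℝ} (hg : Nice g) (s : ℝ) :
    Rapid (scaling s g) :=
  (hg.rapid.const_mul _).add ((Rapid.sum _ fun i _ => (hg.rapid_pd i).coord_mul i).const_mul _)

theorem Nice.continuous_scaling {N : ℕ} {g : Space N → ℝ} (hg : Nice g) (s : ℝ) :
    Continuous (scaling s g) := by
  have h := hg.continuous
  have h' := hg.continuous_pd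
  unfold scaling
  fun_prop

theorem Nice.memLp_scaling {N : ℕ} {g : Space N → ℝ} (hg : Nice g) (s : ℝ) :
    MemLp (scaling s g) 2 volume := (hg.rapid_scaling s).memLp (hg.continuous_scaling s)

/-- The pairing `-⟨u, X g⟩`, expanded with respect to the coefficients of `X`. -/
def tangentPair {N : ℕ} (s : ℝ) (X : LieAlg N) (u : Space N → ℂ) (g : Space N → ℝ) : ℂ :=
  (∑ i, (X (.inl i) : ℂ) * pair u (pd i g)) - X (.inr (.inr 1)) * pair u (scaling s g) +
    Complex.I * ((∑ i, (X (.inr (.inl i)) : ℂ) * pair u (fun y => y i * g y)) +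
      X (.inr (.inr 0)) * pair u g)

theorem pair_conj_act_toC {N : ℕ} (s : ℝ) (X : LieAlg N) {u : Space N → ℂ}
    (hu : MemLp u 2 volume) {g : Space N → ℝ} (hg : Nice g) :
    ∫ y, u y * conj (act s X (toC g) y) = -tangentPair s X u g := by
  have hx : ∀ i, MemLp (fun y => y i * g y) 2 volume := fun i => (hg.coord_mul i).memLp
  have h1 := pair_actRe s X hu hg.memLp_pd (hg.memLp_scaling s)
  have h2 := pair_actIm X hu hg.memLp hx
  have m1 : MemLp (actRe s X g) 2 volume := by
    have : MemLp (fun y => ∑ i, X (.inl i) * pd i g y) 2 volume := by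
      simpa using memLp_finsetSum Finset.univ fun i _ => (hg.memLp_pd i).const_mul (X (.inl i))
    exact this.neg.add ((hg.memLp_scaling s).const_mul _)
  have m2 : MemLp (actIm X g) 2 volume := by
    have : MemLp (fun y => ∑ i, X (.inr (.inl i)) * (y i * g y)) 2 volume := by
      simpa using memLp_finsetSum Finset.univ fun i _ => (hx i).const_mul (X (.inr (.inl i)))
    exact this.add (hg.memLp.const_mul _)
  have e : ∀ y, u y * conj (act s X (toC g) y) =
      u y * (actRe s X g y : ℂ) - Complex.I * (u y * (actIm X g y : ℂ)) := fun y => by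
    rw [act_toC s X hg.contDiff]
    simp only [map_add, map_mul, Complex.conj_ofReal, Complex.conj_I]
    ring
  simp only [e]
  rw [integral_sub (integrable_pair hu m1) ((integrable_pair hu m2).const_mul _),
    integral_const_mul]
  change pair u (actRe s X g) - Complex.I * pair u (actIm X g) = _
  rw [h1, h2, tangentPair]
  ring

/-- Writing the velocity as free motion minus `Xtilde`, the `√μ v_i` part cancels the transport term
and `-|v|² / 4` cancels the kinetic phase. The remaining `μ` supplies the zeroth order term of the
static operator. -/
theorem hasDerivWithinAt_pair_trans {N : ℕ} {s st : ℝ} (hs : 0 < s) {lam : Space N → ℝ}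
    {ε T : ℝ} {ψ : ℝ → Space N → ℂ} {σ : ℝ → Param N} (hψ : IsNLSSolution s st lam ε T ψ)
    (hσ : IsDifferentiablePath T σ) (hμ : ∀ t ∈ Icc 0 T, 0 < (σ t).μ) {g : Space N → ℝ}
    (hg : Nice g) {t : ℝ} (ht : t ∈ Icc 0 T) {u : Space N → ℂ} (hu : MemH1 u)
    (hψu : ψ t = trans s (σ t) u) :
    HasDerivWithinAt (fun r => ∫ x, ψ r x * conj (trans s (σ r) (toC g) x))
      (massFactor N s (σ t).μ * (-Complex.I * ((σ t).μ * staticPair s u g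
        + (ε * (σ t).μ ^ (st / s) : ℝ) * pertPair st (frameLam lam (σ t)) u g)
        + tangentPair s (Xtilde T σ t) u g)) (Icc 0 T) t := by
  have hμt := hμ t ht
  obtain ⟨C, hC0, hC⟩ := hg.exists_trans_sub_le s hμt (hσ.a t ht) (hσ.v t ht) (hσ.γ t ht)
    (hσ.μ t ht)
  have hc : Filter.Tendsto (fun r => l2 fun x => ψ r x - ψ t x) (nhdsWithin t (Icc 0 T))
      (nhds 0) := by
    refine tendsto_of_tendsto_of_tendsto_of_le_of_le' tendsto_const_nhds (hψ.continuous t ht)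
      (Filter.Eventually.of_forall fun r => l2_nonneg _) ?_
    filter_upwards [self_mem_nhdsWithin] with r hr
    exact ((hψ.memH1 r hr).sub (hψ.memH1 t ht)).l2_le
  have h := hasDerivWithinAt_integral_mul_conj ht (H := fun x => C * weight x)
    (memLp_weight.const_mul C) (fun r hr => (hψ.memH1 r hr).1)
    (fun r hr => memLp_trans (hμ r hr) hg.memH1_toC.1) hc
    (hψ.equation t ht _ (hg.memH1_toC.trans hμt))
    (hasDerivWithinAt_trans_toC hg.contDiff hμt (hσ.a t ht).hasDerivWithinAt
      (hσ.v t ht).hasDerivWithinAt (hσ.γ t ht).hasDerivWithinAt (hσ.μ t ht).hasDerivWithinAt)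
    (by
      filter_upwards [hC] with r hr x
      refine (hr x).trans (le_of_eq ?_)
      ring)
  refine h.congr_deriv ?_
  change _ + ∫ x, ψ t x * conj (trans s (σ t) (act s (velocity T σ t) (toC g)) x) = _
  rw [hψu, energyGradPairing_trans hs st lam ε hμt hu hg, integral_trans_mul_conj hs hμt,
    pair_conj_act_toC s _ hu.1 hg]
  have e1 : ∀ i, velocity T σ t (.inl i) =
      (σ t).v i * Real.sqrt (σ t).μ - Xtilde T σ t (.inl i) := fun i => by
    simp [Xtilde, coeffs]
  have e2 : ∀ i, velocity T σ t (.inr (.inl i)) = - Xtilde T σ t (.inr (.inl i)) := fun i => by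
    simp [Xtilde, coeffs]
  have e3 : velocity T σ t (.inr (.inr 0)) =
      (σ t).μ - ‖(σ t).v‖ ^ 2 / 4 - Xtilde T σ t (.inr (.inr 0)) := by
    simp [Xtilde, coeffs]
  have e4 : velocity T σ t (.inr (.inr 1)) = - Xtilde T σ t (.inr (.inr 1)) := by
    simp [Xtilde, coeffs]
  have s1 : ∑ i, ((velocity T σ t (.inl i) : ℝ) : ℂ) * pair u (pd i g) =
      Real.sqrt (σ t).μ * (∑ i, (σ t).v i * pair u (pd i g)) -
        ∑ i, ((Xtilde T σ t (.inl i) : ℝ) : ℂ) * pair u (pd i g) := by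
    rw [Finset.mul_sum, ← Finset.sum_sub_distrib]
    refine Finset.sum_congr rfl fun i _ => ?_
    rw [e1]; push_cast; ring
  have s2 : ∑ i, ((velocity T σ t (.inr (.inl i)) : ℝ) : ℂ) * pair u (fun y => y i * g y) =
      -∑ i, ((Xtilde T σ t (.inr (.inl i)) : ℝ) : ℂ) * pair u (fun y => y i * g y) := by
    rw [← Finset.sum_neg_distrib]
    refine Finset.sum_congr rfl fun i _ => ?_
    rw [e2]; push_cast; ring
  rw [tangentPair, tangentPair, staticPair, s1, s2, e3, e4]
  push_cast
  linear_combination (-(massFactor N s (σ t).μ : ℂ) * Real.sqrt (σ t).μ *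
    ∑ i, (σ t).v i * pair u (pd i g)) * Complex.I_mul_I

/-! ### The fluctuation -/

theorem fluctuation_eq {N : ℕ} {s : ℝ} (η : Space N → ℝ) (ψ : Space N → ℂ) {σ : Param N}
    (hμ : 0 < σ.μ) : transInv s σ ψ = fun y => toC η y + fluctuation s η ψ σ y := by
  have h := transInv_trans s σ hμ (toC η)
  funext y
  have hy := congrFun h y
  simp only [fluctuation, soliton]
  rw [← hy]
  simp only [transInv]
  ring

theorem sub_soliton_eq {N : ℕ} {s : ℝ} (η : Space N → ℝ) (ψ : Space N → ℂ) {σ : Param N}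
    (hμ : 0 < σ.μ) : (fun x => ψ x - soliton s η σ x) = trans s σ (fluctuation s η ψ σ) := by
  rw [fluctuation, trans_transInv s σ hμ]

end

noncomputable section

/-! ### Skew-orthogonality in the moving frame -/

theorem contDiff_trans_toC {N : ℕ} (s : ℝ) {σ : Param N} (hμ : 0 < σ.μ) {g : Space N → ℝ}
    (hg : ContDiff ℝ 1 g) : ContDiff ℝ 1 (trans s σ (toC g)) := by
  have e : trans s σ (toC g) = fun x => phase σ (Real.sqrt σ.μ • (x - σ.a)) *
      ((σ.μ ^ (1 / (2 * s)) : ℝ) : ℂ) * toC g (Real.sqrt σ.μ • (x - σ.a)) :=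
    funext (trans_apply_eq s hμ (toC g))
  have ha : ContDiff ℝ 1 (fun x : Space N => Real.sqrt σ.μ • (x - σ.a)) :=
    (contDiff_id.sub contDiff_const).const_smul _
  rw [e]
  exact ((((contDiff_phase σ).of_le (by simp)).comp ha).mul contDiff_const).mul
    ((contDiff_toC hg).comp ha)

theorem partialDeriv_trans_toC {N : ℕ} (s : ℝ) {σ : Param N} (hμ : 0 < σ.μ) {g : Space N → ℝ}
    (hg : ContDiff ℝ 1 g) (i : Fin N) (x : Space N) :
    partialDeriv i (trans s σ (toC g)) x = trans s σ (fun y =>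
      ((Real.sqrt σ.μ * pd i g y : ℝ) : ℂ) + Complex.I * ((σ.v i / 2 * g y : ℝ) : ℂ)) x := by
  -- Moving `x` in direction `i` is the same as moving the centre backwards, so the spatial
  -- derivative is a special case of the parameter derivative.
  set τ : ℝ → Param N := fun t => ⟨σ.a - t • basisVec i, σ.v, σ.γ, σ.μ⟩ with hτ
  have ha : HasDerivAt (fun t => (τ t).a) (-basisVec i) 0 := by
    simpa using ((hasDerivAt_id (0 : ℝ)).smul_const (basisVec i : Space N)).const_sub σ.a
  have τ0 : τ 0 = σ := by simp [hτ]
  have h := hasDerivWithinAt_trans_toC (s := s) hg (S := univ) (t₀ := 0) (σ := τ) (by rw [τ0]; exact hμ)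
    ha.hasDerivWithinAt (hasDerivWithinAt_const _ _ σ.v) (hasDerivWithinAt_const _ _ σ.γ)
    (hasDerivWithinAt_const _ _ σ.μ) x
  rw [hasDerivWithinAt_univ, τ0] at h
  have hl : HasDerivAt (fun t : ℝ => x + t • (basisVec i : Space N)) (basisVec i) 0 := by
    simpa using ((hasDerivAt_id (0 : ℝ)).smul_const (basisVec i : Space N)).const_add x
  have hd : HasFDerivAt (trans s σ (toC g)) (fderiv ℝ (trans s σ (toC g)) x)
      (x + (0 : ℝ) • (basisVec i : Space N)) := by
    rw [zero_smul, add_zero]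
    exact ((contDiff_trans_toC s hμ hg).differentiable (by simp) x).hasFDerivAt
  have h' := hd.comp_hasDerivAt (0 : ℝ) hl
  have e : (trans s σ (toC g) ∘ fun t : ℝ => x + t • (basisVec i : Space N)) =
      fun t => trans s (τ t) (toC g) x := by
    funext t
    have : x + t • (basisVec i : Space N) - σ.a = x - (σ.a - t • basisVec i) := by abel
    simp only [Function.comp_apply, trans, this, hτ]
  rw [e] at h'
  rw [partialDeriv, h'.unique h]
  congr 1
  funext y
  rw [act_toC s _ hg]
  have e1 : ∀ j, (-basisVec i : Space N) j = if j = i then -1 else 0 := fun j => by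
    by_cases hj : j = i
    · subst hj; simp [basisVec]
    · simp [basisVec, hj]
  have e2 : inner ℝ (-basisVec i) σ.v = -σ.v i := by
    rw [inner_neg_left, real_inner_comm, inner_basisVec]
  simp only [actRe, actIm, coeffs, Sum.elim_inl, Sum.elim_inr, e1, e2, PiLp.zero_apply]
  simp
  ring

theorem act_single {N : ℕ} (s : ℝ) (α : Idx N) (u : Space N → ℂ) :
    act s (Pi.single α 1) u = gen s α u := by
  classical
  funext x
  rw [act, Finset.sum_eq_single α]
  · simp
  · intro β _ h
    simp [Pi.single_eq_of_ne h]
  · simp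

theorem sympl_re_add_im {N : ℕ} {w : Space N → ℂ} (hw : MemLp w 2 volume) {g h : Space N → ℝ}
    (hg : MemLp g 2 volume) (hh : MemLp h 2 volume) :
    sympl w (fun y => (g y : ℂ) + Complex.I * (h y : ℂ)) = (pair w g).im - (pair w h).re := by
  have e : ∀ y, w y * conj ((g y : ℂ) + Complex.I * (h y : ℂ)) =
      w y * (g y : ℂ) - Complex.I * (w y * (h y : ℂ)) := fun y => by
    simp only [map_add, map_mul, Complex.conj_ofReal, Complex.conj_I]
    ring
  simp only [sympl, e]
  rw [integral_sub (integrable_pair hw hg) ((integrable_pair hw hh).const_mul _),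
    integral_const_mul]
  simp [pair, Complex.sub_im, Complex.mul_im]

theorem sympl_trans {N : ℕ} {s : ℝ} (hs : 0 < s) {σ : Param N} (hμ : 0 < σ.μ)
    (u v : Space N → ℂ) :
    sympl (trans s σ u) (trans s σ v) = massFactor N s σ.μ * sympl u v := by
  rw [sympl, integral_trans_mul_conj hs hμ, Complex.im_ofReal_mul]
  rfl

theorem coord_eq {N : ℕ} {σ : Param N} (hμ : 0 < σ.μ) (x : Space N) (i : Fin N) :
    x i = (Real.sqrt σ.μ)⁻¹ * (Real.sqrt σ.μ • (x - σ.a)) i + σ.a i := by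
  conv_lhs => rw [← inv_smul_add_eq hμ x]
  simp

/-- Skew-orthogonality to the soliton manifold, expressed through the profile. -/
theorem IsSkewOrthogonal.pair_eq_zero {N : ℕ} (hN : 1 ≤ N) {s : ℝ} (hs : 0 < s)
    {η : Space N → ℝ} (hη : IsSolitonProfile s η) {ψ : Space N → ℂ} {σ : Param N} (hμ : 0 < σ.μ)
    (h : IsSkewOrthogonal s η ψ σ) {w : Space N → ℂ} (hw : w = fluctuation s η ψ σ)
    (hw2 : MemLp w 2 volume) :
    (pair w η).re = 0 ∧ (∀ i, (pair w (fun y => y i * η y)).re = 0) ∧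
      (∀ i, (pair w (pd i η)).im = 0) ∧ (pair w (scaling s η)).im = 0 := by
  have n0 := hη.nice hN hs
  have n1 := hη.nice_pd hN hs
  have n2 := hη.nice_scaling hN hs
  have nx := fun i => n0.coord_mul i
  have r0 : 0 < Real.sqrt σ.μ := Real.sqrt_pos.2 hμ
  -- A generator applied to `T_σ η` is `T_σ (g + i k)` with real `g` and `k`; the phase of `T_σ` and
  -- its centre mix the generators in a triangular way. The constraints are therefore solved
  -- successively: gauge, boosts and translations, scaling.
  have key : ∀ (α : Idx N) (g k : Space N → ℝ), MemLp g 2 volume → MemLp k 2 volume →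
      (∀ x, gen s α (soliton s η σ) x =
        trans s σ (fun y => (g y : ℂ) + Complex.I * (k y : ℂ)) x) →
      (pair w g).im = (pair w k).re := fun α g k hg hk e => by
    have h1 := h (Pi.single α 1)
    rw [act_single, sub_soliton_eq η ψ hμ, ← hw, funext e, sympl_trans hs hμ,
      sympl_re_add_im hw2 hg hk] at h1
    have := (mul_eq_zero.1 h1).resolve_left (massFactor_pos N s hμ).ne'
    linarith
  have pz : (pair w (fun _ => 0)) = 0 := by simp [pair]
  have A : (pair w η).re = 0 := by
    have := key (.inr (.inr 0)) (fun _ => 0) η (by simp) n0.memLp fun x => by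
      simp only [gen, soliton, trans, toC]
      push_cast
      ring
    rw [← this, pz]; simp
  have B : ∀ i, (pair w (fun y => y i * η y)).re = 0 := fun i => by
    have := key (.inr (.inl i)) (fun _ => 0)
      (fun y => (Real.sqrt σ.μ)⁻¹ * (y i * η y) + σ.a i * η y) (by simp)
      (((nx i).const_mul _).add (n0.const_mul _)).memLp fun x => by
        simp only [gen, soliton, trans, toC]
        rw [coord_eq hμ x i]
        push_cast
        ring
    rw [pz, pair_add hw2 ((nx i).const_mul _).memLp (n0.const_mul _).memLp, pair_const_mul,
      pair_const_mul, Complex.add_re, Complex.re_ofReal_mul, Complex.re_ofReal_mul, A, mul_zero,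
      add_zero, Complex.zero_im] at this
    exact (mul_eq_zero.1 this.symm).resolve_left (inv_pos.2 r0).ne'
  have C : ∀ i, (pair w (pd i η)).im = 0 := fun i => by
    have := key (.inl i) (fun y => -Real.sqrt σ.μ * pd i η y) (fun y => -(σ.v i / 2) * η y)
      ((n1 i).const_mul _).memLp (n0.const_mul _).memLp fun x => by
        simp only [gen, soliton]
        rw [partialDeriv_trans_toC s hμ n0.contDiff]
        simp only [trans]
        push_cast
        ring
    rw [pair_const_mul, pair_const_mul, Complex.im_ofReal_mul, Complex.re_ofReal_mul, A,
      mul_zero] at this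
    exact (mul_eq_zero.1 this).resolve_left (neg_neg_of_pos r0).ne
  refine ⟨A, B, C, ?_⟩
  have m1 : ∀ j ∈ (Finset.univ : Finset (Fin N)),
      Nice (fun y => (1 / 2 * σ.a j * Real.sqrt σ.μ) * pd j η y) := fun j _ => (n1 j).const_mul _
  have m2 : ∀ j ∈ (Finset.univ : Finset (Fin N)),
      Nice (fun y => (1 / 2 * (σ.v j / 2) * (Real.sqrt σ.μ)⁻¹) * (y j * η y) +
        (1 / 2 * (σ.v j / 2) * σ.a j) * η y) := fun j _ =>
    ((nx j).const_mul _).add (n0.const_mul _)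
  -- Scaling about the origin picks up translations from the centre, and boosts and gauge from the
  -- phase; these contributions vanish by the constraints already obtained.
  have := key (.inr (.inr 1))
    (fun y => scaling s η y + ∑ j, (1 / 2 * σ.a j * Real.sqrt σ.μ) * pd j η y)
    (fun y => ∑ j, ((1 / 2 * (σ.v j / 2) * (Real.sqrt σ.μ)⁻¹) * (y j * η y) +
        (1 / 2 * (σ.v j / 2) * σ.a j) * η y))
    (n2.add (Nice.sum _ m1)).memLp (Nice.sum _ m2).memLp fun x => by
      simp only [gen, soliton]
      simp only [partialDeriv_trans_toC s hμ n0.contDiff]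
      have r1 : (Real.sqrt σ.μ)⁻¹ * Real.sqrt σ.μ = 1 := inv_mul_cancel₀ r0.ne'
      have e : ∀ j, x j = (Real.sqrt σ.μ)⁻¹ * (Real.sqrt σ.μ • (x - σ.a)) j + σ.a j :=
        coord_eq hμ x
      simp only [trans, toC]
      set y := Real.sqrt σ.μ • (x - σ.a) with hy
      set E := Complex.exp (Complex.I * (((1 / 2) * inner ℝ σ.v (x - σ.a) + σ.γ : ℝ) : ℂ)) *
        ((σ.μ ^ (1 / (2 * s)) : ℝ) : ℂ) with hE
      have e' : ∑ j, (x j : ℂ) * (E * (((Real.sqrt σ.μ * pd j η y : ℝ) : ℂ) +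
          Complex.I * ((σ.v j / 2 * η y : ℝ) : ℂ))) =
          E * ∑ j, ((y j : ℂ) * (pd j η y : ℂ) + (σ.a j * Real.sqrt σ.μ * pd j η y : ℝ) +
            Complex.I * (((σ.v j / 2 * (Real.sqrt σ.μ)⁻¹) * (y j * η y) +
              (σ.v j / 2 * σ.a j) * η y : ℝ) : ℂ)) := by
        rw [Finset.mul_sum]
        refine Finset.sum_congr rfl fun j _ => ?_
        rw [e j]
        have : ((Real.sqrt σ.μ)⁻¹ : ℂ) * (Real.sqrt σ.μ : ℂ) = 1 := by exact_mod_cast r1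
        push_cast
        linear_combination (E * y j * pd j η y : ℂ) * this
      rw [e']
      have e3 : ∑ j, (1 / 2 * σ.a j * Real.sqrt σ.μ) * pd j η y =
        1 / 2 * ∑ j, σ.a j * Real.sqrt σ.μ * pd j η y := by
        rw [Finset.mul_sum]; exact Finset.sum_congr rfl fun j _ => by ring
      have e4 : ∑ j, ((1 / 2 * (σ.v j / 2) * (Real.sqrt σ.μ)⁻¹) * (y j * η y) +
        (1 / 2 * (σ.v j / 2) * σ.a j) * η y) = 1 / 2 * ∑ j, ((σ.v j / 2 * (Real.sqrt σ.μ)⁻¹) *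
          (y j * η y) + (σ.v j / 2 * σ.a j) * η y) := by
        rw [Finset.mul_sum]; exact Finset.sum_congr rfl fun j _ => by ring
      rw [e3, e4, Finset.sum_add_distrib, Finset.sum_add_distrib, ← Finset.mul_sum, scaling]
      simp only [← Complex.ofReal_mul, ← Complex.ofReal_sum]
      push_cast
      ring
  rw [pair_add hw2 n2.memLp (Nice.sum _ m1).memLp, pair_sum _ hw2 fun j hj => (m1 j hj).memLp,
    pair_sum _ hw2 fun j hj => (m2 j hj).memLp, Complex.add_im, Complex.im_sum, Complex.re_sum,
    Finset.sum_eq_zero, Finset.sum_eq_zero, add_zero] at this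
  · exact this
  · intro j _
    rw [pair_add hw2 ((nx j).const_mul _).memLp (n0.const_mul _).memLp, pair_const_mul,
      pair_const_mul, Complex.add_re, Complex.re_ofReal_mul, Complex.re_ofReal_mul, A, B]
    simp
  · intro j _
    rw [pair_const_mul, Complex.im_ofReal_mul, C, mul_zero]

end

noncomputable section

/-! ### The linearised equation tested against generators of the soliton manifold -/

theorem pair_add_left {N : ℕ} {u v : Space N → ℂ} (hu : MemLp u 2 volume) (hv : MemLp v 2 volume)
    {g : Space N → ℝ} (hg : MemLp g 2 volume) :
    pair (fun x => u x + v x) g = pair u g + pair v g := by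
  simp only [pair, add_mul]
  exact integral_add (integrable_pair hu hg) (integrable_pair hv hg)

theorem gradPair_add_left {N : ℕ} {u v : Space N → ℂ} (hu : MemH1 u) (hv : MemH1 v)
    {g : Space N → ℝ} (hg : Nice g) :
    gradPair (fun x => u x + v x) g = gradPair u g + gradPair v g := by
  rw [gradPair, gradPair, gradPair, ← Finset.sum_add_distrib]
  refine Finset.sum_congr rfl fun i _ => ?_
  rw [← pair_add_left (hu.memLp_weakPartial i) (hv.memLp_weakPartial i) (hg.memLp_pd i)]
  refine integral_congr_ae ?_
  filter_upwards [hu.weakPartial_add hv i] with x hx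
  rw [hx]

theorem pair_toC {N : ℕ} (g h : Space N → ℝ) :
    pair (toC g) h = ((∫ x, g x * h x : ℝ) : ℂ) := by
  rw [pair, ← integral_complex_ofReal]
  congr 1
  funext x
  simp [toC]

theorem Nice.gradPair_toC_comm {N : ℕ} {g h : Space N → ℝ} (hg : Nice g) (hh : Nice h) :
    gradPair (toC g) h = gradPair (toC h) g := by
  have e : ∀ {g h : Space N → ℝ}, Nice g → ∀ i, pair (weakPartial i (toC g)) (pd i h) =
      ∫ x, (pd i g x : ℂ) * (pd i h x : ℂ) := fun {g h} hg i => by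
    refine integral_congr_ae ?_
    filter_upwards [hg.weakPartial_toC i] with x hx
    rw [hx]
  rw [gradPair, gradPair]
  refine Finset.sum_congr rfl fun i _ => ?_
  rw [e hg, e hh]
  simp only [mul_comm]

theorem norm_pair_le {N : ℕ} {w : Space N → ℂ} (hw : MemLp w 2 volume) {g : Space N → ℝ}
    (hg : MemLp g 2 volume) : ‖pair w g‖ ≤ l2 w * l2 (toC g) :=
  norm_integral_mul_le hw (memLp_toC hg)

theorem tangentPair_add {N : ℕ} (s : ℝ) (X : LieAlg N) {u v : Space N → ℂ}
    (hu : MemLp u 2 volume) (hv : MemLp v 2 volume) {g : Space N → ℝ} (hg : Nice g) :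
    tangentPair s X (fun x => u x + v x) g = tangentPair s X u g + tangentPair s X v g := by
  simp only [tangentPair, pair_add_left hu hv hg.memLp, pair_add_left hu hv (hg.memLp_pd _),
    pair_add_left hu hv (hg.memLp_scaling s), pair_add_left hu hv (hg.coord_mul _).memLp, mul_add,
    Finset.sum_add_distrib]
  ring

theorem Nice.exists_tangentPair_le {N : ℕ} (s : ℝ) {g : Space N → ℝ} (hg : Nice g) :
    ∃ C, 0 ≤ C ∧ ∀ (X : LieAlg N) (w : Space N → ℂ), MemH1 w →
      ‖tangentPair s X w g‖ ≤ C * (‖X‖ * normH1 w) := by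
  refine ⟨(∑ i, l2 (toC (pd i g))) + l2 (toC (scaling s g)) +
    ((∑ i, l2 (toC fun y => y i * g y)) + l2 (toC g)), ?_, fun X w hw => ?_⟩
  · have h1 := Finset.sum_nonneg fun (i : Fin N) (_ : i ∈ Finset.univ) => l2_nonneg (toC (pd i g))
    have h2 := Finset.sum_nonneg fun (i : Fin N) (_ : i ∈ Finset.univ) =>
      l2_nonneg (toC fun y : Space N => y i * g y)
    have h3 := l2_nonneg (toC (scaling s g))
    exact add_nonneg (add_nonneg h1 h3) (add_nonneg h2 (l2_nonneg (toC g)))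
  have b : ∀ (α : Idx N) (h : Space N → ℝ), MemLp h 2 volume →
      ‖(X α : ℂ) * pair w h‖ ≤ ‖X‖ * normH1 w * l2 (toC h) := fun α h hh => by
    rw [norm_mul, Complex.norm_real, mul_assoc]
    have h1 := norm_le_pi_norm X α
    have h2 := (norm_pair_le hw.1 hh).trans
      (mul_le_mul_of_nonneg_right hw.l2_le (l2_nonneg (toC h)))
    exact mul_le_mul h1 h2 (norm_nonneg _) (norm_nonneg _)
  have c1 := (norm_sum_le Finset.univ fun i => (X (.inl i) : ℂ) * pair w (pd i g)).trans
    (Finset.sum_le_sum fun i _ => b (.inl i) _ (hg.memLp_pd i))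
  have c2 := (norm_sum_le Finset.univ fun i =>
    (X (.inr (.inl i)) : ℂ) * pair w (fun y => y i * g y)).trans
    (Finset.sum_le_sum fun i _ => b (.inr (.inl i)) _ (hg.coord_mul i).memLp)
  have c3 := b (.inr (.inr 0)) _ hg.memLp
  have c4 := b (.inr (.inr 1)) _ (hg.memLp_scaling s)
  rw [← Finset.mul_sum] at c1 c2
  rw [tangentPair]
  refine (norm_add_le _ _).trans ?_
  rw [norm_mul, Complex.norm_I, one_mul]
  have d1 := norm_sub_le (∑ i, (X (.inl i) : ℂ) * pair w (pd i g))
    (X (.inr (.inr 1)) * pair w (scaling s g))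
  have d2 := norm_add_le (∑ i, (X (.inr (.inl i)) : ℂ) * pair w (fun y => y i * g y))
    (X (.inr (.inr 0)) * pair w g)
  linarith

namespace IsSolitonProfile

variable {N : ℕ} {s : ℝ} {η : Space N → ℝ}

theorem memLp_rpow_mul (hN : 1 ≤ N) (hs : 0 < s) (hη : IsSolitonProfile s η) {g : Space N → ℝ}
    (hg : Nice g) : MemLp (fun x => η x ^ (2 * s) * g x) 2 volume := by
  obtain ⟨B, -, hB⟩ := hη.exists_rpow_bound hN hs (p := 2 * s) (by positivity)
  exact (hg.rapid.bdd_mul hB).memLp ((hη.continuous_rpow _).mul hg.continuous)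

theorem pair_one_sub_rpow_mul (hN : 1 ≤ N) (hs : 0 < s) (hη : IsSolitonProfile s η)
    {g : Space N → ℝ} (hg : Nice g) {w : Space N → ℂ} (hw : MemLp w 2 volume) (c : ℝ) :
    pair w (fun x => (1 - c * η x ^ (2 * s)) * g x) =
      pair w g - c * pair w (fun x => η x ^ (2 * s) * g x) := by
  have : (fun x => (1 - c * η x ^ (2 * s)) * g x) =
      fun x => g x + (-c) * (η x ^ (2 * s) * g x) := by funext x; ring
  rw [this, pair_add hw hg.memLp ((hη.memLp_rpow_mul hN hs hg).const_mul _), pair_const_mul]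
  push_cast
  ring

/-- The Dirichlet form is symmetric on real profiles, so the weak profile equation may be used with
`g` in the role of the `H¹` function. -/
theorem staticPair_profile (hN : 1 ≤ N) (hs : 0 < s) (hη : IsSolitonProfile s η)
    {g : Space N → ℝ} (hg : Nice g) :
    gradPair (toC η) g + pair (toC η) g - ∫ x, ((η x ^ (2 * s + 1) : ℝ) : ℂ) * (g x : ℂ) = 0 := by
  have n0 := hη.nice hN hs
  have e : source s η = fun x => η x + (-1) * (η x ^ (2 * s) * η x) := by
    funext x
    rw [source, Real.rpow_add (hη.pos x), Real.rpow_one]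
    ring
  rw [n0.gradPair_toC_comm hg, hη.gradPair_profile hN hs hg.memH1_toC, e,
    pair_add hg.memH1_toC.1 n0.memLp ((hη.memLp_rpow_mul hN hs n0).const_mul _), pair_const_mul]
  have e1 : pair (toC g) η = pair (toC η) g := by
    simp only [pair, toC]; congr 1; funext x; ring
  have e2 : pair (toC g) (fun x => η x ^ (2 * s) * η x) =
      ∫ x, ((η x ^ (2 * s + 1) : ℝ) : ℂ) * (g x : ℂ) := by
    simp only [pair, toC]; congr 1; funext x
    rw [Real.rpow_add (hη.pos x), Real.rpow_one]
    push_cast; ring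
  rw [e1, e2]
  push_cast
  ring

/-- The static equation, expanded around the soliton profile with quadratic remainder. -/
theorem exists_staticPair_le (hN : 1 ≤ N) (hs : 0 < s) (hsN : s < 2 / (N : ℝ))
    (hη : IsSolitonProfile s η) {g : Space N → ℝ} (hg : Nice g) (hgη : Controlled η g) :
    ∃ C, 0 ≤ C ∧ ∀ w : Space N → ℂ, MemH1 w → normH1 w ≤ 1 →
      ‖staticPair s (fun y => toC η y + w y) g - (gradPair w g + pair w g
        - pair w (fun x => η x ^ (2 * s) * g x)
        - ((2 * s * (pair w (fun x => η x ^ (2 * s) * g x)).re : ℝ) : ℂ))‖ ≤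
          C * normH1 w ^ 2 := by
  obtain ⟨C, hC0, hC⟩ := hη.exists_taylor_bound hN hs hsN hg.continuous hgη
  refine ⟨C, hC0, fun w hw hw1 => ?_⟩
  obtain ⟨i0, b0⟩ := hC w hw hw1
  have n0 := hη.nice hN hs
  have m := hη.memLp_rpow_mul hN hs hg
  have i1 : Integrable (fun x => ((η x ^ (2 * s + 1) : ℝ) : ℂ) * (g x : ℂ)) := by
    have := (((hη.rapid_rpow hN hs (p := 2 * s) (by linarith)).mul hg.rapid).integrable
      ((hη.continuous_rpow (2 * s + 1)).mul hg.continuous)).ofReal (𝕜 := ℂ)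
    refine this.congr (Filter.Eventually.of_forall fun x => ?_)
    simp
  have i2 : Integrable (fun x => ((η x ^ (2 * s) : ℝ) : ℂ) * w x * (g x : ℂ)) := by
    refine (integrable_pair hw.1 m).congr (Filter.Eventually.of_forall fun x => ?_)
    push_cast; ring
  have i3 : Integrable (fun x => ((2 * s * η x ^ (2 * s) * (w x).re : ℝ) : ℂ) * (g x : ℂ)) := by
    have := ((integrable_pair hw.1 m).re.const_mul (2 * s)).ofReal (𝕜 := ℂ)
    refine this.congr (Filter.Eventually.of_forall fun x => ?_)
    simp [-Complex.ofReal_mul]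
    push_cast
    ring
  have v2 : ∫ x, ((η x ^ (2 * s) : ℝ) : ℂ) * w x * (g x : ℂ) =
      pair w (fun x => η x ^ (2 * s) * g x) := by
    rw [pair]; congr 1; funext x; push_cast; ring
  have v3 : ∫ x, ((2 * s * η x ^ (2 * s) * (w x).re : ℝ) : ℂ) * (g x : ℂ) =
      ((2 * s * (pair w (fun x => η x ^ (2 * s) * g x)).re : ℝ) : ℂ) := by
    have h1 : (pair w (fun x => η x ^ (2 * s) * g x)).re =
        ∫ x, (w x * ((η x ^ (2 * s) * g x : ℝ) : ℂ)).re :=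
      (integral_re (integrable_pair hw.1 m)).symm
    rw [h1, ← integral_const_mul, ← integral_complex_ofReal]
    congr 1; funext x
    rw [Complex.re_mul_ofReal]
    push_cast; ring
  have split : pair (fun y => powNL s (toC η y + w y)) g =
      (∫ x, (powNL s (toC η x + w x) - ((η x ^ (2 * s + 1) : ℝ) : ℂ)
        - ((η x ^ (2 * s) : ℝ) : ℂ) * w x - ((2 * s * η x ^ (2 * s) * (w x).re : ℝ) : ℂ))
          * (g x : ℂ)) + (∫ x, ((η x ^ (2 * s + 1) : ℝ) : ℂ) * (g x : ℂ)) +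
      (∫ x, ((η x ^ (2 * s) : ℝ) : ℂ) * w x * (g x : ℂ)) +
      ∫ x, ((2 * s * η x ^ (2 * s) * (w x).re : ℝ) : ℂ) * (g x : ℂ) := by
    -- The second slot of `integral_comb4` is subtracted, hence the coefficient `-1` for a plain
    -- sum.
    have h := integral_comb4 i0 i1 i2 i3 1 (-1) 1 1
    simp only [one_mul, neg_one_mul, sub_neg_eq_add] at h
    rw [← h, pair]
    congr 1
    funext x
    ring
  have z := hη.staticPair_profile hN hs hg
  rw [staticPair, gradPair_add_left n0.memH1_toC hw hg, pair_add_left n0.memH1_toC.1 hw.1 hg.memLp,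
    split, v2, v3]
  refine le_trans (le_of_eq ?_) b0
  rw [← norm_neg]
  congr 1
  linear_combination (-1 : ℂ) * z

end IsSolitonProfile

end

noncomputable section

namespace IsSolitonProfile

variable {N : ℕ} {s : ℝ} {η : Space N → ℝ}

/-! ### Control of the generators by the profile -/

theorem controlled_self (hη : IsSolitonProfile s η) : Controlled η η :=
  ⟨1, zero_le_one, fun x => by
    rw [abs_of_pos (hη.pos x)]
    nlinarith [hη.pos x, norm_nonneg x, mul_nonneg (norm_nonneg x) (hη.pos x).le]⟩

theorem controlled_coord (hη : IsSolitonProfile s η) (i : Fin N) :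
    Controlled η (fun x => x i * η x) :=
  ⟨1, zero_le_one, fun x => by
    rw [abs_mul, abs_of_pos (hη.pos x), one_mul]
    have := hη.pos x
    gcongr
    linarith [abs_coord_le x i]⟩

theorem controlled_pd (hN : 1 ≤ N) (hs : 0 < s) (hη : IsSolitonProfile s η) (i : Fin N) :
    Controlled η (pd i η) := by
  obtain ⟨K, hK, -, h, -⟩ := hη.exists_bounds hN hs
  refine ⟨K, hK, fun x => (h i x).trans ?_⟩
  have := hη.pos x
  gcongr
  nlinarith [norm_nonneg x]

theorem controlled_scaling (hN : 1 ≤ N) (hs : 0 < s) (hη : IsSolitonProfile s η) :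
    Controlled η (scaling s η) := by
  obtain ⟨K, hK, -, h, -⟩ := hη.exists_bounds hN hs
  refine ⟨1 / (2 * s) + 1 / 2 * (N * K), by positivity, fun x => ?_⟩
  have hx := hη.pos x
  have b : ∀ i, |x i * pd i η x| ≤ K * ((1 + ‖x‖) * η x) := fun i => by
    rw [abs_mul]
    calc |x i| * |pd i η x| ≤ (1 + ‖x‖) * (K * η x) := by
          gcongr
          · linarith [abs_coord_le x i]
          · exact h i x
      _ = _ := by ring
  have b' : |∑ i, x i * pd i η x| ≤ N * (K * ((1 + ‖x‖) * η x)) := by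
    refine (Finset.abs_sum_le_sum_abs _ _).trans ((Finset.sum_le_sum fun i _ => b i).trans ?_)
    simp
  have c : η x ≤ (1 + ‖x‖) * η x := by nlinarith [mul_nonneg (norm_nonneg x) hx.le]
  rw [scaling]
  refine (abs_add_le _ _).trans ?_
  rw [abs_mul, abs_mul, abs_of_pos hx, abs_of_pos (by positivity : 0 < 1 / (2 * s)),
    abs_of_pos (by norm_num : (0 : ℝ) < 1 / 2)]
  calc _ ≤ 1 / (2 * s) * ((1 + ‖x‖) * η x) + 1 / 2 * (N * (K * ((1 + ‖x‖) * η x))) := by gcongr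
    _ = _ := by ring

/-! ### Quadratic estimates -/

/-- The real part of the linear term is the pairing with `L₊ ∂_i η`, which is zero. -/
theorem exists_re_staticPair_pd_le (hN : 1 ≤ N) (hs : 0 < s) (hsN : s < 2 / (N : ℝ))
    (hη : IsSolitonProfile s η) (i : Fin N) :
    ∃ C, 0 ≤ C ∧ ∀ w : Space N → ℂ, MemH1 w → normH1 w ≤ 1 →
      |(staticPair s (fun y => toC η y + w y) (pd i η)).re| ≤ C * normH1 w ^ 2 := by
  have hg := hη.nice_pd hN hs i
  obtain ⟨C, hC0, hC⟩ := hη.exists_staticPair_le hN hs hsN hg (hη.controlled_pd hN hs i)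
  refine ⟨C, hC0, fun w hw hw1 => ?_⟩
  have h := (Complex.abs_re_le_norm _).trans (hC w hw hw1)
  rw [hη.gradPair_pd hN hs hw, hη.pd_source, hη.pair_one_sub_rpow_mul hN hs hg hw.1] at h
  refine le_trans (le_of_eq ?_) h
  congr 1
  simp only [Complex.sub_re, Complex.add_re, Complex.neg_re, Complex.re_ofReal_mul,
    Complex.ofReal_re]
  ring

/-- Here `L₊ Λη = -η`, so the linear term is a multiple of the constrained quantity `Re ⟨w, η⟩`. -/
theorem exists_re_staticPair_scaling_le (hN : 1 ≤ N) (hs : 0 < s) (hsN : s < 2 / (N : ℝ))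
    (hη : IsSolitonProfile s η) :
    ∃ C, 0 ≤ C ∧ ∀ w : Space N → ℂ, MemH1 w → normH1 w ≤ 1 → (pair w η).re = 0 →
      |(staticPair s (fun y => toC η y + w y) (scaling s η)).re| ≤ C * normH1 w ^ 2 := by
  have hg := hη.nice_scaling hN hs
  obtain ⟨C, hC0, hC⟩ := hη.exists_staticPair_le hN hs hsN hg (hη.controlled_scaling hN hs)
  refine ⟨C, hC0, fun w hw hw1 h0 => ?_⟩
  have h := (Complex.abs_re_le_norm _).trans (hC w hw hw1)
  rw [hη.gradPair_scaling hN hs hw, hη.pair_one_sub_rpow_mul hN hs hg hw.1] at h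
  refine le_trans (le_of_eq ?_) h
  congr 1
  simp only [Complex.sub_re, Complex.add_re, Complex.neg_re, Complex.re_ofReal_mul,
    Complex.ofReal_re, h0]
  ring

/-- In the imaginary part the real-linear correction drops out and `L₋` acts; `L₋ η = 0` is the
profile equation. -/
theorem exists_im_staticPair_self_le (hN : 1 ≤ N) (hs : 0 < s) (hsN : s < 2 / (N : ℝ))
    (hη : IsSolitonProfile s η) :
    ∃ C, 0 ≤ C ∧ ∀ w : Space N → ℂ, MemH1 w → normH1 w ≤ 1 →
      |(staticPair s (fun y => toC η y + w y) η).im| ≤ C * normH1 w ^ 2 := by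
  have hg := hη.nice hN hs
  obtain ⟨C, hC0, hC⟩ := hη.exists_staticPair_le hN hs hsN hg hη.controlled_self
  refine ⟨C, hC0, fun w hw hw1 => ?_⟩
  have h := (Complex.abs_im_le_norm _).trans (hC w hw hw1)
  have e : source s η = fun x => (1 - 1 * η x ^ (2 * s)) * η x := by
    funext x
    rw [source, Real.rpow_add (hη.pos x), Real.rpow_one]
    ring
  rw [hη.gradPair_profile hN hs hw, e, hη.pair_one_sub_rpow_mul hN hs hg hw.1] at h
  refine le_trans (le_of_eq ?_) h
  congr 1
  simp only [Complex.sub_im, Complex.add_im, Complex.neg_im, Complex.im_ofReal_mul,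
    Complex.ofReal_im]
  ring

/-- Here `L₋ (x_i η) = -2 ∂_i η`, and `Im ⟨w, ∂_i η⟩` is one of the constraints. -/
theorem exists_im_staticPair_coord_le (hN : 1 ≤ N) (hs : 0 < s) (hsN : s < 2 / (N : ℝ))
    (hη : IsSolitonProfile s η) (i : Fin N) :
    ∃ C, 0 ≤ C ∧ ∀ w : Space N → ℂ, MemH1 w → normH1 w ≤ 1 → (pair w (pd i η)).im = 0 →
      |(staticPair s (fun y => toC η y + w y) (fun x => x i * η x)).im| ≤ C * normH1 w ^ 2 := by
  have hg := (hη.nice hN hs).coord_mul i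
  obtain ⟨C, hC0, hC⟩ := hη.exists_staticPair_le hN hs hsN hg (hη.controlled_coord i)
  refine ⟨C, hC0, fun w hw hw1 h0 => ?_⟩
  have h := (Complex.abs_im_le_norm _).trans (hC w hw hw1)
  have e : (fun x : Space N => x i * source s η x) =
      fun x => (1 - 1 * η x ^ (2 * s)) * (x i * η x) := by
    funext x
    rw [source, Real.rpow_add (hη.pos x), Real.rpow_one]
    ring
  rw [hη.gradPair_coord hN hs hw, e, hη.pair_one_sub_rpow_mul hN hs hg hw.1] at h
  refine le_trans (le_of_eq ?_) h
  congr 1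
  have e2 : (2 * pair w (pd i η)).im = 0 := by
    have := Complex.im_ofReal_mul 2 (pair w (pd i η))
    rw [h0] at this
    simpa using this
  simp only [Complex.sub_im, Complex.add_im, Complex.neg_im, Complex.im_ofReal_mul,
    Complex.ofReal_im, e2]
  ring

/-! ### Moments of the profile -/

theorem even (hη : IsSolitonProfile s η) (x : Space N) : η (-x) = η x :=
  hη.radial _ _ (norm_neg x)

theorem pd_neg (hη : IsSolitonProfile s η) (i : Fin N) (x : Space N) :
    pd i η (-x) = -pd i η x := by
  have h : (fun x => η (-x)) = η := funext hη.even
  have hd : HasFDerivAt η (fderiv ℝ η (-x)) (-x) :=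
    (hη.contDiff.differentiable (by simp) (-x)).hasFDerivAt
  have h2 : HasFDerivAt η ((fderiv ℝ η (-x)).comp (-ContinuousLinearMap.id ℝ (Space N))) x := by
    have := hd.comp x (hasFDerivAt_id x).neg
    rwa [show η ∘ Neg.neg = η from h] at this
  rw [pd, pd, h2.fderiv]
  simp

theorem scaling_neg (hη : IsSolitonProfile s η) (x : Space N) :
    scaling s η (-x) = scaling s η x := by
  simp only [scaling, hη.even, hη.pd_neg, PiLp.neg_apply, neg_mul_neg]

theorem integral_eq_zero_of_odd {f : Space N → ℝ} (h : ∀ x, f (-x) = -f x) : ∫ x, f x = 0 := by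
  have h1 := integral_neg_eq_self f (volume : Measure (Space N))
  simp only [h, integral_neg] at h1
  linarith

theorem integral_mul_pd (hη : IsSolitonProfile s η) (i : Fin N) :
    ∫ x, η x * pd i η x = 0 :=
  integral_eq_zero_of_odd fun x => by rw [hη.even, hη.pd_neg]; ring

theorem integral_mul_coord (hη : IsSolitonProfile s η) (i : Fin N) :
    ∫ x, η x * (x i * η x) = 0 :=
  integral_eq_zero_of_odd fun x => by rw [hη.even, PiLp.neg_apply]; ring

theorem integral_mul_coord_scaling (hη : IsSolitonProfile s η) (i : Fin N) :
    ∫ x, η x * (x i * scaling s η x) = 0 :=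
  integral_eq_zero_of_odd fun x => by rw [hη.even, hη.scaling_neg, PiLp.neg_apply]; ring

/-- Integration by parts reproduces the same integral with opposite sign, which determines it. -/
theorem integral_mul_coord_pd (hN : 1 ≤ N) (hs : 0 < s) (hη : IsSolitonProfile s η)
    (i k : Fin N) :
    ∫ x, η x * (x i * pd k η x) = if k = i then -(1 / 2) * ∫ x, η x * η x else 0 := by
  have n0 := hη.nice hN hs
  have h := integral_pd_mul n0 (n0.coord_mul i) k
  rw [pd_coord_mul n0.contDiff] at h
  have e1 : ∀ x, pd k η x * (x i * η x) = η x * (x i * pd k η x) := fun x => by ring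
  simp only [e1, mul_add] at h
  have j1 : Integrable (fun x => η x * (x i * pd k η x)) :=
    (n0.rapid.mul ((n0.rapid_pd k).coord_mul i)).integrable
      (n0.continuous.mul ((contDiff_coord i).continuous.mul (n0.continuous_pd k)))
  have j2 : Integrable (fun x => η x * η x) :=
    (n0.rapid.mul n0.rapid).integrable (n0.continuous.mul n0.continuous)
  split_ifs with hki
  · simp only [hki, if_true] at h j1 ⊢
    rw [integral_add j2 j1] at h
    linarith
  · simp only [hki, if_false, mul_zero, zero_add] at h
    linarith

theorem integral_mul_scaling (hN : 1 ≤ N) (hs : 0 < s) (hη : IsSolitonProfile s η) :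
    ∫ x, η x * scaling s η x = 1 / 2 * (1 / s - N / 2) * ∫ x, η x * η x := by
  have n0 := hη.nice hN hs
  have j1 : ∀ k ∈ (Finset.univ : Finset (Fin N)), Integrable (fun x => η x * (x k * pd k η x)) :=
    fun k _ => (n0.rapid.mul ((n0.rapid_pd k).coord_mul k)).integrable
      (n0.continuous.mul ((contDiff_coord k).continuous.mul (n0.continuous_pd k)))
  have j2 : Integrable (fun x => η x * η x) :=
    (n0.rapid.mul n0.rapid).integrable (n0.continuous.mul n0.continuous)
  have e : (fun x => η x * scaling s η x) = fun x => 1 / (2 * s) * (η x * η x) +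
      1 / 2 * ∑ k, η x * (x k * pd k η x) := by
    funext x
    rw [scaling, ← Finset.mul_sum]
    ring
  rw [e, integral_add (j2.const_mul _) ((integrable_finsetSum _ j1).const_mul _),
    integral_const_mul, integral_const_mul, integral_finsetSum _ j1]
  simp only [hη.integral_mul_coord_pd hN hs, if_true, Finset.sum_const, Finset.card_univ,
    Fintype.card_fin, nsmul_eq_mul]
  field_simp
  ring

theorem integral_sq_pos (hN : 1 ≤ N) (hs : 0 < s) (hη : IsSolitonProfile s η) :
    0 < ∫ x, η x * η x := by
  have n0 := hη.nice hN hs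
  have j2 : Integrable (fun x => η x * η x) :=
    (n0.rapid.mul n0.rapid).integrable (n0.continuous.mul n0.continuous)
  refine (integral_pos_iff_support_of_nonneg (fun x => (mul_self_nonneg _)) j2).2 ?_
  have : Function.support (fun x => η x * η x) = univ := by
    ext x; simp [(hη.pos x).ne']
  rw [this]
  exact isOpen_univ.measure_pos _ univ_nonempty

theorem mass_eq (hs : 0 < s) {μ : ℝ} (hμ : 0 < μ) :
    mass s η μ = 1 / 2 * (massFactor N s μ * ∫ x, η x * η x) := by
  have h := integral_trans_mul_conj (N := N) hs (σ := ⟨0, 0, 0, μ⟩) hμ (toC η) (toC η)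
  have e1 : ∀ z : ℂ, z * conj z = ((‖z‖ ^ 2 : ℝ) : ℂ) := fun z => by
    rw [Complex.mul_conj, Complex.normSq_eq_norm_sq]
  have e2 : ∀ y, ‖toC η y‖ ^ 2 = η y * η y := fun y => by
    rw [toC_apply, Complex.norm_real, Real.norm_eq_abs, sq_abs, sq]
  simp only [e1, e2] at h
  rw [integral_complex_ofReal, integral_complex_ofReal] at h
  rw [mass, soliton]
  congr 1
  exact_mod_cast h

theorem mass_one (hs : 0 < s) : mass s η 1 = 1 / 2 * ∫ x, η x * η x := by
  rw [mass_eq hs one_pos, massFactor, Real.one_rpow, one_mul]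

theorem deriv_mass_one (hs : 0 < s) :
    deriv (mass s η) 1 = 1 / 2 * (1 / s - N / 2) * ∫ x, η x * η x := by
  have h : HasDerivAt (fun μ : ℝ => 1 / 2 * (massFactor N s μ * ∫ x, η x * η x))
      (1 / 2 * ((1 / s - N / 2) * ∫ x, η x * η x)) 1 := by
    have := (Real.hasDerivAt_rpow_const (x := 1) (p := 1 / s - (N : ℝ) / 2) (Or.inl one_ne_zero))
    rw [Real.one_rpow, mul_one] at this
    exact (this.mul_const _).const_mul _
  have h' : HasDerivAt (mass s η) (1 / 2 * ((1 / s - N / 2) * ∫ x, η x * η x)) 1 := by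
    refine h.congr_of_eventuallyEq ?_
    filter_upwards [eventually_gt_nhds (zero_lt_one (α := ℝ))] with μ hμ using mass_eq hs hμ
  rw [h'.deriv]
  ring

end IsSolitonProfile

end

noncomputable section

/-! ### The perturbation in the moving frame -/

theorem quasiMeasurePreserving_affine {N : ℕ} {r : ℝ} (hr : r ≠ 0) (a : Space N) :
    Measure.QuasiMeasurePreserving (fun y : Space N => r • y + a) volume volume := by
  refine ⟨by fun_prop, ?_⟩
  have h1 : Measure.map (fun y : Space N => r • y + a) volume =
      Measure.map (fun y : Space N => y + a) (Measure.map (fun y : Space N => r • y) volume) := by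
    rw [Measure.map_map (by fun_prop) (by fun_prop)]; rfl
  rw [h1, Measure.map_addHaar_smul _ hr, Measure.map_smul,
    (measurePreserving_add_right volume a).map_eq]
  exact Measure.smul_absolutelyContinuous

theorem aestronglyMeasurable_frameLam {N : ℕ} {lam : Space N → ℝ} (hlam : MemLp lam ⊤ volume)
    {σ : Param N} (hμ : 0 < σ.μ) : AEStronglyMeasurable (frameLam lam σ) :=
  hlam.1.comp_quasiMeasurePreserving
    (quasiMeasurePreserving_affine (inv_pos.2 (Real.sqrt_pos.2 hμ)).ne' σ.a)

/-- Affine maps preserve null sets, so the essential bound of the potential holds in every frame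
with a constant independent of `σ`. -/
theorem abs_frameLam_le {N : ℕ} {lam : Space N → ℝ} (hlam : MemLp lam ⊤ volume)
    {σ : Param N} (hμ : 0 < σ.μ) :
    ∀ᵐ y, |frameLam lam σ y| ≤ (eLpNorm lam ⊤ volume).toReal := by
  have h : ∀ᵐ x, |lam x| ≤ (eLpNorm lam ⊤ volume).toReal := by
    filter_upwards [enorm_ae_le_eLpNormEssSup lam volume] with x hx
    rw [← eLpNorm_exponent_top] at hx
    have := ENNReal.toReal_mono hlam.eLpNorm_ne_top hx
    simpa using this
  exact (quasiMeasurePreserving_affine (inv_pos.2 (Real.sqrt_pos.2 hμ)).ne' σ.a).ae h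

/-- The perturbation of the soliton profile, paired with a real function. -/
def pertProfile {N : ℕ} (p : ℝ) (η l g : Space N → ℝ) : ℂ :=
  ∫ x, (l x : ℂ) * ((η x ^ (2 * p + 1) : ℝ) : ℂ) * (g x : ℂ)

theorem pertProfile_im {N : ℕ} (p : ℝ) (η l g : Space N → ℝ) : (pertProfile p η l g).im = 0 := by
  have : pertProfile p η l g = ((∫ x, l x * η x ^ (2 * p + 1) * g x : ℝ) : ℂ) := by
    rw [pertProfile, ← integral_complex_ofReal]
    congr 1; funext x; push_cast; ring
  rw [this, Complex.ofReal_im]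

theorem sympl_perturbation_toC {N : ℕ} (p : ℝ) (η l g : Space N → ℝ) :
    sympl (fun x => Complex.I * (l x : ℂ) * ((η x ^ (2 * p + 1) : ℝ) : ℂ)) (toC g) =
      (pertProfile p η l g).re := by
  have e : ∀ x, Complex.I * (l x : ℂ) * ((η x ^ (2 * p + 1) : ℝ) : ℂ) * conj (toC g x) =
      Complex.I * ((l x : ℂ) * ((η x ^ (2 * p + 1) : ℝ) : ℂ) * (g x : ℂ)) := fun x => by
    rw [toC_apply, Complex.conj_ofReal]; ring
  simp only [sympl, e]
  rw [integral_const_mul, ← pertProfile]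
  simp

theorem sympl_perturbation_I_mul {N : ℕ} (p : ℝ) (η l g : Space N → ℝ) :
    sympl (fun x => Complex.I * (l x : ℂ) * ((η x ^ (2 * p + 1) : ℝ) : ℂ))
      (fun x => Complex.I * (g x : ℂ)) = 0 := by
  have e : ∀ x, Complex.I * (l x : ℂ) * ((η x ^ (2 * p + 1) : ℝ) : ℂ) *
      conj (Complex.I * (g x : ℂ)) = (l x : ℂ) * ((η x ^ (2 * p + 1) : ℝ) : ℂ) * (g x : ℂ) :=
    fun x => by
      rw [map_mul, Complex.conj_I, Complex.conj_ofReal]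
      linear_combination (-(l x : ℂ) * ((η x ^ (2 * p + 1) : ℝ) : ℂ) * (g x : ℂ)) * Complex.I_mul_I
  simp only [sympl, e]
  exact pertProfile_im p η l g

section LyapunovSchmidt

variable {N : ℕ} {s : ℝ} {η : Space N → ℝ} (p : ℝ) (l : Space N → ℝ)

/-- The projected perturbation is `i` times a real function, so its symplectic pairing with the
imaginary generators vanishes. Hence only the boost and gauge components of `P` feel the
perturbation. -/
theorem lyapunovSchmidt_translation (i : Fin N) :
    lyapunovSchmidt s η (fun x => Complex.I * (l x : ℂ) * ((η x ^ (2 * p + 1) : ℝ) : ℂ))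
      (.inl i) = 0 := by
  have : gen s (.inr (.inl i)) (toC η) = fun x => Complex.I * ((x i * η x : ℝ) : ℂ) := by
    funext x
    simp only [gen, toC_apply]
    push_cast; ring
  rw [lyapunovSchmidt, coeffs, Sum.elim_inl, this,
    sympl_perturbation_I_mul p η l (fun x => x i * η x), mul_zero]

theorem lyapunovSchmidt_boost (hη : ContDiff ℝ 1 η) (i : Fin N) :
    lyapunovSchmidt s η (fun x => Complex.I * (l x : ℂ) * ((η x ^ (2 * p + 1) : ℝ) : ℂ))
      (.inr (.inl i)) = -(1 / mass s η 1 * (pertProfile p η l (pd i η)).re) := by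
  rw [lyapunovSchmidt, coeffs, Sum.elim_inr, Sum.elim_inl, gen_translation_toC s hη,
    sympl_perturbation_toC]
  have : pertProfile p η l (fun y => -pd i η y) = -pertProfile p η l (pd i η) := by
    rw [pertProfile, pertProfile, ← integral_neg]
    congr 1; funext x; push_cast; ring
  rw [this, Complex.neg_re]
  ring

theorem lyapunovSchmidt_gauge (hη : ContDiff ℝ 1 η) :
    lyapunovSchmidt s η (fun x => Complex.I * (l x : ℂ) * ((η x ^ (2 * p + 1) : ℝ) : ℂ))
      (.inr (.inr 0)) = 1 / deriv (mass s η) 1 * (pertProfile p η l (scaling s η)).re := by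
  simp only [lyapunovSchmidt, coeffs, Sum.elim_inr, Matrix.cons_val_zero]
  rw [gen_scaling_toC s hη, sympl_perturbation_toC]

theorem lyapunovSchmidt_scaling :
    lyapunovSchmidt s η (fun x => Complex.I * (l x : ℂ) * ((η x ^ (2 * p + 1) : ℝ) : ℂ))
      (.inr (.inr 1)) = 0 := by
  simp only [lyapunovSchmidt, coeffs, Sum.elim_inr, Matrix.cons_val_one, Matrix.cons_val_fin_one]
  have : gen s (.inr (.inr 0)) (toC η) = fun x => Complex.I * ((η x : ℝ) : ℂ) := rfl
  rw [this, sympl_perturbation_I_mul, mul_zero]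

end LyapunovSchmidt

namespace IsSolitonProfile

variable {N : ℕ} {s : ℝ} {η : Space N → ℝ}

theorem exists_pertPair_sub_le (hN : 1 ≤ N) (hs : 0 < s) (hη : IsSolitonProfile s η) {p : ℝ}
    (hp : 0 ≤ p) (hpN : 3 ≤ N → p < 2 / ((N : ℝ) - 2)) (L : ℝ) {g : Space N → ℝ} (hg : Nice g) :
    ∃ C, 0 ≤ C ∧ ∀ l : Space N → ℝ, AEStronglyMeasurable l → (∀ᵐ x, |l x| ≤ L) →
      ∀ w : Space N → ℂ, MemH1 w → normH1 w ≤ 1 →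
      ‖pertPair p l (fun y => toC η y + w y) g - pertProfile p η l g‖ ≤ C * normH1 w := by
  obtain ⟨C, hC0, hC⟩ := hη.exists_lipschitz_bound hN hs hp hpN L hg.continuous hg.rapid
  refine ⟨C, hC0, fun l hl hlL w hw hw1 => ?_⟩
  obtain ⟨i1, b⟩ := hC l hl hlL w hw hw1
  have i2 := hη.integrable_perturbation hN hs hp hg.continuous hg.rapid hl hlL
  have e : pertPair p l (fun y => toC η y + w y) g = (∫ x, (l x : ℂ) *
      (powNL p (toC η x + w x) - ((η x ^ (2 * p + 1) : ℝ) : ℂ)) * (g x : ℂ)) +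
        pertProfile p η l g := by
    rw [pertProfile, ← integral_add i1 i2, pertPair]
    congr 1; funext x; ring
  rw [e, add_sub_cancel_right]
  exact b

/-- Boundedness of the projected perturbation. -/
theorem exists_lyapunovSchmidt_le (hN : 1 ≤ N) (hs : 0 < s) (hη : IsSolitonProfile s η) {p : ℝ}
    (hp : 0 ≤ p) (L : ℝ) : ∃ C, 0 ≤ C ∧ ∀ l : Space N → ℝ, (∀ᵐ x, |l x| ≤ L) →
      ‖lyapunovSchmidt s η
        (fun x => Complex.I * (l x : ℂ) * ((η x ^ (2 * p + 1) : ℝ) : ℂ))‖ ≤ C := by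
  have n0 := hη.nice hN hs
  have n1 := hη.nice_pd hN hs
  have n2 := hη.nice_scaling hN hs
  choose B hB0 hB using fun i =>
    hη.norm_integral_perturbation_le hN hs hp L (n1 i).continuous (n1 i).rapid
  obtain ⟨D, hD0, hD⟩ := hη.norm_integral_perturbation_le hN hs hp L n2.continuous n2.rapid
  have S0 := Finset.sum_nonneg fun i (_ : i ∈ (Finset.univ : Finset (Fin N))) => hB0 i
  have A0 : 0 ≤ |1 / mass s η 1| * ∑ i, B i := mul_nonneg (abs_nonneg _) S0
  have A1 : 0 ≤ |1 / deriv (mass s η) 1| * D := by positivity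
  refine ⟨|1 / mass s η 1| * ∑ i, B i + |1 / deriv (mass s η) 1| * D, add_nonneg A0 A1,
    fun l hl => (pi_norm_le_iff_of_nonneg (add_nonneg A0 A1)).2 ?_⟩
  rintro (i | i | i)
  · rw [lyapunovSchmidt_translation, norm_zero]
    exact add_nonneg A0 A1
  · rw [lyapunovSchmidt_boost p l n0.contDiff, norm_neg, Real.norm_eq_abs, abs_mul]
    have h := (Complex.abs_re_le_norm _).trans (hB i l hl)
    have h' := h.trans (Finset.single_le_sum (fun j _ => hB0 j) (Finset.mem_univ i))
    exact le_add_of_le_of_nonneg (mul_le_mul_of_nonneg_left h' (abs_nonneg _)) A1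
  · fin_cases i
    · simp only [Fin.zero_eta]
      rw [lyapunovSchmidt_gauge p l n0.contDiff, Real.norm_eq_abs, abs_mul]
      have h := (Complex.abs_re_le_norm _).trans (hD l hl)
      exact le_add_of_nonneg_of_le A0 (mul_le_mul_of_nonneg_left h (abs_nonneg _))
    · simp only [Fin.mk_one]
      rw [lyapunovSchmidt_scaling, norm_zero]
      exact add_nonneg A0 A1

/-! ### The tangential pairing of the profile with the generators -/

/-- Each test profile isolates the symplectically conjugate coefficient: `∂_k η` the boost, `Λη` the
gauge, `x_k η` the translation and `η` the scaling. All other moments vanish by parity or by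
`integral_mul_coord_pd`. -/
theorem tangentPair_pd_im (hN : 1 ≤ N) (hs : 0 < s) (hη : IsSolitonProfile s η) (X : LieAlg N)
    (k : Fin N) :
    (tangentPair s X (toC η) (pd k η)).im = -(mass s η 1 * X (.inr (.inl k))) := by
  simp only [tangentPair, pair_toC, hη.integral_mul_pd, hη.integral_mul_coord_pd hN hs]
  simp only [← Complex.ofReal_mul, ← Complex.ofReal_sum, ← Complex.ofReal_sub,
    ← Complex.ofReal_add]
  rw [Complex.add_im, Complex.ofReal_im, Complex.I_mul_im, Complex.ofReal_re, mass_one hs]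
  simp
  ring

theorem tangentPair_scaling_im (hN : 1 ≤ N) (hs : 0 < s) (hη : IsSolitonProfile s η)
    (X : LieAlg N) :
    (tangentPair s X (toC η) (scaling s η)).im = deriv (mass s η) 1 * X (.inr (.inr 0)) := by
  simp only [tangentPair, pair_toC, hη.integral_mul_coord_scaling,
    hη.integral_mul_scaling hN hs]
  simp only [← Complex.ofReal_mul, ← Complex.ofReal_sum, ← Complex.ofReal_sub,
    ← Complex.ofReal_add]
  rw [Complex.add_im, Complex.ofReal_im, Complex.I_mul_im, Complex.ofReal_re, deriv_mass_one hs]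
  simp
  ring

theorem tangentPair_coord_re (hN : 1 ≤ N) (hs : 0 < s) (hη : IsSolitonProfile s η) (X : LieAlg N)
    (k : Fin N) :
    (tangentPair s X (toC η) (fun y => y k * η y)).re = mass s η 1 * X (.inl k) := by
  have n0 := hη.nice hN hs
  have e1 : ∀ i, ∫ x, η x * pd i (fun y => y k * η y) x =
      if i = k then 1 / 2 * ∫ x, η x * η x else 0 := fun i => by
    have h := integral_pd_mul n0 (n0.coord_mul k) i
    have e : ∀ x, pd i η x * (x k * η x) = η x * (x k * pd i η x) := fun x => by ring
    simp only [e, hη.integral_mul_coord_pd hN hs] at h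
    split_ifs at h ⊢ <;> linarith
  have e2 : ∫ x, η x * scaling s (fun y => y k * η y) x = 0 := by
    refine integral_eq_zero_of_odd fun x => ?_
    have : ∀ i, (-x : Space N) i * pd i (fun y => y k * η y) (-x) =
        -(x i * pd i (fun y => y k * η y) x) := fun i => by
      rw [pd_coord_mul n0.contDiff]
      simp only [hη.even, hη.pd_neg, PiLp.neg_apply]
      ring
    rw [scaling, scaling, Finset.sum_congr rfl fun i _ => this i, Finset.sum_neg_distrib]
    simp only [hη.even, PiLp.neg_apply]
    ring
  simp only [tangentPair, pair_toC, e1, e2]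
  simp only [← Complex.ofReal_mul, ← Complex.ofReal_sum, ← Complex.ofReal_sub,
    ← Complex.ofReal_add]
  rw [Complex.add_re, Complex.ofReal_re, Complex.I_mul_re, Complex.ofReal_im, mass_one hs]
  simp
  ring

theorem tangentPair_self_re (hN : 1 ≤ N) (hs : 0 < s) (hη : IsSolitonProfile s η)
    (X : LieAlg N) :
    (tangentPair s X (toC η) η).re = -(deriv (mass s η) 1 * X (.inr (.inr 1))) := by
  simp only [tangentPair, pair_toC, hη.integral_mul_pd, hη.integral_mul_scaling hN hs]
  simp only [← Complex.ofReal_mul, ← Complex.ofReal_sum, ← Complex.ofReal_sub,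
    ← Complex.ofReal_add]
  rw [Complex.add_re, Complex.ofReal_re, Complex.I_mul_re, Complex.ofReal_im, deriv_mass_one hs]
  simp
  ring

end IsSolitonProfile

end

noncomputable section

/-! ### Modulation equations -/

/-- A solution together with a differentiable skew-orthogonal decomposition. -/
structure IsDecomposition {N : ℕ} (s st : ℝ) (lam η : Space N → ℝ) (ε T : ℝ)
    (ψ : ℝ → Space N → ℂ) (σ : ℝ → Param N) : Prop where
  eps_nonneg : 0 ≤ ε
  time_pos : 0 < T
  solution : IsNLSSolution s st lam ε T ψ
  path : IsDifferentiablePath T σ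
  pos : ∀ t ∈ Icc 0 T, 0 < (σ t).μ
  skew : ∀ t ∈ Icc 0 T, IsSkewOrthogonal s η (ψ t) (σ t)

namespace IsDecomposition

variable {N : ℕ} {s st : ℝ} {lam η : Space N → ℝ} {ε T : ℝ} {ψ : ℝ → Space N → ℂ}
  {σ : ℝ → Param N}

theorem memH1_fluctuation (hN : 1 ≤ N) (hs : 0 < s) (hη : IsSolitonProfile s η)
    (h : IsDecomposition s st lam η ε T ψ σ) {t : ℝ} (ht : t ∈ Icc 0 T) :
    MemH1 (fluctuation s η (ψ t) (σ t)) :=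
  ((h.solution.memH1 t ht).sub ((hη.nice hN hs).memH1_toC.trans (h.pos t ht))).transInv (h.pos t ht)

theorem eq_trans (h : IsDecomposition s st lam η ε T ψ σ) {t : ℝ} (ht : t ∈ Icc 0 T) :
    ψ t = trans s (σ t) (fun y => toC η y + fluctuation s η (ψ t) (σ t) y) := by
  rw [← fluctuation_eq η (ψ t) (h.pos t ht), trans_transInv s _ (h.pos t ht)]

theorem integral_eq (hN : 1 ≤ N) (hs : 0 < s) (hη : IsSolitonProfile s η)
    (h : IsDecomposition s st lam η ε T ψ σ) {g : Space N → ℝ} (hg : Nice g) {t : ℝ}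
    (ht : t ∈ Icc 0 T) :
    ∫ x, ψ t x * conj (trans s (σ t) (toC g) x) = massFactor N s (σ t).μ *
      (((∫ x, η x * g x : ℝ) : ℂ) + pair (fluctuation s η (ψ t) (σ t)) g) := by
  have h1 := integral_trans_mul_conj_toC hs (h.pos t ht)
    (fun y => toC η y + fluctuation s η (ψ t) (σ t) y) g
  rw [← h.eq_trans ht, pair_add_left (hη.nice hN hs).memH1_toC.1
    (h.memH1_fluctuation hN hs hη ht).1 hg.memLp, pair_toC] at h1
  exact h1

theorem hasDerivWithinAt (hN : 1 ≤ N) (hs : 0 < s) (hη : IsSolitonProfile s η)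
    (h : IsDecomposition s st lam η ε T ψ σ) {g : Space N → ℝ} (hg : Nice g) {t : ℝ}
    (ht : t ∈ Icc 0 T) :
    HasDerivWithinAt (fun r => ∫ x, ψ r x * conj (trans s (σ r) (toC g) x))
      (massFactor N s (σ t).μ * (-Complex.I * ((σ t).μ *
          staticPair s (fun y => toC η y + fluctuation s η (ψ t) (σ t) y) g
        + (ε * (σ t).μ ^ (st / s) : ℝ) * pertPair st (frameLam lam (σ t))
          (fun y => toC η y + fluctuation s η (ψ t) (σ t) y) g)
        + (tangentPair s (Xtilde T σ t) (toC η) g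
          + tangentPair s (Xtilde T σ t) (fluctuation s η (ψ t) (σ t)) g))) (Icc 0 T) t := by
  have n0 := (hη.nice hN hs).memH1_toC
  have hw := h.memH1_fluctuation hN hs hη ht
  rw [← tangentPair_add s _ n0.1 hw.1 hg]
  exact hasDerivWithinAt_pair_trans hs h.solution h.path h.pos hg ht (n0.add hw) (h.eq_trans ht)

theorem uniqueDiff (h : IsDecomposition s st lam η ε T ψ σ) {t : ℝ} (ht : t ∈ Icc 0 T) :
    UniqueDiffWithinAt ℝ (Icc 0 T) t := uniqueDiffOn_Icc h.time_pos t ht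

/-- The modulation equation of a real generator. -/
theorem modulation_im (hN : 1 ≤ N) (hs : 0 < s) (hη : IsSolitonProfile s η)
    (h : IsDecomposition s st lam η ε T ψ σ) {g : Space N → ℝ} (hg : Nice g)
    (h0 : ∀ t ∈ Icc 0 T, (pair (fluctuation s η (ψ t) (σ t)) g).im = 0) {t : ℝ}
    (ht : t ∈ Icc 0 T) :
    (tangentPair s (Xtilde T σ t) (toC η) g).im =
      (σ t).μ * (staticPair s (fun y => toC η y + fluctuation s η (ψ t) (σ t) y) g).re
      + ε * (σ t).μ ^ (st / s) * (pertPair st (frameLam lam (σ t))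
          (fun y => toC η y + fluctuation s η (ψ t) (σ t) y) g).re
      - (tangentPair s (Xtilde T σ t) (fluctuation s η (ψ t) (σ t)) g).im := by
  have d := Complex.imCLM.hasFDerivAt.comp_hasDerivWithinAt t (h.hasDerivWithinAt hN hs hη hg ht)
  -- By the constraint the imaginary part is identically zero on `[0, T]`; its derivative is unique
  -- because the interval is nondegenerate.
  have z : HasDerivWithinAt (Complex.imCLM ∘ fun r =>
      ∫ x, ψ r x * conj (trans s (σ r) (toC g) x)) 0 (Icc 0 T) t := by
    refine (hasDerivWithinAt_const t (Icc 0 T) (0 : ℝ)).congr_of_mem (fun r hr => ?_) ht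
    simp only [Function.comp_apply, Complex.imCLM_apply]
    rw [h.integral_eq hN hs hη hg hr, Complex.im_ofReal_mul, Complex.add_im, Complex.ofReal_im,
      h0 r hr, add_zero, mul_zero]
  have e := (h.uniqueDiff ht).eq_deriv _ d z
  rw [Complex.imCLM_apply, Complex.im_ofReal_mul, neg_mul, Complex.add_im, Complex.neg_im,
    Complex.I_mul_im, Complex.add_re, Complex.re_ofReal_mul, Complex.re_ofReal_mul,
    Complex.add_im] at e
  have := (mul_eq_zero.1 e).resolve_left (massFactor_pos N s (h.pos t ht)).ne'
  linarith

/-- The modulation equation of an imaginary generator. -/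
theorem modulation_re (hN : 1 ≤ N) (hs : 0 < s) (hη : IsSolitonProfile s η)
    (h : IsDecomposition s st lam η ε T ψ σ) {g : Space N → ℝ} (hg : Nice g)
    (h0 : ∀ t ∈ Icc 0 T, (pair (fluctuation s η (ψ t) (σ t)) g).re = 0) {t : ℝ}
    (ht : t ∈ Icc 0 T) :
    (tangentPair s (Xtilde T σ t) (toC η) g).re =
      -((1 / s - N / 2) * Xtilde T σ t (.inr (.inr 1)) * ∫ x, η x * g x)
      - (σ t).μ * (staticPair s (fun y => toC η y + fluctuation s η (ψ t) (σ t) y) g).im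
      - ε * (σ t).μ ^ (st / s) * (pertPair st (frameLam lam (σ t))
          (fun y => toC η y + fluctuation s η (ψ t) (σ t) y) g).im
      - (tangentPair s (Xtilde T σ t) (fluctuation s η (ψ t) (σ t)) g).re := by
  have hμ := h.pos t ht
  have d := Complex.reCLM.hasFDerivAt.comp_hasDerivWithinAt t (h.hasDerivWithinAt hN hs hη hg ht)
  have eX : Xtilde T σ t (.inr (.inr 1)) =
      -(derivWithin (fun r => (σ r).μ) (Icc 0 T) t / (σ t).μ) := by
    simp [Xtilde, velocity, coeffs]
  -- The real part need not be constant: it equals `massFactor` times `∫ η g` and varies with `μ`,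
  -- which explains the additional scaling term in this equation.
  have z : HasDerivWithinAt (Complex.reCLM ∘ fun r =>
      ∫ x, ψ r x * conj (trans s (σ r) (toC g) x))
      (massFactor N s (σ t).μ * (-((1 / s - N / 2) * Xtilde T σ t (.inr (.inr 1)) *
        ∫ x, η x * g x))) (Icc 0 T) t := by
    have m := ((h.path.μ t ht).hasDerivWithinAt.rpow_const (p := 1 / s - (N : ℝ) / 2)
      (Or.inl hμ.ne')).mul_const (∫ x, η x * g x)
    have m' := m.congr_of_mem (f₁ := Complex.reCLM ∘ fun r =>
      ∫ x, ψ r x * conj (trans s (σ r) (toC g) x)) (fun r hr => by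
        simp only [Function.comp_apply, Complex.reCLM_apply]
        rw [h.integral_eq hN hs hη hg hr, Complex.re_ofReal_mul, Complex.add_re,
          Complex.ofReal_re, h0 r hr, add_zero]
        rfl) ht
    refine m'.congr_deriv ?_
    rw [eX, Real.rpow_sub_one hμ.ne', massFactor]
    field_simp
  have e := (h.uniqueDiff ht).eq_deriv _ d z
  rw [Complex.reCLM_apply, Complex.re_ofReal_mul, neg_mul, Complex.add_re, Complex.neg_re,
    Complex.I_mul_re, Complex.add_im, Complex.im_ofReal_mul, Complex.im_ofReal_mul,
    Complex.add_re] at e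
  have := mul_left_cancel₀ (massFactor_pos N s hμ).ne' e
  linarith

theorem pair_eq_zero (hN : 1 ≤ N) (hs : 0 < s) (hη : IsSolitonProfile s η)
    (h : IsDecomposition s st lam η ε T ψ σ) {t : ℝ} (ht : t ∈ Icc 0 T) :
    (pair (fluctuation s η (ψ t) (σ t)) η).re = 0 ∧
      (∀ i, (pair (fluctuation s η (ψ t) (σ t)) (fun y => y i * η y)).re = 0) ∧
      (∀ i, (pair (fluctuation s η (ψ t) (σ t)) (pd i η)).im = 0) ∧
      (pair (fluctuation s η (ψ t) (σ t)) (scaling s η)).im = 0 :=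
  (h.skew t ht).pair_eq_zero hN hs hη (h.pos t ht) rfl (h.memH1_fluctuation hN hs hη ht).1

theorem Yelem_apply (t : ℝ) (α : Idx N) : Yelem s st lam η ε T σ t α = Xtilde T σ t α -
    ε * (σ t).μ ^ (st / s) * lyapunovSchmidt s η (fun x => Complex.I *
      (frameLam lam (σ t) x : ℂ) * ((η x ^ (2 * st + 1) : ℝ) : ℂ)) α := rfl

/-- The right-hand side of the estimates for the components of `Y`. -/
def errorBound (s st : ℝ) (η : Space N → ℝ) (ε T : ℝ) (ψ : ℝ → Space N → ℂ) (σ : ℝ → Param N)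
    (t : ℝ) : ℝ :=
  ‖Xtilde T σ t‖ * normH1 (fluctuation s η (ψ t) (σ t))
    + (σ t).μ * normH1 (fluctuation s η (ψ t) (σ t)) ^ 2
    + ε * (σ t).μ ^ (st / s) * normH1 (fluctuation s η (ψ t) (σ t))

/-- Common last step for all components: `κ` is `m(1)` or `m'(1)`, `a` the static term, `b` the
perturbation error and `d` the term of `Xtilde` against the fluctuation. -/
theorem combine_bounds {κ y A B D n X μ e a b d : ℝ} (hκ : κ ≠ 0) (hA : 0 ≤ A) (hB : 0 ≤ B)
    (hD : 0 ≤ D) (hn : 0 ≤ n) (hX : 0 ≤ X) (hμ : 0 ≤ μ) (he : 0 ≤ e)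
    (ha : |a| ≤ A * n ^ 2) (hb : |b| ≤ B * n) (hd : |d| ≤ D * (X * n))
    (h : |κ * y| = |μ * a + e * b - d|) :
    |y| ≤ (A + B + D) / |κ| * (X * n + μ * n ^ 2 + e * n) := by
  have hκ' : 0 < |κ| := abs_pos.2 hκ
  rw [div_mul_eq_mul_div, le_div_iff₀ hκ', mul_comm, ← abs_mul, h]
  have h1 : |μ * a + e * b - d| ≤ μ * (A * n ^ 2) + e * (B * n) + D * (X * n) := by
    refine (abs_sub _ _).trans (add_le_add ((abs_add_le _ _).trans ?_) hd)
    rw [abs_mul, abs_mul, abs_of_nonneg hμ, abs_of_nonneg he]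
    gcongr
  refine h1.trans ?_
  have p1 : 0 ≤ X * n := by positivity
  have p2 : 0 ≤ μ * n ^ 2 := by positivity
  have p3 : 0 ≤ e * n := by positivity
  nlinarith [mul_nonneg hA p1, mul_nonneg hA p3, mul_nonneg hB p1, mul_nonneg hB p2,
    mul_nonneg hD p2, mul_nonneg hD p3]

end IsDecomposition

end

/-! ### Estimates for the components of `Y`, and absorption -/

noncomputable section

namespace IsDecomposition

variable {N : ℕ} {s st : ℝ} {lam η : Space N → ℝ}

theorem errorBound_nonneg {ε T : ℝ} {ψ : ℝ → Space N → ℂ} {σ : ℝ → Param N}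
    (h : IsDecomposition s st lam η ε T ψ σ) {t : ℝ} (ht : t ∈ Icc 0 T) :
    0 ≤ errorBound s st η ε T ψ σ t := by
  have := h.eps_nonneg
  have := h.pos t ht
  have := normH1_nonneg (fluctuation s η (ψ t) (σ t))
  unfold errorBound
  positivity

/-- Each component of `Y` is controlled by the error terms. -/
theorem exists_component_le (hN : 1 ≤ N) (hs : 0 < s) (hsN : s < 2 / (N : ℝ)) (hst0 : 0 ≤ st)
    (hst : 3 ≤ N → st < 2 / ((N : ℝ) - 2)) (hlam : MemLp lam ⊤ volume)
    (hη : IsSolitonProfile s η) (α : Idx N) :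
    ∃ C, 0 ≤ C ∧ ∀ (ε T : ℝ) (ψ : ℝ → Space N → ℂ) (σ : ℝ → Param N),
      IsDecomposition s st lam η ε T ψ σ → ∀ t ∈ Icc 0 T,
      normH1 (fluctuation s η (ψ t) (σ t)) ≤ 1 →
      |Yelem s st lam η ε T σ t α| ≤ C * errorBound s st η ε T ψ σ t := by
  set L := (eLpNorm lam ⊤ volume).toReal
  have n0 := hη.nice hN hs
  have n1 := hη.nice_pd hN hs
  have n2 := hη.nice_scaling hN hs
  have nx := fun i => n0.coord_mul i
  have M0 := hη.integral_sq_pos hN hs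
  have N0 : (0 : ℝ) < N := by exact_mod_cast hN
  have hm : mass s η 1 ≠ 0 := by
    rw [IsSolitonProfile.mass_one hs]; positivity
  -- Mass subcriticality `s < 2 / N` enters here: `m'(1)` is a positive multiple of `1 / s - N / 2`.
  have hm' : deriv (mass s η) 1 ≠ 0 := by
    rw [IsSolitonProfile.deriv_mass_one hs]
    have : (N : ℝ) / 2 < 1 / s := by
      rw [div_lt_div_iff₀ two_pos hs, one_mul, mul_comm]
      exact (lt_div_iff₀ N0).1 hsN
    have : 0 < 1 / s - (N : ℝ) / 2 := by linarith
    positivity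
  rcases α with k | k | k
  -- Translation coefficient, tested with `x_k η`. The perturbation at the profile is real and does
  -- not enter the imaginary part, in accordance with the vanishing component of `P`.
  · obtain ⟨A, hA0, hA⟩ := hη.exists_im_staticPair_coord_le hN hs hsN k
    obtain ⟨B, hB0, hB⟩ := hη.exists_pertPair_sub_le hN hs hst0 hst L (nx k)
    obtain ⟨D, hD0, hD⟩ := (nx k).exists_tangentPair_le s
    refine ⟨(A + B + D) / |mass s η 1|, by positivity, fun ε T ψ σ h t ht hn => ?_⟩
    have hw := h.memH1_fluctuation hN hs hη ht
    have hμ := h.pos t ht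
    have e := h.modulation_re hN hs hη (nx k) (fun r hr => (h.pair_eq_zero hN hs hη hr).2.1 k) ht
    rw [hη.integral_mul_coord, mul_zero, hη.tangentPair_coord_re hN hs] at e
    refine combine_bounds hm hA0 hB0 hD0 (normH1_nonneg _) (norm_nonneg _) hμ.le
      (mul_nonneg h.eps_nonneg (Real.rpow_nonneg hμ.le _))
      (hA _ hw hn ((h.pair_eq_zero hN hs hη ht).2.2.1 k))
      ((Complex.abs_im_le_norm _).trans
        (hB _ (aestronglyMeasurable_frameLam hlam hμ) (abs_frameLam_le hlam hμ) _ hw hn))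
      (d := -(tangentPair s (Xtilde T σ t) (fluctuation s η (ψ t) (σ t))
        (fun y => y k * η y)).re)
      (by rw [abs_neg]; exact (Complex.abs_re_le_norm _).trans (hD _ _ hw)) ?_
    rw [← abs_neg]
    congr 1
    rw [Yelem_apply, lyapunovSchmidt_translation, Complex.sub_im, pertProfile_im]
    linarith
  -- Boost coefficient, tested with `∂_k η`; subtracting the component of `P` removes the
  -- perturbation at the profile exactly.
  · obtain ⟨A, hA0, hA⟩ := hη.exists_re_staticPair_pd_le hN hs hsN k
    obtain ⟨B, hB0, hB⟩ := hη.exists_pertPair_sub_le hN hs hst0 hst L (n1 k)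
    obtain ⟨D, hD0, hD⟩ := (n1 k).exists_tangentPair_le s
    refine ⟨(A + B + D) / |mass s η 1|, by positivity, fun ε T ψ σ h t ht hn => ?_⟩
    have hw := h.memH1_fluctuation hN hs hη ht
    have hμ := h.pos t ht
    have e := h.modulation_im hN hs hη (n1 k)
      (fun r hr => (h.pair_eq_zero hN hs hη hr).2.2.1 k) ht
    rw [hη.tangentPair_pd_im hN hs] at e
    refine combine_bounds hm hA0 hB0 hD0 (normH1_nonneg _) (norm_nonneg _) hμ.le
      (mul_nonneg h.eps_nonneg (Real.rpow_nonneg hμ.le _)) (hA _ hw hn)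
      ((Complex.abs_re_le_norm _).trans
        (hB _ (aestronglyMeasurable_frameLam hlam hμ) (abs_frameLam_le hlam hμ) _ hw hn))
      (d := (tangentPair s (Xtilde T σ t) (fluctuation s η (ψ t) (σ t)) (pd k η)).im)
      ((Complex.abs_im_le_norm _).trans (hD _ _ hw)) ?_
    rw [← abs_neg]
    congr 1
    rw [Yelem_apply, lyapunovSchmidt_boost st _ n0.contDiff, Complex.sub_re]
    have : ∀ c : ℝ, mass s η 1 * (1 / mass s η 1 * c) = c := fun c => by field_simp
    linear_combination e - ε * (σ t).μ ^ (st / s) *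
      this (pertProfile st η (frameLam lam (σ t)) (pd k η)).re
  · fin_cases k
    · simp only [Fin.zero_eta]
      -- Gauge coefficient, tested with `Λη`; the static estimate uses the constraint `Re ⟨w, η⟩ =
      -- 0`.
      obtain ⟨A, hA0, hA⟩ := hη.exists_re_staticPair_scaling_le hN hs hsN
      obtain ⟨B, hB0, hB⟩ := hη.exists_pertPair_sub_le hN hs hst0 hst L n2
      obtain ⟨D, hD0, hD⟩ := n2.exists_tangentPair_le s
      refine ⟨(A + B + D) / |deriv (mass s η) 1|, by positivity, fun ε T ψ σ h t ht hn => ?_⟩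
      have hw := h.memH1_fluctuation hN hs hη ht
      have hμ := h.pos t ht
      have e := h.modulation_im hN hs hη n2
        (fun r hr => (h.pair_eq_zero hN hs hη hr).2.2.2) ht
      rw [hη.tangentPair_scaling_im hN hs] at e
      refine combine_bounds hm' hA0 hB0 hD0 (normH1_nonneg _) (norm_nonneg _) hμ.le
        (mul_nonneg h.eps_nonneg (Real.rpow_nonneg hμ.le _))
        (hA _ hw hn (h.pair_eq_zero hN hs hη ht).1)
        ((Complex.abs_re_le_norm _).trans
          (hB _ (aestronglyMeasurable_frameLam hlam hμ) (abs_frameLam_le hlam hμ) _ hw hn))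
        (d := (tangentPair s (Xtilde T σ t) (fluctuation s η (ψ t) (σ t)) (scaling s η)).im)
        ((Complex.abs_im_le_norm _).trans (hD _ _ hw)) ?_
      congr 1
      rw [Yelem_apply, lyapunovSchmidt_gauge st _ n0.contDiff, Complex.sub_re]
      have : ∀ c : ℝ, deriv (mass s η) 1 * (1 / deriv (mass s η) 1 * c) = c :=
        fun c => by field_simp
      linear_combination e - ε * (σ t).μ ^ (st / s) *
        this (pertProfile st η (frameLam lam (σ t)) (scaling s η)).re
    · simp only [Fin.mk_one]
      -- Scaling coefficient, tested with `η`.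
      obtain ⟨A, hA0, hA⟩ := hη.exists_im_staticPair_self_le hN hs hsN
      obtain ⟨B, hB0, hB⟩ := hη.exists_pertPair_sub_le hN hs hst0 hst L n0
      obtain ⟨D, hD0, hD⟩ := n0.exists_tangentPair_le s
      refine ⟨(A + B + D) / |deriv (mass s η) 1|, by positivity, fun ε T ψ σ h t ht hn => ?_⟩
      have hw := h.memH1_fluctuation hN hs hη ht
      have hμ := h.pos t ht
      have e := h.modulation_re hN hs hη n0 (fun r hr => (h.pair_eq_zero hN hs hη hr).1) ht
      rw [hη.tangentPair_self_re hN hs] at e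
      refine combine_bounds hm' hA0 hB0 hD0 (normH1_nonneg _) (norm_nonneg _) hμ.le
        (mul_nonneg h.eps_nonneg (Real.rpow_nonneg hμ.le _)) (hA _ hw hn)
        ((Complex.abs_im_le_norm _).trans
          (hB _ (aestronglyMeasurable_frameLam hlam hμ) (abs_frameLam_le hlam hμ) _ hw hn))
        (d := -(tangentPair s (Xtilde T σ t) (fluctuation s η (ψ t) (σ t)) η).re)
        (by rw [abs_neg]; exact (Complex.abs_re_le_norm _).trans (hD _ _ hw)) ?_
      rw [← abs_neg]
      congr 1
      rw [Yelem_apply, lyapunovSchmidt_scaling, Complex.sub_im, pertProfile_im]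
      -- The variation of the mass contributes `-2 m'(1)` times the scaling coefficient, against
      -- `-m'(1)` on the left-hand side, so one copy remains.
      have e' := IsSolitonProfile.deriv_mass_one (N := N) (η := η) hs
      linear_combination -e - 2 * Xtilde T σ t (.inr (.inr 1)) * e'

theorem exists_norm_le (hN : 1 ≤ N) (hs : 0 < s) (hsN : s < 2 / (N : ℝ)) (hst0 : 0 ≤ st)
    (hst : 3 ≤ N → st < 2 / ((N : ℝ) - 2)) (hlam : MemLp lam ⊤ volume)
    (hη : IsSolitonProfile s η) :
    ∃ C, 0 ≤ C ∧ ∀ (ε T : ℝ) (ψ : ℝ → Space N → ℂ) (σ : ℝ → Param N),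
      IsDecomposition s st lam η ε T ψ σ → ∀ t ∈ Icc 0 T,
      normH1 (fluctuation s η (ψ t) (σ t)) ≤ 1 →
      ‖Yelem s st lam η ε T σ t‖ ≤ C * errorBound s st η ε T ψ σ t := by
  choose C hC0 hC using fun α => exists_component_le hN hs hsN hst0 hst hlam hη α
  have S0 := Finset.sum_nonneg fun α (_ : α ∈ Finset.univ) => hC0 α
  refine ⟨∑ α, C α, S0, fun ε T ψ σ h t ht hn => ?_⟩
  have E0 := h.errorBound_nonneg ht
  refine (pi_norm_le_iff_of_nonneg (mul_nonneg S0 E0)).2 fun α => ?_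
  refine (hC α ε T ψ σ h t ht hn).trans ?_
  exact mul_le_mul_of_nonneg_right
    (Finset.single_le_sum (fun β _ => hC0 β) (Finset.mem_univ α)) E0

end IsDecomposition

/-- Absorption of the linear term. -/
theorem absorb_bound {C K M B Y X n μ e ε : ℝ} (hC : 0 ≤ C) (hK : 0 ≤ K) (hM : 0 ≤ M) (hB : 0 ≤ B)
    (hY : 0 ≤ Y) (hn : 0 ≤ n) (hnc : 2 * C * n ≤ 1) (hε : 0 ≤ ε) (hμ : μ ≤ M) (he : e ≤ ε * B)
    (hX : X ≤ Y + e * K) (h : Y ≤ C * (X * n + μ * n ^ 2 + e * n)) :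
    Y ≤ 2 * C * ((K + 1) * B + M) * (ε * n + n ^ 2) := by
  have h1 : X * n + μ * n ^ 2 + e * n ≤
      Y * n + ((K + 1) * (ε * B) * n + M * n ^ 2) := by
    calc X * n + μ * n ^ 2 + e * n ≤ (Y + ε * B * K) * n + M * n ^ 2 + ε * B * n := by
          gcongr
          exact hX.trans (by gcongr)
      _ = _ := by ring
  have h2 : Y ≤ C * n * Y + C * ((K + 1) * (ε * B) * n + M * n ^ 2) :=
    (h.trans (mul_le_mul_of_nonneg_left h1 hC)).trans (le_of_eq (by ring))
  -- Smallness of `n` makes the linear term at most half of `Y`, hence the factor `2 C` in the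
  -- conclusion.
  have h3 : C * n * Y ≤ 1 / 2 * Y := by gcongr; linarith
  have h4 : (K + 1) * (ε * B) * n + M * n ^ 2 ≤ ((K + 1) * B + M) * (ε * n + n ^ 2) := by
    have : 0 ≤ (K + 1) * B * n ^ 2 + M * (ε * n) := by positivity
    linarith
  have h5 := mul_le_mul_of_nonneg_left h4 hC
  linarith

end

end SolitonNLS

/-! ### Choice of the threshold and of the constant -/

theorem proposition3p1
    (N : ℕ) (hN : 1 ≤ N)
    (s st : ℝ) (hs0 : 0 < s) (hs : s < 2 / (N : ℝ))
    (hst0 : 0 ≤ st) (hst : 3 ≤ N → st < 2 / ((N : ℝ) - 2))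
    (lam : Space N → ℝ) (hlam : MemLp lam ⊤ volume)
    (η : Space N → ℝ) (hη : IsSolitonProfile s η)
    (I : Set ℝ) (hIpos : I ⊆ Ioi 0) (hIbdd : Bornology.IsBounded I) :
    ∃ c ∈ Ioo (0 : ℝ) 1, ∃ C : ℝ, 0 < C ∧
      ∀ (I₀ : Set ℝ), I₀ ⊆ I \ frontier I →
      ∀ (ε : ℝ), ε ∈ Ico (0 : ℝ) 1 →
      ∀ (δ : ℝ), 0 < δ →
      ∀ (T : ℝ), 0 < T →
      ∀ (ψ : ℝ → Space N → ℂ) (σ : ℝ → Param N),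
        IsNLSSolution s st lam ε T ψ →
        (∀ t ∈ Icc 0 T, ψ t ∈ nbhd s η I₀ δ) →
        IsDifferentiablePath T σ →
        (∀ t ∈ Icc 0 T, (σ t).μ ∈ I ∧ IsSkewOrthogonal s η (ψ t) (σ t)) →
        ∀ t ∈ Icc 0 T, normH1 (fluctuation s η (ψ t) (σ t)) < c →
          ‖Yelem s st lam η ε T σ t‖ ≤
            C * (ε * normH1 (fluctuation s η (ψ t) (σ t))
              + normH1 (fluctuation s η (ψ t) (σ t)) ^ 2) := by
  obtain ⟨C, hC0, hC⟩ := IsDecomposition.exists_norm_le hN hs0 hs hst0 hst hlam hη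
  obtain ⟨K, hK0, hK⟩ := hη.exists_lyapunovSchmidt_le hN hs0 hst0 (eLpNorm lam ⊤ volume).toReal
  -- Boundedness of `I` replaces `μ` and `μ^{s̃/s}` by constants independent of time and of the
  -- path.
  obtain ⟨M, hM0, hM⟩ := hIbdd.exists_pos_norm_le
  have hB0 : 0 ≤ M ^ (st / s) := Real.rpow_nonneg hM0.le _
  -- A fluctuation below `1 / (2 C + 2)` satisfies the absorption condition `2 C n ≤ 1` and lies in
  -- the unit ball where the Sobolev bounds hold. The summand `2` also covers `C = 0`.
  have hc1 : 1 / (2 * C + 2) ≤ 1 / 2 := one_div_le_one_div_of_le two_pos (by linarith)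
  refine ⟨1 / (2 * C + 2), ⟨by positivity, by linarith⟩,
    -- The summand `1` only secures strict positivity.
    2 * C * ((K + 1) * M ^ (st / s) + M) + 1, by positivity,
    fun I₀ _ ε hε δ _ T hT ψ σ hψ _ hσ hI t ht hw => ?_⟩
  have hd : IsDecomposition s st lam η ε T ψ σ :=
    ⟨hε.1, hT, hψ, hσ, fun r hr => hIpos (hI r hr).1, fun r hr => (hI r hr).2⟩
  have hμ : 0 < (σ t).μ := hd.pos t ht
  have hμM : (σ t).μ ≤ M := (Real.le_norm_self _).trans (hM _ (hI t ht).1)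
  set n := normH1 (fluctuation s η (ψ t) (σ t)) with hn
  have hn0 : 0 ≤ n := normH1_nonneg _
  have hnc : 2 * C * n ≤ 1 := by
    calc 2 * C * n ≤ (2 * C + 2) * (1 / (2 * C + 2)) := by gcongr; linarith
      _ = 1 := mul_one_div_cancel (by positivity)
  have he : ε * (σ t).μ ^ (st / s) ≤ ε * M ^ (st / s) :=
    mul_le_mul_of_nonneg_left (Real.rpow_le_rpow hμ.le hμM (div_nonneg hst0 hs0.le)) hε.1
  -- The two elements differ by the projected perturbation, whose norm is bounded by `K` in every
  -- frame; this closes the estimate in terms of `Y` alone.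
  have hX : ‖Xtilde T σ t‖ ≤ ‖Yelem s st lam η ε T σ t‖ + ε * (σ t).μ ^ (st / s) * K := by
    have e0 : 0 ≤ ε * (σ t).μ ^ (st / s) := mul_nonneg hε.1 (Real.rpow_nonneg hμ.le _)
    have e1 : Xtilde T σ t = Yelem s st lam η ε T σ t + (ε * (σ t).μ ^ (st / s)) •
        lyapunovSchmidt s η (fun x => Complex.I * (frameLam lam (σ t) x : ℂ) *
          ((η x ^ (2 * st + 1) : ℝ) : ℂ)) := (sub_add_cancel _ _).symm
    calc ‖Xtilde T σ t‖ ≤ _ := (congrArg norm e1).le.trans (norm_add_le _ _)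
      _ ≤ _ := by
        rw [norm_smul, Real.norm_of_nonneg e0]
        gcongr
        exact hK _ (abs_frameLam_le hlam hμ)
  have h := absorb_bound hC0 hK0 hM0.le hB0 (norm_nonneg _) hn0 hnc hε.1 hμM he hX
    (hC ε T ψ σ hd t ht (by linarith))
  have : 0 ≤ ε * n + n ^ 2 := add_nonneg (mul_nonneg hε.1 hn0) (sq_nonneg n)
  linarith
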